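/- Let $(\mathcal R,\mu)$ be a $\sigma$-finite measure space. For a measurable function $f$ with values in the extended complex numbers let $f^*(t)=\inf\{s\ge 0:\mu(\{|f|>s\})\le t\}$, $t\ge 0$, be its non-increasing rearrangement. Assume that $(\mathcal R,\mu)$ is resonant, i.e. $\sup\{\int_{\mathcal R}|f\tilde g|\,d\mu:\tilde g^*=g^*\}=\int_0^\infty f^*g^*\,d\lambda$ for all measurable $f,g$. Let $X=\{f:\|f\|_X<\infty\}$ be a rearrangement-invariant (r.i.) Banach function space over $(\mathcal R,\mu)$. That is, $\|\cdot\|_X$ maps measurable functions (modulo equality a.e.) to $[0,\infty]$, $\|f\|_X=\||f|\|_X$, $\|f\|_X=\|g\|_X$ whenever $f^*=g^*$, and on non-negative functions: it is absolutely homogeneous, subadditive, and vanishes only at functions that are $0$ a.e.; $f\le g$ a.e. implies $\|f\|_X\le\|g\|_X$; $f_n\uparrow f$ a.e. implies $\|f_n\|_X\uparrow\|f\|_X$; and if $\mu(E)<\infty$, then $\|\chi_E\|_X<\infty$ and $\int_E f\,d\mu\le C_E\|f\|_X$ for all $f\ge 0$ with a finite constant $C_E$. Let $X'$ be the associate space,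 given by $\|\varphi\|_{X'}=\sup_{g\in X}\|g\|_X^{-1}\int_{\mathcal R}|\varphi g|\,d\mu$ (with $0/0=0$), which is again an r.i. Banach function space. On $X$ let $w'=\sigma(X,X')$ be the weak topology induced by the functionals $f\mapsto\int_{\mathcal R}\varphi f\,d\mu$, $\varphi\in X'$, and let $\xi$ be the locally convex topology induced by the seminorms $|f|_\varphi=\int_0^\infty\varphi^*f^*\,d\lambda$, $\varphi\in X'$; the topologies $w'$ and $\xi$ on $X'$ are defined in the same way with $X'$ and $X''=(X')'$ in place of $X$ and $X'$. Linear operators $S$ on $X$ and $S'$ on $X'$ are associate if $\int_{\mathcal R}S(f)\varphi\,d\mu=\int_{\mathcal R}fS'(\varphi)\,d\mu$ for all $f\in X$, $\varphi\in X'$. Assume that both $X$ and $X'$ have the (ACR) property, i.e. $\lim_{t\to\infty}f^*(t)=0$ for every $f\in X$ and for every $f\in X'$. Let $\phi:\mathcal R\to\mathcal R$ be power-measure-bounded, i.e. measurable and such that there is $A\in(0,\infty)$ with $\mu(\phi^{-n}(E))\le A\mu(E)$ for all $n\ge 1$ and all measurable $E$. Then: (1) The composition operator $T_\phi f=f\circ\phi$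 is a well-defined linear operator from $X$ to $X$, it is $\xi$-continuous, and it has an associate operator $T_\phi'$ on $X'$, which is $\xi$-continuous as well. The operator $T_\phi$ is mean ergodic on $(X,\xi)$: there is a $\xi$-continuous linear operator $T:X\to X$ such that for every $f\in X$ $$\frac1n\sum_{i=0}^{n-1}T_\phi^i f\to Tf\quad\text{in }(X,\xi)\text{ as }n\to\infty .$$ (2) $T$ is positive and is also continuous from $(X,w')$ to $(X,w')$ and from $(X,\|\cdot\|_X)$ to $(X,\|\cdot\|_X)$. (3) $T$ has an associate operator $T'$ on $X'$, which is continuous with respect to each of $\|\cdot\|_{X'}$, $\xi$ and $w'$, and for every $\varphi\in X'$ $$\frac1n\sum_{i=0}^{n-1}(T_\phi')^i\varphi\to T'\varphi\quad\text{in }(X',\xi)\text{ as }n\to\infty .$$ (4) $T$ and $T'$ are projections onto $\operatorname{Ker}(I-T_\phi)$ and $\operatorname{Ker}(I-T_\phi')$, respectively; $I-T$ and $I-T'$ are projections onto $\overline{\operatorname{Im}(I-T_\phi)}^{\xi}$ and $\overline{\operatorname{Im}(I-T_\phi')}^{\xi}$, respectively; and $$X=\operatorname{Ker}(I-T_\phi)\oplus\overline{\operatorname{Im}(I-T_\phi)}^{\xi},\qquad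 X'=\operatorname{Ker}(I-T_\phi')\oplus\overline{\operatorname{Im}(I-T_\phi')}^{\xi}.$$ -/

import Mathlib

open MeasureTheory Filter Topology
open scoped ENNReal NNReal

/-! Functions with values in `[0, ∞]` play the role of the moduli of extended complex valued
functions; complex valued functions that are finite a.e. are represented by the classes
`R →ₘ[μ] ℂ`. -/

section Rearrangement

variable {R : Type*} [MeasurableSpace R]

/-- The non-increasing rearrangement of (the modulus of) a function:
`f^*(t) = inf {s ∈ [0, ∞) ; μ {|f| > s} ≤ t}` for `t ≥ 0`, with `inf ∅ = ∞`.
For `t < 0` the value is that at `t = 0`. -/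
noncomputable def rearrangement (μ : Measure R) (f : R → ℝ≥0∞) (t : ℝ) : ℝ≥0∞ :=
  ⨅ (s : ℝ≥0) (_ : μ {x | (s : ℝ≥0∞) < f x} ≤ ENNReal.ofReal t), (s : ℝ≥0∞)

/-- The integral `∫₀^∞ f^* g^* dλ`. -/
noncomputable def rearrangementPairing (μ : Measure R) (f g : R → ℝ≥0∞) : ℝ≥0∞ :=
  ∫⁻ t in Set.Ioi (0 : ℝ), rearrangement μ f t * rearrangement μ g t

/-- Resonant measure spaces: `sup {∫ |f g̃| dμ ; g̃^* = g^*} = ∫₀^∞ f^* g^* dλ` for all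
measurable `f` and `g`. -/
class IsResonant (μ : Measure R) : Prop where
  iSup_eq : ∀ f g : R → ℝ≥0∞, Measurable f → Measurable g →
    ⨆ (h : R → ℝ≥0∞) (_ : Measurable h) (_ : rearrangement μ h = rearrangement μ g),
      ∫⁻ x, f x * h x ∂μ = rearrangementPairing μ f g

theorem rearrangementPairing_comm (μ : Measure R) (f g : R → ℝ≥0∞) :
    rearrangementPairing μ f g = rearrangementPairing μ g f := by
  simp only [rearrangementPairing, mul_comm]

theorem rearrangement_congr_ae {μ : Measure R} {f g : R → ℝ≥0∞} (h : f =ᵐ[μ] g) :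
    rearrangement μ f = rearrangement μ g := by
  have key : ∀ s : ℝ≥0, μ {x | (s : ℝ≥0∞) < f x} = μ {x | (s : ℝ≥0∞) < g x} := fun s => by
    refine measure_congr ?_
    filter_upwards [h] with x hx
    show ((s : ℝ≥0∞) < f x) = ((s : ℝ≥0∞) < g x)
    rw [hx]
  funext t
  simp only [rearrangement, key]

theorem lintegral_le_rearrangementPairing {μ : Measure R} [IsResonant μ] {f g h : R → ℝ≥0∞}
    (hf : Measurable f) (hg : Measurable g) (hh : Measurable h)
    (e : rearrangement μ h = rearrangement μ g) :
    ∫⁻ x, f x * h x ∂μ ≤ rearrangementPairing μ f g := by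
  rw [← IsResonant.iSup_eq f g hf hg]
  exact le_iSup_of_le h (le_iSup_of_le hh (le_iSup_of_le e le_rfl))

theorem rearrangementPairing_le {μ : Measure R} [IsResonant μ] {f g : R → ℝ≥0∞} {C : ℝ≥0∞}
    (hf : Measurable f) (hg : Measurable g)
    (H : ∀ h, Measurable h → rearrangement μ h = rearrangement μ g →
      ∫⁻ x, f x * h x ∂μ ≤ C) :
    rearrangementPairing μ f g ≤ C := by
  rw [← IsResonant.iSup_eq f g hf hg]
  exact iSup_le fun h => iSup_le fun hh => iSup_le fun e => H h hh e

end Rearrangement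

/-- A rearrangement-invariant Banach function norm, given by its restriction to the cone of
measurable functions with values in `[0, ∞]`. The values of `toFun` at functions that are not
measurable are irrelevant. -/
structure RIBanachFunctionNorm {R : Type*} [MeasurableSpace R] (μ : Measure R) where
  toFun : (R → ℝ≥0∞) → ℝ≥0∞
  smul' : ∀ (c : ℝ≥0) (f : R → ℝ≥0∞), Measurable f → toFun (fun x => c * f x) = c * toFun f
  eq_zero_iff' : ∀ f : R → ℝ≥0∞, Measurable f → (toFun f = 0 ↔ f =ᵐ[μ] 0)
  add_le' : ∀ f g : R → ℝ≥0∞, Measurable f → Measurable g →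
    toFun (fun x => f x + g x) ≤ toFun f + toFun g
  mono' : ∀ f g : R → ℝ≥0∞, Measurable f → Measurable g → f ≤ᵐ[μ] g → toFun f ≤ toFun g
  fatou' : ∀ (f : ℕ → R → ℝ≥0∞) (g : R → ℝ≥0∞), (∀ n, Measurable (f n)) → Measurable g →
    (∀ᵐ x ∂μ, Monotone (fun n => f n x) ∧ Tendsto (fun n => f n x) atTop (𝓝 (g x))) →
    Tendsto (fun n => toFun (f n)) atTop (𝓝 (toFun g))
  indicator_lt_top' : ∀ E : Set R, MeasurableSet E → μ E < ∞ →
    toFun (E.indicator fun _ => 1) < ∞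
  setLIntegral_le' : ∀ E : Set R, MeasurableSet E → μ E < ∞ →
    ∃ C : ℝ≥0, ∀ f : R → ℝ≥0∞, Measurable f → ∫⁻ x in E, f x ∂μ ≤ C * toFun f
  rearrangement_invariant' : ∀ f g : R → ℝ≥0∞, Measurable f → Measurable g →
    rearrangement μ f = rearrangement μ g → toFun f = toFun g

namespace RIBanachFunctionNorm

variable {R : Type*} [MeasurableSpace R] {μ : Measure R}

theorem congr_ae (X : RIBanachFunctionNorm μ) {f g : R → ℝ≥0∞} (hf : Measurable f)
    (hg : Measurable g) (h : f =ᵐ[μ] g) : X.toFun f = X.toFun g :=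
  le_antisymm (X.mono' f g hf hg h.le) (X.mono' g f hg hf h.symm.le)

section Associate

/-- The associate functional `‖f‖_{X'} = sup {‖g‖_X⁻¹ ∫ |f g| dμ ; ‖g‖_X < ∞}`, where
`0 / 0 = 0` and `a / 0 = ∞` for `a > 0` (this is the division of `[0, ∞]`). -/
noncomputable def associateFun (X : RIBanachFunctionNorm μ) (f : R → ℝ≥0∞) : ℝ≥0∞ :=
  ⨆ (g : R → ℝ≥0∞) (_ : Measurable g) (_ : X.toFun g < ∞), (∫⁻ x, f x * g x ∂μ) / X.toFun g

theorem lintegral_mul_le (X : RIBanachFunctionNorm μ) (f : R → ℝ≥0∞) {g : R → ℝ≥0∞}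
    (hg : Measurable g) (hgX : X.toFun g < ∞) :
    ∫⁻ x, f x * g x ∂μ ≤ X.associateFun f * X.toFun g := by
  by_cases h0 : X.toFun g = 0
  · have hg0 := (X.eq_zero_iff' g hg).1 h0
    have : ∫⁻ x, f x * g x ∂μ = 0 := by
      rw [← lintegral_zero (μ := μ)]
      refine lintegral_congr_ae ?_
      filter_upwards [hg0] with x hx
      simp [hx]
    simp [this]
  · rw [← ENNReal.div_le_iff h0 hgX.ne]
    exact le_iSup_of_le g (le_iSup_of_le hg (le_iSup_of_le hgX le_rfl))

theorem associateFun_le (X : RIBanachFunctionNorm μ) {f : R → ℝ≥0∞} {C : ℝ≥0∞}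
    (H : ∀ g, Measurable g → X.toFun g < ∞ → ∫⁻ x, f x * g x ∂μ ≤ C * X.toFun g) :
    X.associateFun f ≤ C :=
  iSup_le fun g => iSup_le fun hg => iSup_le fun hgX => ENNReal.div_le_of_le_mul (H g hg hgX)

theorem associateFun_mono (X : RIBanachFunctionNorm μ) {f g : R → ℝ≥0∞} (h : f ≤ᵐ[μ] g) :
    X.associateFun f ≤ X.associateFun g := by
  refine X.associateFun_le fun k hk hkX => le_trans (lintegral_mono_ae ?_)
    (X.lintegral_mul_le g hk hkX)
  filter_upwards [h] with x hx
  gcongr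

theorem associateFun_ri [IsResonant μ] (X : RIBanachFunctionNorm μ) {f g : R → ℝ≥0∞}
    (hf : Measurable f) (hg : Measurable g) (e : rearrangement μ f = rearrangement μ g) :
    X.associateFun f ≤ X.associateFun g := by
  refine X.associateFun_le fun k hk hkX => ?_
  calc ∫⁻ x, f x * k x ∂μ = ∫⁻ x, k x * f x ∂μ := by simp only [mul_comm]
    _ ≤ rearrangementPairing μ k g := lintegral_le_rearrangementPairing hk hg hf e
    _ = rearrangementPairing μ g k := rearrangementPairing_comm _ _ _
    _ ≤ X.associateFun g * X.toFun k := rearrangementPairing_le hg hk fun h hh eh => by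
        have : X.toFun h = X.toFun k := X.rearrangement_invariant' h k hh hk eh
        rw [← this]
        exact X.lintegral_mul_le g hh (this ▸ hkX)

/-- The associate norm of an r.i. Banach function norm over a resonant measure space. -/
noncomputable def associate [SigmaFinite μ] [IsResonant μ] (X : RIBanachFunctionNorm μ) :
    RIBanachFunctionNorm μ where
  toFun := X.associateFun
  smul' c f hf := by
    simp only [associateFun, ENNReal.mul_iSup]
    refine iSup_congr fun g => iSup_congr fun hg => iSup_congr fun _ => ?_
    have : ∫⁻ x, c * f x * g x ∂μ = c * ∫⁻ x, f x * g x ∂μ := by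
      simp only [mul_assoc]
      exact lintegral_const_mul _ (hf.fun_mul hg)
    rw [this, mul_div_assoc]
  eq_zero_iff' f hf := by
    constructor
    · intro h0
      refine ae_of_forall_measure_lt_top_ae_restrict _ fun E hE hEμ => ?_
      have h1 := X.lintegral_mul_le f (g := E.indicator fun _ => 1)
        (measurable_const.indicator hE) (X.indicator_lt_top' E hE hEμ)
      rw [h0, zero_mul] at h1
      have h2 : ∫⁻ x in E, f x ∂μ = 0 := by
        rw [← lintegral_indicator hE, ← nonpos_iff_eq_zero]
        refine le_trans (le_of_eq (lintegral_congr fun x => ?_)) h1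
        by_cases hx : x ∈ E <;> simp [hx]
      exact (lintegral_eq_zero_iff hf).1 h2
    · intro h0
      rw [← nonpos_iff_eq_zero]
      refine X.associateFun_le fun g hg _ => ?_
      rw [zero_mul, nonpos_iff_eq_zero, ← lintegral_zero (μ := μ)]
      refine lintegral_congr_ae ?_
      filter_upwards [h0] with x hx
      simp [hx]
  add_le' f g hf _ := by
    refine X.associateFun_le fun k hk hkX => ?_
    simp only [add_mul]
    rw [lintegral_add_left (hf.fun_mul hk)]
    exact add_le_add (X.lintegral_mul_le f hk hkX) (X.lintegral_mul_le g hk hkX)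
  mono' _ _ _ _ h := X.associateFun_mono h
  fatou' f g hf hg h := by
    have hle : ∀ n, f n ≤ᵐ[μ] g := fun n => by
      filter_upwards [h] with x hx
      exact hx.1.ge_of_tendsto hx.2 n
    have hmono : Monotone fun n => X.associateFun (f n) := fun m n hmn => by
      refine X.associateFun_mono ?_
      filter_upwards [h] with x hx
      exact hx.1 hmn
    have hsup : X.associateFun g = ⨆ n, X.associateFun (f n) := by
      refine le_antisymm ?_ (iSup_le fun n => X.associateFun_mono (hle n))
      refine X.associateFun_le fun k hk hkX => ?_
      have hae : ∀ᵐ x ∂μ, Monotone fun n => f n x * k x := by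
        filter_upwards [h] with x hx m n hmn
        exact mul_le_mul_left (hx.1 hmn) _
      have : ∫⁻ x, g x * k x ∂μ = ⨆ n, ∫⁻ x, f n x * k x ∂μ := by
        rw [← lintegral_iSup' (fun n => ((hf n).fun_mul hk).aemeasurable) hae]
        refine lintegral_congr_ae ?_
        filter_upwards [h] with x hx
        rw [← ENNReal.iSup_mul, tendsto_nhds_unique hx.2 (tendsto_atTop_iSup hx.1)]
      rw [this]
      refine iSup_le fun n => (X.lintegral_mul_le (f n) hk hkX).trans ?_
      exact mul_le_mul_left (le_iSup (fun n => X.associateFun (f n)) n) _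
    rw [hsup]
    exact tendsto_atTop_iSup hmono
  indicator_lt_top' E hE hEμ := by
    obtain ⟨C, hC⟩ := X.setLIntegral_le' E hE hEμ
    refine lt_of_le_of_lt (X.associateFun_le (C := C) fun g hg _ => ?_) ENNReal.coe_lt_top
    refine le_trans (le_of_eq ?_) (hC g hg)
    rw [← lintegral_indicator hE]
    refine lintegral_congr fun x => ?_
    by_cases hx : x ∈ E <;> simp [hx]
  setLIntegral_le' E hE hEμ := by
    have hlt := X.indicator_lt_top' E hE hEμ
    refine ⟨(X.toFun (E.indicator fun _ => 1)).toNNReal, fun f hf => ?_⟩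
    rw [ENNReal.coe_toNNReal hlt.ne, mul_comm]
    refine le_trans (le_of_eq ?_) (X.lintegral_mul_le f (measurable_const.indicator hE) hlt)
    rw [← lintegral_indicator hE]
    refine lintegral_congr fun x => ?_
    by_cases hx : x ∈ E <;> simp [hx]
  rearrangement_invariant' _ _ hf hg e :=
    le_antisymm (X.associateFun_ri hf hg e) (X.associateFun_ri hg hf e.symm)

end Associate

section Space

theorem measurable_enorm_coe (f : R →ₘ[μ] ℂ) : Measurable fun x => ‖f x‖ₑ :=
  f.stronglyMeasurable.enorm

/-- The extended norm `‖f‖_X` of a class of complex valued functions. -/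
noncomputable def enorm (X : RIBanachFunctionNorm μ) (f : R →ₘ[μ] ℂ) : ℝ≥0∞ :=
  X.toFun fun x => ‖f x‖ₑ

theorem enorm_zero (X : RIBanachFunctionNorm μ) : X.enorm 0 = 0 := by
  rw [enorm, X.eq_zero_iff' _ (measurable_enorm_coe _)]
  filter_upwards [AEEqFun.coeFn_zero (μ := μ) (β := ℂ)] with x hx
  simp [hx]

theorem enorm_add_le (X : RIBanachFunctionNorm μ) (f g : R →ₘ[μ] ℂ) :
    X.enorm (f + g) ≤ X.enorm f + X.enorm g := by
  have hf := measurable_enorm_coe f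
  have hg := measurable_enorm_coe g
  refine le_trans (X.mono' _ _ (measurable_enorm_coe _) (hf.add hg) ?_) (X.add_le' _ _ hf hg)
  filter_upwards [AEEqFun.coeFn_add f g] with x hx
  rw [hx]
  exact _root_.enorm_add_le _ _

theorem enorm_smul (X : RIBanachFunctionNorm μ) (c : ℂ) (f : R →ₘ[μ] ℂ) :
    X.enorm (c • f) = ‖c‖ₑ * X.enorm f := by
  have hf := measurable_enorm_coe f
  have h := X.smul' ‖c‖₊ _ hf
  refine Eq.trans (X.congr_ae (measurable_enorm_coe _) (hf.const_mul _) ?_) h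
  filter_upwards [AEEqFun.coeFn_smul c f] with x hx
  rw [hx, Pi.smul_apply, _root_.enorm_smul]
  rfl

theorem enorm_neg (X : RIBanachFunctionNorm μ) (f : R →ₘ[μ] ℂ) : X.enorm (-f) = X.enorm f := by
  refine X.congr_ae (measurable_enorm_coe _) (measurable_enorm_coe _) ?_
  filter_upwards [AEEqFun.coeFn_neg f] with x hx
  rw [hx, Pi.neg_apply, _root_.enorm_neg]

/-- The additive group `{f ; ‖f‖_X < ∞}`. -/
def addSubgroup (X : RIBanachFunctionNorm μ) : AddSubgroup (R →ₘ[μ] ℂ) where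
  carrier := {f | X.enorm f < ∞}
  add_mem' hf hg := lt_of_le_of_lt (X.enorm_add_le _ _) (ENNReal.add_lt_top.2 ⟨hf, hg⟩)
  zero_mem' := by simp [enorm_zero]
  neg_mem' hf := by
    rw [Set.mem_ofPred_eq, enorm_neg]
    exact hf

/-- The r.i. Banach function space `X = {f ; ‖f‖_X < ∞}`. -/
def Space (X : RIBanachFunctionNorm μ) : Type _ := X.addSubgroup

instance (X : RIBanachFunctionNorm μ) : CoeOut X.Space (R →ₘ[μ] ℂ) := ⟨Subtype.val⟩

noncomputable instance (X : RIBanachFunctionNorm μ) : AddCommGroup X.Space :=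
  inferInstanceAs (AddCommGroup X.addSubgroup)

noncomputable instance (X : RIBanachFunctionNorm μ) : SMul ℂ X.Space :=
  ⟨fun c f => ⟨c • (f : R →ₘ[μ] ℂ), by
    have hf : X.enorm (f : R →ₘ[μ] ℂ) < ∞ := f.2
    show X.enorm _ < ∞
    rw [enorm_smul]
    exact ENNReal.mul_lt_top enorm_lt_top hf⟩⟩

theorem coe_zero (X : RIBanachFunctionNorm μ) : ((0 : X.Space) : R →ₘ[μ] ℂ) = 0 := rfl

theorem coe_add (X : RIBanachFunctionNorm μ) (f g : X.Space) :
    ((f + g : X.Space) : R →ₘ[μ] ℂ) = (f : R →ₘ[μ] ℂ) + (g : R →ₘ[μ] ℂ) := rfl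

theorem coe_smul (X : RIBanachFunctionNorm μ) (c : ℂ) (f : X.Space) :
    ((c • f : X.Space) : R →ₘ[μ] ℂ) = c • (f : R →ₘ[μ] ℂ) := rfl

noncomputable instance (X : RIBanachFunctionNorm μ) : Module ℂ X.Space where
  one_smul f := Subtype.ext (one_smul ℂ (f : R →ₘ[μ] ℂ))
  mul_smul a b f := Subtype.ext (mul_smul a b (f : R →ₘ[μ] ℂ))
  smul_zero a := Subtype.ext (smul_zero (A := R →ₘ[μ] ℂ) a)
  smul_add a f g := Subtype.ext (smul_add a (f : R →ₘ[μ] ℂ) (g : R →ₘ[μ] ℂ))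
  add_smul a b f := Subtype.ext (add_smul a b (f : R →ₘ[μ] ℂ))
  zero_smul f := Subtype.ext (zero_smul ℂ (f : R →ₘ[μ] ℂ))

/-- The (ACR) property: `f^*(t) → 0` as `t → ∞` for every `f ∈ X`. -/
def HasACR (X : RIBanachFunctionNorm μ) : Prop :=
  ∀ f : X.Space, Tendsto (rearrangement μ fun x => ‖(f : R →ₘ[μ] ℂ) x‖ₑ) atTop (𝓝 0)

end Space

section Topologies

/-- The norm `‖·‖_X` on `X`. -/
noncomputable def normSeminorm (X : RIBanachFunctionNorm μ) : Seminorm ℂ X.Space :=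
  Seminorm.of (fun f => (X.enorm (f : R →ₘ[μ] ℂ)).toReal)
    (fun f g => by
      have hf : X.enorm (f : R →ₘ[μ] ℂ) < ∞ := f.2
      have hg : X.enorm (g : R →ₘ[μ] ℂ) < ∞ := g.2
      rw [← ENNReal.toReal_add hf.ne hg.ne]
      exact ENNReal.toReal_mono (ENNReal.add_lt_top.2 ⟨hf, hg⟩).ne (X.enorm_add_le _ _))
    (fun c f => by
      rw [coe_smul, enorm_smul, ENNReal.toReal_mul, toReal_enorm])

/-- The topology on `X` induced by the norm `‖·‖_X`. -/
noncomputable abbrev normTopology (X : RIBanachFunctionNorm μ) : TopologicalSpace X.Space :=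
  X.normSeminorm.toSeminormedAddCommGroup.toPseudoMetricSpace.toUniformSpace.toTopologicalSpace

theorem rearrangementPairing_add_le [IsResonant μ] (φ f g : R →ₘ[μ] ℂ) :
    rearrangementPairing μ (fun x => ‖φ x‖ₑ) (fun x => ‖(f + g) x‖ₑ) ≤
      rearrangementPairing μ (fun x => ‖φ x‖ₑ) (fun x => ‖f x‖ₑ) +
        rearrangementPairing μ (fun x => ‖φ x‖ₑ) (fun x => ‖g x‖ₑ) := by
  have hφ := measurable_enorm_coe φ
  have hf := measurable_enorm_coe f
  have hg := measurable_enorm_coe g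
  simp only [rearrangementPairing_comm μ (fun x => ‖φ x‖ₑ)]
  refine rearrangementPairing_le (measurable_enorm_coe _) hφ fun h hh e => ?_
  refine le_trans ?_ (add_le_add (lintegral_le_rearrangementPairing hf hφ hh e)
    (lintegral_le_rearrangementPairing hg hφ hh e))
  rw [← lintegral_add_left (hf.fun_mul hh)]
  refine lintegral_mono_ae ?_
  filter_upwards [AEEqFun.coeFn_add f g] with x hx
  rw [hx, ← add_mul]
  exact mul_le_mul_left (_root_.enorm_add_le _ _) _

theorem rearrangementPairing_smul_le [IsResonant μ] (φ : R →ₘ[μ] ℂ) (c : ℂ) (f : R →ₘ[μ] ℂ) :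
    rearrangementPairing μ (fun x => ‖φ x‖ₑ) (fun x => ‖(c • f) x‖ₑ) ≤
      ‖c‖ₑ * rearrangementPairing μ (fun x => ‖φ x‖ₑ) (fun x => ‖f x‖ₑ) := by
  have hφ := measurable_enorm_coe φ
  have hf := measurable_enorm_coe f
  simp only [rearrangementPairing_comm μ (fun x => ‖φ x‖ₑ)]
  refine rearrangementPairing_le (measurable_enorm_coe _) hφ fun h hh e => ?_
  refine le_trans ?_ (mul_le_mul_right (lintegral_le_rearrangementPairing hf hφ hh e) _)
  rw [← lintegral_const_mul _ (hf.fun_mul hh)]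
  refine lintegral_mono_ae ?_
  filter_upwards [AEEqFun.coeFn_smul c f] with x hx
  rw [hx, Pi.smul_apply, _root_.enorm_smul, mul_assoc]

variable [SigmaFinite μ] [IsResonant μ]

/-- `∫₀^∞ φ^* f^* dλ ≤ ‖f‖_X ‖φ‖_{X'}`. -/
theorem rearrangementPairing_le_enorm (X : RIBanachFunctionNorm μ) (φ f : R →ₘ[μ] ℂ)
    (hf : X.enorm f < ∞) :
    rearrangementPairing μ (fun x => ‖φ x‖ₑ) (fun x => ‖f x‖ₑ) ≤
      X.associate.enorm φ * X.enorm f := by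
  have hfm := measurable_enorm_coe f
  refine rearrangementPairing_le (measurable_enorm_coe φ) hfm fun h hh e => ?_
  have : X.toFun h = X.enorm f := X.rearrangement_invariant' h _ hh hfm e
  rw [← this]
  exact X.lintegral_mul_le _ hh (this ▸ hf)

theorem rearrangementPairing_ne_top (X : RIBanachFunctionNorm μ) (φ : X.associate.Space)
    (f : X.Space) :
    rearrangementPairing μ (fun x => ‖(φ : R →ₘ[μ] ℂ) x‖ₑ)
      (fun x => ‖(f : R →ₘ[μ] ℂ) x‖ₑ) ≠ ∞ :=
  (lt_of_le_of_lt (X.rearrangementPairing_le_enorm _ _ f.2) (ENNReal.mul_lt_top φ.2 f.2)).ne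

/-- For `φ ∈ X'`, the functional `|f|_φ = ∫₀^∞ φ^* f^* dλ` on `X`. -/
noncomputable def xiSeminorm (X : RIBanachFunctionNorm μ) :
    SeminormFamily ℂ X.Space X.associate.Space := fun φ =>
  Seminorm.ofSMulLE (fun f => (rearrangementPairing μ (fun x => ‖(φ : R →ₘ[μ] ℂ) x‖ₑ)
      (fun x => ‖(f : R →ₘ[μ] ℂ) x‖ₑ)).toReal)
    (by
      have h := X.rearrangementPairing_le_enorm (φ : R →ₘ[μ] ℂ) 0
        (by rw [enorm_zero]; exact ENNReal.zero_lt_top)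
      rw [enorm_zero, mul_zero, nonpos_iff_eq_zero] at h
      rw [coe_zero, h, ENNReal.toReal_zero])
    (fun f g => by
      have hf := X.rearrangementPairing_ne_top φ f
      have hg := X.rearrangementPairing_ne_top φ g
      rw [← ENNReal.toReal_add hf hg]
      exact ENNReal.toReal_mono (ENNReal.add_ne_top.2 ⟨hf, hg⟩)
        (rearrangementPairing_add_le _ _ _))
    (fun c f => by
      have hf := X.rearrangementPairing_ne_top φ f
      rw [← toReal_enorm c, ← ENNReal.toReal_mul]
      exact ENNReal.toReal_mono (ENNReal.mul_ne_top enorm_ne_top hf)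
        (rearrangementPairing_smul_le _ _ _))

/-- The rearrangement-invariant locally convex topology `ξ` on `X`, induced by the family
`|·|_φ`, `φ ∈ X'`. -/
noncomputable abbrev xi (X : RIBanachFunctionNorm μ) : TopologicalSpace X.Space :=
  X.xiSeminorm.moduleFilterBasis.topology

/-- The weak topology `w' = σ(X, X')` on `X`. -/
noncomputable abbrev weakPrime (X : RIBanachFunctionNorm μ) : TopologicalSpace X.Space :=
  ⨅ φ : X.associate.Space, TopologicalSpace.induced
    (fun f : X.Space => ∫ x, (φ : R →ₘ[μ] ℂ) x * (f : R →ₘ[μ] ℂ) x ∂μ) inferInstance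

/-- The closure of a linear subspace of `X` with respect to `ξ`. -/
noncomputable def xiClosure (X : RIBanachFunctionNorm μ) (V : Submodule ℂ X.Space) :
    Submodule ℂ X.Space :=
  letI : TopologicalSpace X.Space := X.xi
  have h : IsTopologicalAddGroup X.Space :=
    X.xiSeminorm.moduleFilterBasis.toAddGroupFilterBasis.isTopologicalAddGroup
  haveI : ContinuousAdd X.Space := h.toContinuousAdd
  haveI : ContinuousSMul ℂ X.Space := X.xiSeminorm.moduleFilterBasis.continuousSMul
  V.topologicalClosure

theorem coe_xiClosure (X : RIBanachFunctionNorm μ) (V : Submodule ℂ X.Space) :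
    (X.xiClosure V : Set X.Space) = @closure X.Space X.xi V :=
  rfl

end Topologies

section Operators

/-- Positivity: nonnegative functions are mapped to nonnegative functions. -/
def IsPositiveOperator (X : RIBanachFunctionNorm μ) (S : X.Space →ₗ[ℂ] X.Space) : Prop :=
  ∀ f : X.Space,
    (∀ᵐ x ∂μ, 0 ≤ ((f : R →ₘ[μ] ℂ) x).re ∧ ((f : R →ₘ[μ] ℂ) x).im = 0) →
    ∀ᵐ x ∂μ, 0 ≤ ((S f : R →ₘ[μ] ℂ) x).re ∧ ((S f : R →ₘ[μ] ℂ) x).im = 0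

/-- `S'` on `X'` is the associate operator of `S` on `X`. -/
def IsAssociateOperator [SigmaFinite μ] [IsResonant μ] (X : RIBanachFunctionNorm μ)
    (S : X.Space →ₗ[ℂ] X.Space) (S' : X.associate.Space →ₗ[ℂ] X.associate.Space) : Prop :=
  ∀ (f : X.Space) (φ : X.associate.Space),
    ∫ x, (S f : R →ₘ[μ] ℂ) x * (φ : R →ₘ[μ] ℂ) x ∂μ =
      ∫ x, (f : R →ₘ[μ] ℂ) x * (S' φ : R →ₘ[μ] ℂ) x ∂μ

end Operators

end RIBanachFunctionNorm

/-- The Cesàro mean `n⁻¹ ∑_{i < n} S^i f`. -/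
noncomputable def cesaroMean {E : Type*} [AddCommGroup E] [Module ℂ E] (S : E →ₗ[ℂ] E) (n : ℕ)
    (f : E) : E :=
  (n : ℂ)⁻¹ • ∑ i ∈ Finset.range n, (S ^ i) f

/-- `S` is mean ergodic on `(E, τ)` with limit operator `T`. -/
def IsMeanErgodicWithLimit {E : Type*} [AddCommGroup E] [Module ℂ E] (τ : TopologicalSpace E)
    (S T : E →ₗ[ℂ] E) : Prop :=
  Continuous[τ, τ] S ∧ Continuous[τ, τ] T ∧
    ∀ f : E, Tendsto (fun n => cesaroMean S n f) atTop (@nhds E τ (T f))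

/-- Power-measure-bounded maps: measurable maps for which there is `A ∈ (0, ∞)` such that
`μ (φ⁻ⁿ(E)) ≤ A μ(E)` for all `n ≥ 1` and all measurable `E`. -/
structure PowerMeasureBounded {R : Type*} [MeasurableSpace R] (μ : Measure R) (φ : R → R) :
    Prop where
  measurable : Measurable φ
  bound : ∃ A : ℝ≥0, 0 < A ∧ ∀ n : ℕ, 1 ≤ n → ∀ E : Set R, MeasurableSet E →
    μ (φ^[n] ⁻¹' E) ≤ A * μ E

theorem PowerMeasureBounded.quasiMeasurePreserving {R : Type*} [MeasurableSpace R]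
    {μ : Measure R} {φ : R → R} (h : PowerMeasureBounded μ φ) :
    Measure.QuasiMeasurePreserving φ μ μ := by
  refine ⟨h.measurable, Measure.AbsolutelyContinuous.mk fun E hE h0 => ?_⟩
  obtain ⟨A, -, hA⟩ := h.bound
  have := hA 1 le_rfl E hE
  rw [h0, mul_zero, Function.iterate_one, nonpos_iff_eq_zero] at this
  rwa [Measure.map_apply h.measurable hE]

/-- `S` is the composition operator `f ↦ f ∘ φ` on `X`. The class of `f ∘ φ` is well defined
since `φ` is non-singular. -/
def IsCompositionOperator {R : Type*} [MeasurableSpace R] {μ : Measure R}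
    (X : RIBanachFunctionNorm μ) {φ : R → R} (hφ : Measure.QuasiMeasurePreserving φ μ μ)
    (S : X.Space →ₗ[ℂ] X.Space) : Prop :=
  ∀ f : X.Space, (S f : R →ₘ[μ] ℂ) = (f : R →ₘ[μ] ℂ).compQuasiMeasurePreserving φ hφ

/-! ### Distribution functions, rearrangements and the pairing `∫ f^* g^*` -/

section RearrangementLemmas

variable {R : Type*} [MeasurableSpace R] {μ : Measure R}

/-! The theorem is proved in `L²` and then transported. On `L²` the composition operator `V` is
power bounded, because `μ(φ⁻ⁿ(E)) ≤ A μ(E)` bounds all image measures. The mean ergodic theorem in a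
Hilbert space therefore gives strong limits `Q` and `Q'` of the Cesàro means of `V` and of its
transpose `V'` (`exists_L2_operators`).

What survives outside `L²` is the estimate `∫ (W f)^* ψ^* ≤ A ∫ f^* ψ^*`, called `PairingBounded`.
For powers of `V` it is a dilation estimate: `(f ∘ φⁿ)^*(t) ≤ f^*(t / A)`. Resonance makes it
equivalent to a bound on the bilinear form `∫ W f · g` (`pairingBounded_of_enorm_integral_le`), and
in that form it passes to transposes, Cesàro means and strong limits with the same constant.

A pairing bounded operator extends from `X ∩ L²` to `X` (`exists_isExtension`). By (ACR) for `X`,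
every `f` is the `ξ`-limit of its restrictions to `1/(k+1) < |f| ≤ k+1`, which lie in `L²`. The
images are `ξ`-Cauchy and norm bounded, the latter by the Lorentz–Luxemburg theorem `X'' = X`, and
such sequences converge by the Fatou property (`exists_xi_limit`). By (ACR) for `X'`, `L²`
convergence together with domination in the pairing implies `ξ` convergence
(`tendsto_rearrangementPairing_of_tendsto_L2`), so the means converge on `X ∩ L²`, and by the
uniform bound on all of `X`.

Duality, positivity and the identification with `f ∘ φ` pass to the limit from `X ∩ L²`. The
decomposition is the general fact `isProj_of_tendsto_cesaroMean`. The statements on `X'` are the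
same ones for the pair `X'`, `X''`, where `X''` inherits (ACR) from `X`. -/

theorem rearrangement_le_iff {f : R → ℝ≥0∞} {t : ℝ} {s : ℝ≥0} :
    rearrangement μ f t ≤ s ↔ μ {x | (s : ℝ≥0∞) < f x} ≤ ENNReal.ofReal t := by
  refine ⟨fun h => ?_, fun h => iInf₂_le s h⟩
  -- The infimum is attained: along `u n ↓ s` the sets `{f > u n}` increase to `{f > s}`, and each
  -- of them already satisfies the measure bound.
  obtain ⟨u, hu, hus, hlim⟩ := exists_seq_strictAnti_tendsto s
  have hU : {x | (s : ℝ≥0∞) < f x} = ⋃ n, {x | (u n : ℝ≥0∞) < f x} := by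
    ext x
    simp only [Set.mem_ofPred_eq, Set.mem_iUnion]
    constructor
    · intro hx
      have hlim' : Tendsto (fun n => (u n : ℝ≥0∞)) atTop (𝓝 (s : ℝ≥0∞)) :=
        ENNReal.tendsto_coe.2 hlim
      exact (hlim'.eventually (gt_mem_nhds hx)).exists
    · rintro ⟨n, hn⟩
      exact lt_of_le_of_lt (by exact_mod_cast (hus n).le) hn
  have hmono : Monotone fun n => {x | (u n : ℝ≥0∞) < f x} := fun m n hmn x hx =>
    show (u n : ℝ≥0∞) < f x from
      lt_of_le_of_lt (ENNReal.coe_le_coe.2 (hu.antitone hmn)) (show (u m : ℝ≥0∞) < f x from hx)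
  rw [hU, hmono.measure_iUnion]
  refine iSup_le fun n => ?_
  have h1 : rearrangement μ f t < u n := lt_of_le_of_lt h (by exact_mod_cast hus n)
  simp only [rearrangement, iInf_lt_iff] at h1
  obtain ⟨r, hr, hrn⟩ := h1
  exact (measure_mono fun x (hx : (u n : ℝ≥0∞) < f x) => hrn.trans hx).trans hr

theorem rearrangement_mono_ae {f g : R → ℝ≥0∞} (h : f ≤ᵐ[μ] g) (t : ℝ) :
    rearrangement μ f t ≤ rearrangement μ g t := by
  refine le_iInf₂ fun s hs => rearrangement_le_iff.2 (le_trans (measure_mono_ae ?_) hs)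
  filter_upwards [h] with x hx hs
  exact lt_of_lt_of_le hs hx

theorem rearrangement_antitone (f : R → ℝ≥0∞) : Antitone (rearrangement μ f) := fun _ _ hst =>
  le_iInf₂ fun _ hr => rearrangement_le_iff.2 (hr.trans (ENNReal.ofReal_le_ofReal hst))

theorem measurable_rearrangement (f : R → ℝ≥0∞) : Measurable (rearrangement μ f) :=
  (rearrangement_antitone f).measurable

/-- The distribution function can be read off from the rearrangement by testing at `t = μ {g > s}`.
Functions with equal rearrangements are thus equimeasurable. -/
theorem measure_lt_le_of_rearrangement_eq {f g : R → ℝ≥0∞}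
    (h : rearrangement μ f = rearrangement μ g) (s : ℝ≥0) :
    μ {x | (s : ℝ≥0∞) < f x} ≤ μ {x | (s : ℝ≥0∞) < g x} := by
  by_cases htop : μ {x | (s : ℝ≥0∞) < g x} = ∞
  · rw [htop]; exact le_top
  · have h1 : rearrangement μ g (μ {x | (s : ℝ≥0∞) < g x}).toReal ≤ s :=
      rearrangement_le_iff.2 (by rw [ENNReal.ofReal_toReal htop])
    rw [← h, rearrangement_le_iff, ENNReal.ofReal_toReal htop] at h1
    exact h1

theorem ae_le_of_rearrangement_eq {f g : R → ℝ≥0∞} {c : ℝ≥0}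
    (h : rearrangement μ f = rearrangement μ g) (hg : ∀ᵐ x ∂μ, g x ≤ c) : ∀ᵐ x ∂μ, f x ≤ c := by
  have h1 := measure_lt_le_of_rearrangement_eq h c
  have h2 : μ {x | (c : ℝ≥0∞) < g x} = 0 := by
    rw [← compl_mem_ae_iff]
    filter_upwards [hg] with x hx
    simpa using hx
  rw [h2, nonpos_iff_eq_zero, ← compl_mem_ae_iff] at h1
  filter_upwards [h1] with x hx
  simpa using hx

theorem rearrangementPairing_mono {f f' g g' : R → ℝ≥0∞} (h : f ≤ᵐ[μ] f') (h' : g ≤ᵐ[μ] g') :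
    rearrangementPairing μ f g ≤ rearrangementPairing μ f' g' :=
  lintegral_mono fun t => mul_le_mul' (rearrangement_mono_ae h t) (rearrangement_mono_ae h' t)

theorem rearrangementPairing_congr {f f' g g' : R → ℝ≥0∞} (h : f =ᵐ[μ] f') (h' : g =ᵐ[μ] g') :
    rearrangementPairing μ f g = rearrangementPairing μ f' g' :=
  le_antisymm (rearrangementPairing_mono h.le h'.le)
    (rearrangementPairing_mono h.symm.le h'.symm.le)

theorem lintegral_mul_le_rearrangementPairing [IsResonant μ] {f g : R → ℝ≥0∞}
    (hf : Measurable f) (hg : Measurable g) :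
    ∫⁻ x, f x * g x ∂μ ≤ rearrangementPairing μ f g :=
  lintegral_le_rearrangementPairing hf hg hg rfl

/-- Rearrangement is not subadditive pointwise. Resonance replaces the pairing by integrals against
functions equimeasurable with `f`, which are additive in the other factor. -/
theorem rearrangementPairing_add_right_le [IsResonant μ] {f g h : R → ℝ≥0∞} (hf : Measurable f)
    (hg : Measurable g) (hh : Measurable h) :
    rearrangementPairing μ f (fun x => g x + h x) ≤
      rearrangementPairing μ f g + rearrangementPairing μ f h := by
  simp only [rearrangementPairing_comm μ f]
  refine rearrangementPairing_le (hg.add hh) hf fun k hk e => ?_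
  refine le_trans (le_of_eq ?_) (add_le_add (lintegral_le_rearrangementPairing hg hf hk e)
    (lintegral_le_rearrangementPairing hh hf hk e))
  rw [← lintegral_add_left (hg.fun_mul hk)]
  simp only [add_mul]

/-- Dilation estimate for the pairing. -/
theorem rearrangementPairing_le_of_dilation {A : ℝ≥0} (hA : 1 ≤ A) {f k : R → ℝ≥0∞}
    (h : ∀ t : ℝ, 0 < t → rearrangement μ k t ≤ rearrangement μ f ((A : ℝ)⁻¹ * t))
    (g : R → ℝ≥0∞) :
    rearrangementPairing μ k g ≤ A * rearrangementPairing μ f g := by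
  have hA0 : (0 : ℝ) < A := lt_of_lt_of_le one_pos (by exact_mod_cast hA)
  have hAi : (0 : ℝ) < (A : ℝ)⁻¹ := inv_pos.2 hA0
  set F : ℝ → ℝ≥0∞ := (Set.Ioi (0 : ℝ)).indicator
    fun t => rearrangement μ f t * rearrangement μ g t
  have hF : Measurable F :=
    ((measurable_rearrangement f).mul (measurable_rearrangement g)).indicator measurableSet_Ioi
  -- Since `A ≥ 1`, also `g^*(t) ≤ g^*(t / A)`. Both factors are then evaluated at `t / A`, and the
  -- substitution produces the factor `A`.
  have h1 : rearrangementPairing μ k g ≤ ∫⁻ t, F ((A : ℝ)⁻¹ * t) := by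
    rw [rearrangementPairing, ← lintegral_indicator measurableSet_Ioi]
    refine lintegral_mono fun t => ?_
    by_cases ht : 0 < t
    · have ht' : (0 : ℝ) < (A : ℝ)⁻¹ * t := mul_pos hAi ht
      simp only [F, Set.indicator_of_mem (Set.mem_Ioi.2 ht),
        Set.indicator_of_mem (Set.mem_Ioi.2 ht')]
      refine mul_le_mul' (h t ht) (rearrangement_antitone g ?_)
      calc (A : ℝ)⁻¹ * t ≤ 1 * t :=
            mul_le_mul_of_nonneg_right (inv_le_one_of_one_le₀ (by exact_mod_cast hA)) ht.le
        _ = t := one_mul t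
    · rw [Set.indicator_of_notMem (by simpa using ht)]
      exact zero_le
  refine h1.trans (le_of_eq ?_)
  rw [← lintegral_map hF (measurable_const_mul _), Real.map_volume_mul_left hAi.ne',
    lintegral_smul_measure, rearrangementPairing, ← lintegral_indicator measurableSet_Ioi, inv_inv,
    abs_of_pos hA0, ENNReal.ofReal_coe_nnreal, smul_eq_mul]

theorem rearrangement_comp_le {A : ℝ≥0} (hA : 0 < A) {τ : R → R}
    (hτA : ∀ E, MeasurableSet E → μ (τ ⁻¹' E) ≤ A * μ E) {f : R → ℝ≥0∞} (hf : Measurable f)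
    (t : ℝ) : rearrangement μ (f ∘ τ) t ≤ rearrangement μ f ((A : ℝ)⁻¹ * t) := by
  refine le_iInf₂ fun s hs => rearrangement_le_iff.2 ?_
  calc μ {x | (s : ℝ≥0∞) < (f ∘ τ) x} = μ (τ ⁻¹' {x | (s : ℝ≥0∞) < f x}) := rfl
    _ ≤ A * μ {x | (s : ℝ≥0∞) < f x} := hτA _ (measurableSet_lt measurable_const hf)
    _ ≤ A * ENNReal.ofReal ((A : ℝ)⁻¹ * t) := by gcongr
    _ = ENNReal.ofReal t := by
      rw [← ENNReal.ofReal_coe_nnreal, ← ENNReal.ofReal_mul A.coe_nonneg, mul_inv_cancel_left₀]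
      exact_mod_cast hA.ne'

/-- Cauchy–Schwarz for the pairing with a bounded function. -/
theorem rearrangementPairing_le_eLpNorm_two [IsResonant μ] {g h : R → ℝ≥0∞} {c : ℝ≥0}
    (hg : Measurable g) (hh : Measurable h) (hc : ∀ᵐ x ∂μ, h x ≤ c) :
    rearrangementPairing μ g h ≤
      c * ((∫⁻ x, g x ^ (2 : ℝ) ∂μ) ^ (1 / 2 : ℝ) * μ {x | 0 < h x} ^ (1 / 2 : ℝ)) := by
  refine rearrangementPairing_le hg hh fun k hk e => ?_
  -- A competitor `k` equimeasurable with `h` has the same essential bound and no larger support, so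
  -- the estimate is uniform in `k`.
  have hkc := ae_le_of_rearrangement_eq e hc
  have hm : μ {x | 0 < k x} ≤ μ {x | 0 < h x} := by
    simpa using measure_lt_le_of_rearrangement_eq e 0
  have hms : MeasurableSet {x | 0 < k x} := measurableSet_lt measurable_const hk
  calc ∫⁻ x, g x * k x ∂μ
      ≤ ∫⁻ x, c * (g x * {x | 0 < k x}.indicator 1 x) ∂μ := by
        refine lintegral_mono_ae ?_
        filter_upwards [hkc] with x hx
        by_cases h0 : 0 < k x
        · rw [Set.indicator_of_mem (show x ∈ {x | 0 < k x} from h0), Pi.one_apply, mul_one,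
            mul_comm]
          gcongr
        · simp [nonpos_iff_eq_zero.1 (not_lt.1 h0)]
    _ = c * ∫⁻ x, (g * {x | 0 < k x}.indicator (1 : R → ℝ≥0∞)) x ∂μ :=
        lintegral_const_mul _ (hg.mul (measurable_one.indicator hms))
    _ ≤ c * ((∫⁻ x, g x ^ (2 : ℝ) ∂μ) ^ (1 / 2 : ℝ) *
          (∫⁻ x, {x | 0 < k x}.indicator (1 : R → ℝ≥0∞) x ^ (2 : ℝ) ∂μ) ^ (1 / 2 : ℝ)) := by
        gcongr
        exact ENNReal.lintegral_mul_le_Lp_mul_Lq μ Real.HolderConjugate.two_two hg.aemeasurable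
          (measurable_one.indicator hms).aemeasurable
    _ = c * ((∫⁻ x, g x ^ (2 : ℝ) ∂μ) ^ (1 / 2 : ℝ) * μ {x | 0 < k x} ^ (1 / 2 : ℝ)) := by
        congr 3
        rw [← lintegral_indicator_one hms]
        refine lintegral_congr fun x => ?_
        by_cases h0 : x ∈ {x | 0 < k x}
        · simp [Set.indicator_of_mem h0]
        · simp [Set.indicator_of_notMem h0]
    _ ≤ _ := by gcongr

/-- The set where `1 / (k + 1) < f ≤ k + 1`. -/
def middleSet (f : R → ℝ≥0∞) (k : ℕ) : Set R :=
  {x | ((k + 1 : ℝ≥0)⁻¹ : ℝ≥0) < f x ∧ f x ≤ (k + 1 : ℝ≥0)}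

theorem measurableSet_middleSet {f : R → ℝ≥0∞} (hf : Measurable f) (k : ℕ) :
    MeasurableSet (middleSet f k) :=
  (measurableSet_lt measurable_const hf).inter (measurableSet_le hf measurable_const)

theorem measure_lt_top_of_tendsto_rearrangement {f : R → ℝ≥0∞}
    (h0 : Tendsto (rearrangement μ f) atTop (𝓝 0)) {s : ℝ≥0} (hs : 0 < s) :
    μ {x | (s : ℝ≥0∞) < f x} < ∞ := by
  have hs' : (0 : ℝ≥0∞) < s := by exact_mod_cast hs
  obtain ⟨t, ht⟩ := (h0.eventually (gt_mem_nhds hs')).exists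
  exact lt_of_le_of_lt (rearrangement_le_iff.1 ht.le) ENNReal.ofReal_lt_top

/-- Dominated convergence on the half-line with majorant `f^* g^*`. Off the middle set `f` is either
at most `1/(k+1)` or above `k+1`. The measure of the second set tends to `0`, because `f` is finite
a.e. and the decay of `f^*` makes `{f > 1}` of finite measure. Hence the rearrangement of the
remainder tends to `0` at every `t > 0`. -/
theorem tendsto_rearrangementPairing_compl_middleSet {f g : R → ℝ≥0∞} (hf : Measurable f)
    (hfin : ∀ᵐ x ∂μ, f x < ∞) (h0 : Tendsto (rearrangement μ f) atTop (𝓝 0))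
    (hfg : rearrangementPairing μ f g ≠ ∞) :
    Tendsto (fun k => rearrangementPairing μ ((middleSet f k)ᶜ.indicator f) g) atTop (𝓝 0) := by
  have hle : ∀ k, (middleSet f k)ᶜ.indicator f ≤ f := fun k => Set.indicator_le_self _ _
  have hlim0 : Tendsto (fun k : ℕ => μ {x | ((k + 1 : ℝ≥0) : ℝ≥0∞) < f x}) atTop (𝓝 0) := by
    have h1 := tendsto_measure_iInter_atTop (μ := μ)
      (s := fun k : ℕ => {x | ((k + 1 : ℝ≥0) : ℝ≥0∞) < f x})
      (fun k => (measurableSet_lt measurable_const hf).nullMeasurableSet)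
      (fun m n hmn x hx => show ((m + 1 : ℝ≥0) : ℝ≥0∞) < f x from lt_of_le_of_lt
        (ENNReal.coe_le_coe.2 (add_le_add (Nat.cast_le.2 hmn) le_rfl))
        (show ((n + 1 : ℝ≥0) : ℝ≥0∞) < f x from hx))
      ⟨0, (measure_lt_top_of_tendsto_rearrangement h0 (by simp)).ne⟩
    have h2 : μ (⋂ k : ℕ, {x | ((k + 1 : ℝ≥0) : ℝ≥0∞) < f x}) = 0 := by
      rw [← compl_mem_ae_iff]
      filter_upwards [hfin] with x hx hmem
      obtain ⟨n, hn⟩ := ENNReal.exists_nat_gt hx.ne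
      have h3 := Set.mem_iInter.1 hmem n
      have h4 : (n : ℝ≥0∞) ≤ ((n + 1 : ℝ≥0) : ℝ≥0∞) := by
        push_cast
        exact le_self_add
      exact absurd (h3.trans hn) (not_lt.2 h4)
    rw [h2] at h1
    exact h1
  have hpt : ∀ t : ℝ, 0 < t →
      Tendsto (fun k => rearrangement μ ((middleSet f k)ᶜ.indicator f) t) atTop (𝓝 0) := by
    intro t ht
    rw [ENNReal.tendsto_nhds_zero]
    intro ε hε
    obtain ⟨s, hs0, hsε⟩ := ENNReal.lt_iff_exists_nnreal_btwn.1 hε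
    have hs0' : 0 < s := by exact_mod_cast hs0
    have hinv : ∀ᶠ k : ℕ in atTop, (k + 1 : ℝ≥0)⁻¹ ≤ s := by
      have := tendsto_one_div_add_atTop_nhds_zero_nat (𝕜 := ℝ≥0)
      filter_upwards [this.eventually (gt_mem_nhds hs0')] with k hk
      simpa using hk.le
    have hm := hlim0.eventually (gt_mem_nhds (ENNReal.ofReal_pos.2 ht))
    filter_upwards [hinv, hm] with k hk hk'
    refine le_trans (rearrangement_le_iff.2 ((measure_mono ?_).trans hk'.le)) hsε.le
    intro x hx
    have hx' : (s : ℝ≥0∞) < (middleSet f k)ᶜ.indicator f x := hx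
    by_cases hxm : x ∈ middleSet f k
    · rw [Set.indicator_of_notMem (by simpa using hxm)] at hx'
      exact absurd hx' not_lt_zero
    · rw [Set.indicator_of_mem (by simpa using hxm)] at hx'
      by_contra hcon
      exact hxm ⟨lt_of_le_of_lt (by exact_mod_cast hk) hx', not_lt.1 hcon⟩
  have hlim := tendsto_lintegral_of_dominated_convergence (μ := volume.restrict (Set.Ioi (0 : ℝ)))
    (F := fun k t => rearrangement μ ((middleSet f k)ᶜ.indicator f) t * rearrangement μ g t)
    (f := fun _ => 0) (fun t => rearrangement μ f t * rearrangement μ g t)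
    (fun k => (measurable_rearrangement _).mul (measurable_rearrangement _))
    (fun k => ae_of_all _ fun t => mul_le_mul_left
      (rearrangement_mono_ae (ae_of_all _ (hle k)) t) _)
    hfg ?_
  · simpa [rearrangementPairing] using hlim
  · have hae : ∀ᵐ t ∂volume.restrict (Set.Ioi (0 : ℝ)),
        rearrangement μ f t * rearrangement μ g t < ∞ :=
      ae_lt_top ((measurable_rearrangement f).mul (measurable_rearrangement g)) hfg
    filter_upwards [hae, ae_restrict_mem measurableSet_Ioi] with t ht ht0
    -- Multiplication by `∞` is not continuous at `0`. Where `g^*(t) = ∞`, finiteness of the product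
    -- forces `f^*(t) = 0`, so all terms vanish.
    by_cases hgt : rearrangement μ g t = ∞
    · have hft : rearrangement μ f t = 0 := by
        by_contra hne
        rw [hgt, ENNReal.mul_top hne] at ht
        exact ht.ne rfl
      have : ∀ k, rearrangement μ ((middleSet f k)ᶜ.indicator f) t = 0 := fun k => by
        rw [← nonpos_iff_eq_zero, ← hft]
        exact rearrangement_mono_ae (ae_of_all _ (hle k)) t
      simp [this]
    · have := ENNReal.Tendsto.mul_const (hpt t ht0) (Or.inr hgt)
      simpa using this

end RearrangementLemmas

/-! ### The Lorentz–Luxemburg theorem `X'' = X` -/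

namespace RIBanachFunctionNorm

section LorentzLuxemburg

variable {R : Type*} [MeasurableSpace R] {μ : Measure R}

/-- Fatou's lemma for the function norm. -/
theorem toFun_le_of_tendsto (X : RIBanachFunctionNorm μ) {f : ℕ → R → ℝ≥0∞} {g : R → ℝ≥0∞}
    (hf : ∀ n, Measurable (f n)) (hg : Measurable g) {C : ℝ≥0∞} (hC : ∀ n, X.toFun (f n) ≤ C)
    (h : ∀ᵐ x ∂μ, Tendsto (fun n => f n x) atTop (𝓝 (g x))) : X.toFun g ≤ C := by
  -- The tail infima lie below `f n` and increase a.e. to the limit, so the monotone axiom `fatou'`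
  -- applies to them.
  have hm : ∀ n, Measurable fun x => ⨅ i, f (n + i) x := fun n => Measurable.iInf fun i => hf _
  have hlim := X.fatou' (fun n x => ⨅ i, f (n + i) x) g hm hg ?_
  · refine le_of_tendsto' hlim fun n => (X.mono' _ _ (hm n) (hf n) ?_).trans (hC n)
    exact ae_of_all _ fun x => iInf_le_of_le 0 le_rfl
  · filter_upwards [h] with x hx
    have hmono : Monotone fun n => ⨅ i, f (n + i) x := by
      intro m n hmn
      refine le_iInf fun i => iInf_le_of_le (n - m + i) (le_of_eq ?_)
      congr 1
      omega
    refine ⟨hmono, ?_⟩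
    have h1 := tendsto_atTop_iSup hmono
    have h2 : liminf (fun n => f n x) atTop = ⨆ n, ⨅ i, f (n + i) x := by
      rw [liminf_eq_iSup_iInf_of_nat']
      simp only [add_comm]
    rwa [← h2, hx.liminf_eq] at h1

theorem memLp_toReal_of_le_indicator {g : R → ℝ≥0∞} (hg : Measurable g) {c : ℝ≥0} {E : Set R}
    (hE : MeasurableSet E) (hEμ : μ E < ∞) (h : ∀ x, g x ≤ E.indicator (fun _ => (c : ℝ≥0∞)) x)
    (p : ℝ≥0∞) : MemLp (fun x => (g x).toReal) p μ := by
  refine (memLp_indicator_const p hE (c : ℝ) (Or.inr hEμ.ne)).mono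
    hg.ennreal_toReal.aestronglyMeasurable (ae_of_all _ fun x => ?_)
  have h1 := h x
  by_cases hx : x ∈ E
  · rw [Set.indicator_of_mem hx] at h1 ⊢
    rw [Real.norm_of_nonneg ENNReal.toReal_nonneg, Real.norm_of_nonneg c.coe_nonneg]
    exact ENNReal.toReal_mono ENNReal.coe_ne_top h1
  · rw [Set.indicator_of_notMem hx] at h1
    simp [nonpos_iff_eq_zero.1 h1]

/-- With the closedness proved next, this allows Hahn–Banach separation of a point of real `L²` from
the part of an `X`-ball lying in `L²`. -/
theorem convex_setOf_toFun_le (X : RIBanachFunctionNorm μ) (r : ℝ≥0) :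
    Convex ℝ {g : Lp ℝ 2 μ | X.toFun (fun x => ‖g x‖ₑ) ≤ r} := by
  intro a ha b hb s t hs ht hst
  have hma : Measurable fun x => ‖a x‖ₑ := (Lp.stronglyMeasurable a).enorm
  have hmb : Measurable fun x => ‖b x‖ₑ := (Lp.stronglyMeasurable b).enorm
  have hmab : Measurable fun x => ‖(s • a + t • b : Lp ℝ 2 μ) x‖ₑ :=
    (Lp.stronglyMeasurable _).enorm
  have ha' : X.toFun (fun x => ‖a x‖ₑ) ≤ r := ha
  have hb' : X.toFun (fun x => ‖b x‖ₑ) ≤ r := hb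
  show X.toFun (fun x => ‖(s • a + t • b : Lp ℝ 2 μ) x‖ₑ) ≤ r
  calc X.toFun (fun x => ‖(s • a + t • b : Lp ℝ 2 μ) x‖ₑ)
      ≤ X.toFun (fun x => ‖s‖₊ * ‖a x‖ₑ + ‖t‖₊ * ‖b x‖ₑ) := by
        refine X.mono' _ _ hmab ((hma.const_mul _).add (hmb.const_mul _)) ?_
        filter_upwards [Lp.coeFn_add (s • a) (t • b), Lp.coeFn_smul s a, Lp.coeFn_smul t b]
          with x h1 h2 h3
        rw [h1, Pi.add_apply, h2, h3, Pi.smul_apply, Pi.smul_apply]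
        refine (_root_.enorm_add_le _ _).trans (le_of_eq ?_)
        rw [_root_.enorm_smul, _root_.enorm_smul]
        rfl
    _ ≤ ‖s‖₊ * X.toFun (fun x => ‖a x‖ₑ) + ‖t‖₊ * X.toFun (fun x => ‖b x‖ₑ) := by
        rw [← X.smul' _ _ hma, ← X.smul' _ _ hmb]
        exact X.add_le' _ _ (hma.const_mul _) (hmb.const_mul _)
    _ ≤ ‖s‖₊ * r + ‖t‖₊ * r := by gcongr
    _ = r := by
        rw [← add_mul]
        have : ‖s‖₊ + ‖t‖₊ = 1 := by
          ext
          simp [abs_of_nonneg hs, abs_of_nonneg ht, hst]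
        rw [← ENNReal.coe_add, this, ENNReal.coe_one, one_mul]

/-- An `L²`-convergent sequence has an a.e. convergent subsequence, along which the Fatou property
preserves the norm bound. -/
theorem isClosed_setOf_toFun_le (X : RIBanachFunctionNorm μ) (r : ℝ≥0) :
    IsClosed {g : Lp ℝ 2 μ | X.toFun (fun x => ‖g x‖ₑ) ≤ r} := by
  refine IsSeqClosed.isClosed fun u g hu hlim => ?_
  obtain ⟨ns, -, hns⟩ := (tendstoInMeasure_of_tendsto_Lp hlim).exists_seq_tendsto_ae
  refine X.toFun_le_of_tendsto (f := fun n x => ‖u (ns n) x‖ₑ)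
    (fun n => (Lp.stronglyMeasurable _).enorm) (Lp.stronglyMeasurable _).enorm
    (fun n => hu (ns n)) ?_
  filter_upwards [hns] with x hx
  exact (continuous_enorm.tendsto _).comp hx

theorem associateFun_le_of_forall (X : RIBanachFunctionNorm μ) {r : ℝ≥0} (hr : 0 < r)
    {f : R → ℝ≥0∞} {C : ℝ≥0∞}
    (h : ∀ g, Measurable g → X.toFun g ≤ r → ∫⁻ x, f x * g x ∂μ ≤ C) (hf : Measurable f) :
    X.associateFun f ≤ C / r := by
  refine X.associateFun_le fun g hg hgX => ?_
  by_cases h0 : X.toFun g = 0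
  · have hg0 := (X.eq_zero_iff' g hg).1 h0
    have : ∫⁻ x, f x * g x ∂μ = 0 := by
      rw [← lintegral_zero (μ := μ)]
      refine lintegral_congr_ae ?_
      filter_upwards [hg0] with x hx
      simp [hx]
    simp [this]
  · have hr' : (r : ℝ≥0∞) ≠ 0 := by exact_mod_cast hr.ne'
    lift X.toFun g to ℝ≥0 using hgX.ne with a ha
    have ha0 : a ≠ 0 := by exact_mod_cast h0
    -- Homogeneity: rescaling by `r / a` brings `g` to norm exactly `r`.
    have h1 := h (fun x => ((r / a : ℝ≥0) : ℝ≥0∞) * g x) (hg.const_mul _) (by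
      rw [X.smul' _ _ hg, ← ha, ← ENNReal.coe_mul, div_mul_cancel₀ _ ha0])
    have h2 : ∫⁻ x, f x * (((r / a : ℝ≥0) : ℝ≥0∞) * g x) ∂μ =
        ((r / a : ℝ≥0) : ℝ≥0∞) * ∫⁻ x, f x * g x ∂μ := by
      rw [← lintegral_const_mul _ (hf.fun_mul hg)]
      refine lintegral_congr fun x => ?_
      ring
    rw [h2, ENNReal.coe_div ha0] at h1
    rw [← ENNReal.mul_div_right_comm,
      ENNReal.le_div_iff_mul_le (Or.inl hr') (Or.inl ENNReal.coe_ne_top)]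
    rw [← ENNReal.mul_div_right_comm,
      ENNReal.div_le_iff (by exact_mod_cast ha0) ENNReal.coe_ne_top] at h1
    rwa [mul_comm] at h1

variable [SigmaFinite μ]

/-- Truncations of a function in range and in domain. -/
noncomputable def truncation (μ : Measure R) [SigmaFinite μ] (f : R → ℝ≥0∞) (k : ℕ) (x : R) :
    ℝ≥0∞ :=
  (spanningSets μ k).indicator (fun x => min (f x) k) x

theorem measurable_truncation {f : R → ℝ≥0∞} (hf : Measurable f) (k : ℕ) :
    Measurable (truncation μ f k) :=
  (hf.min measurable_const).indicator (measurableSet_spanningSets μ k)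

theorem truncation_le (f : R → ℝ≥0∞) (k : ℕ) (x : R) : truncation μ f k x ≤ f x :=
  (Set.indicator_le_self _ _ _).trans (min_le_left _ _)

theorem truncation_le_indicator (f : R → ℝ≥0∞) (k : ℕ) (x : R) :
    truncation μ f k x ≤ (spanningSets μ k).indicator (fun _ => ((k : ℝ≥0) : ℝ≥0∞)) x := by
  refine Set.indicator_le_indicator ?_
  simp

theorem monotone_truncation (f : R → ℝ≥0∞) (x : R) : Monotone fun k => truncation μ f k x := by
  intro m n hmn
  by_cases hx : x ∈ spanningSets μ m
  · have hx' := monotone_spanningSets μ hmn hx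
    simp only [truncation, Set.indicator_of_mem hx, Set.indicator_of_mem hx']
    exact min_le_min le_rfl (by exact_mod_cast hmn)
  · simp [truncation, Set.indicator_of_notMem hx]

theorem tendsto_truncation (f : R → ℝ≥0∞) (x : R) :
    Tendsto (fun k => truncation μ f k x) atTop (𝓝 (f x)) := by
  have h1 : Tendsto (fun k : ℕ => min (f x) (k : ℝ≥0∞)) atTop (𝓝 (f x)) := by
    have := (tendsto_const_nhds (x := f x)).min ENNReal.tendsto_nat_nhds_top
    simpa using this
  refine h1.congr' ?_
  have hx : x ∈ ⋃ k, spanningSets μ k := by rw [iUnion_spanningSets]; trivial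
  obtain ⟨N, hN⟩ := Set.mem_iUnion.1 hx
  filter_upwards [eventually_ge_atTop N] with k hk
  rw [truncation, Set.indicator_of_mem (monotone_spanningSets μ hk hN)]

theorem lintegral_le_of_truncation {f g : R → ℝ≥0∞} (hf : Measurable f) (hg : Measurable g)
    {C : ℝ≥0∞} (h : ∀ k, ∫⁻ x, f x * truncation μ g k x ∂μ ≤ C) : ∫⁻ x, f x * g x ∂μ ≤ C := by
  refine le_of_tendsto' (lintegral_tendsto_of_tendsto_of_monotone
    (fun k => (hf.mul (measurable_truncation hg k)).aemeasurable)
    (ae_of_all _ fun x m n hmn => mul_le_mul_right (monotone_truncation g x hmn) _)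
    (ae_of_all _ fun x => ?_)) h
  by_cases hfx : f x = ∞
  · by_cases hgx : g x = 0
    · have : ∀ k, truncation μ g k x = 0 := fun k =>
        nonpos_iff_eq_zero.1 ((truncation_le g k x).trans hgx.le)
      simp [this, hgx]
    · exact ENNReal.Tendsto.const_mul (tendsto_truncation g x) (Or.inl hgx)
  · exact ENNReal.Tendsto.const_mul (tendsto_truncation g x) (Or.inr hfx)

theorem toFun_le_of_truncation (X : RIBanachFunctionNorm μ) {f : R → ℝ≥0∞} (hf : Measurable f)
    {C : ℝ≥0∞} (h : ∀ k, X.toFun (truncation μ f k) ≤ C) : X.toFun f ≤ C :=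
  X.toFun_le_of_tendsto (measurable_truncation hf) hf h (ae_of_all _ (tendsto_truncation f))

/-- The `X`-ball is stable under changes of sign and under truncation. Testing `η` against `sign η`
times a truncation of `g`, which lies in `L²`, turns the inner product into an integral of `|η|`. -/
theorem ofReal_inner_le_of_forall (X : RIBanachFunctionNorm μ) {r : ℝ≥0} {u : ℝ}
    {η : Lp ℝ 2 μ} (hη : ∀ g : Lp ℝ 2 μ, X.toFun (fun x => ‖g x‖ₑ) ≤ r → inner ℝ η g ≤ u)
    {g : R → ℝ≥0∞} (hg : Measurable g) (hgr : X.toFun g ≤ r) :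
    ∫⁻ x, ‖η x‖ₑ * g x ∂μ ≤ ENNReal.ofReal u := by
  refine lintegral_le_of_truncation (Lp.stronglyMeasurable η).enorm hg fun k => ?_
  have hkm := measurable_truncation (μ := μ) hg k
  have hLp : MemLp (fun x => (truncation μ g k x).toReal) 2 μ :=
    memLp_toReal_of_le_indicator hkm (measurableSet_spanningSets μ k)
      (measure_spanningSets_lt_top μ k) (truncation_le_indicator g k) 2
  have hfin : ∀ x, truncation μ g k x ≠ ∞ := fun x => ne_top_of_le_ne_top
    (b := (k : ℝ≥0∞)) (ENNReal.natCast_ne_top k)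
    ((Set.indicator_le_self _ _ _).trans (min_le_right _ _))
  have hηm : Measurable (η : R → ℝ) := (Lp.stronglyMeasurable η).measurable
  have hsm : Measurable fun x => if 0 ≤ η x then (1 : ℝ) else -1 :=
    Measurable.ite (measurableSet_le measurable_const hηm) measurable_const measurable_const
  have hLp' : MemLp (fun x => (if 0 ≤ η x then (1 : ℝ) else -1) *
      (truncation μ g k x).toReal) 2 μ := by
    refine hLp.mono (hsm.mul hkm.ennreal_toReal).aestronglyMeasurable (ae_of_all _ fun x => ?_)
    rw [norm_mul]
    split_ifs <;> simp
  have hGK : X.toFun (fun x => ‖hLp'.toLp _ x‖ₑ) ≤ r := by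
    refine (X.mono' _ _ (Lp.stronglyMeasurable _).enorm hg ?_).trans hgr
    filter_upwards [hLp'.coeFn_toLp] with x hx
    rw [hx, enorm_mul]
    have h1 : ‖(if 0 ≤ η x then (1 : ℝ) else -1)‖ₑ = 1 := by split_ifs <;> simp
    rw [h1, one_mul, Real.enorm_of_nonneg ENNReal.toReal_nonneg, ENNReal.ofReal_toReal (hfin x)]
    exact truncation_le g k x
  have h2 := hη _ hGK
  have hint : Integrable (fun x => |η x| * (truncation μ g k x).toReal) μ := by
    exact (Lp.memLp η).abs.integrable_mul hLp
  have h3 : inner ℝ η (hLp'.toLp _) = ∫ x, |η x| * (truncation μ g k x).toReal ∂μ := by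
    rw [L2.inner_def]
    refine integral_congr_ae ?_
    filter_upwards [hLp'.coeFn_toLp] with x hx
    rw [hx]
    simp only [RCLike.inner_apply, conj_trivial]
    split_ifs with h0
    · rw [abs_of_nonneg h0]; ring
    · rw [abs_of_neg (not_le.1 h0)]; ring
  rw [h3] at h2
  refine le_trans (le_of_eq ?_) (ENNReal.ofReal_le_ofReal h2)
  rw [ofReal_integral_eq_lintegral_ofReal hint
    (ae_of_all _ fun x => mul_nonneg (abs_nonneg _) ENNReal.toReal_nonneg)]
  refine lintegral_congr fun x => ?_
  rw [ENNReal.ofReal_mul (abs_nonneg _), ENNReal.ofReal_toReal (hfin x), Real.enorm_eq_ofReal_abs]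

variable [IsResonant μ]

/-- If `‖f‖_{X''} < r < ‖f‖_X`, then some `η ∈ L²` satisfies `⟨η, g⟩ < u < ⟨η, f⟩` for all `g` in
the `r`-ball of `X`. The first inequality gives `‖η‖_{X'} ≤ u / r`, whence `⟨η, f⟩ ≤ ‖f‖_{X''}
‖η‖_{X'} ≤ u`, a contradiction. The bound by an indicator serves to place `f` in `L²`. -/
theorem toFun_le_associate_associate_of_le_indicator (X : RIBanachFunctionNorm μ)
    {f : R → ℝ≥0∞} (hf : Measurable f) {c : ℝ≥0} {E : Set R} (hE : MeasurableSet E)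
    (hEμ : μ E < ∞) (h : ∀ x, f x ≤ E.indicator (fun _ => (c : ℝ≥0∞)) x) :
    X.toFun f ≤ X.associate.associateFun f := by
  by_contra hlt
  obtain ⟨r, hcr, hrf⟩ := ENNReal.lt_iff_exists_nnreal_btwn.1 (not_le.1 hlt)
  have hr : 0 < r := by
    have := lt_of_le_of_lt zero_le hcr
    exact_mod_cast this
  have hLp := memLp_toReal_of_le_indicator hf hE hEμ h 2
  have hfin : ∀ x, f x ≠ ∞ := fun x => ne_top_of_le_ne_top ENNReal.coe_ne_top
    ((h x).trans (Set.indicator_le_self _ _ _))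
  have hF : hLp.toLp _ ∉ {g : Lp ℝ 2 μ | X.toFun (fun x => ‖g x‖ₑ) ≤ r} := by
    intro hmem
    have hmem' : X.toFun (fun x => ‖hLp.toLp _ x‖ₑ) ≤ r := hmem
    refine absurd (le_of_eq_of_le (X.congr_ae hf (Lp.stronglyMeasurable _).enorm ?_) hmem')
      (not_le.2 hrf)
    filter_upwards [hLp.coeFn_toLp] with x hx
    rw [hx, Real.enorm_of_nonneg ENNReal.toReal_nonneg, ENNReal.ofReal_toReal (hfin x)]
  obtain ⟨ℓ, u, hK, hu⟩ := geometric_hahn_banach_closed_point (X.convex_setOf_toFun_le r)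
    (X.isClosed_setOf_toFun_le r) hF
  set η : Lp ℝ 2 μ := (InnerProductSpace.toDual ℝ (Lp ℝ 2 μ)).symm ℓ
  have hη : ∀ g, inner ℝ η g = ℓ g := fun g => InnerProductSpace.toDual_symm_apply
  have hηm : Measurable fun x => ‖η x‖ₑ := (Lp.stronglyMeasurable η).enorm
  have hηK : ∀ g : Lp ℝ 2 μ, X.toFun (fun x => ‖g x‖ₑ) ≤ r → inner ℝ η g ≤ u := fun g hg => by
    rw [hη]
    exact (hK g hg).le
  have hX' : X.associateFun (fun x => ‖η x‖ₑ) ≤ ENNReal.ofReal u / r :=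
    X.associateFun_le_of_forall hr (fun g hg hgr => X.ofReal_inner_le_of_forall hηK hg hgr) hηm
  have hr' : (r : ℝ≥0∞) ≠ 0 := by exact_mod_cast hr.ne'
  have h1 : ∫⁻ x, f x * ‖η x‖ₑ ∂μ ≤ ENNReal.ofReal u := by
    refine (X.associate.lintegral_mul_le f hηm (lt_of_le_of_lt hX'
      (ENNReal.div_lt_top ENNReal.ofReal_ne_top hr'))).trans ?_
    calc X.associate.associateFun f * X.associateFun (fun x => ‖η x‖ₑ)
        ≤ r * (ENNReal.ofReal u / r) := mul_le_mul' hcr.le hX'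
      _ = ENNReal.ofReal u := ENNReal.mul_div_cancel hr' ENNReal.coe_ne_top
  have hint : Integrable (fun x => η x * (f x).toReal) μ := (Lp.memLp η).integrable_mul hLp
  have h2 : ENNReal.ofReal (ℓ (hLp.toLp _)) ≤ ∫⁻ x, f x * ‖η x‖ₑ ∂μ := by
    rw [← hη, L2.inner_def]
    have h3 : ∫ x, inner ℝ (η x) (hLp.toLp _ x) ∂μ = ∫ x, η x * (f x).toReal ∂μ := by
      refine integral_congr_ae ?_
      filter_upwards [hLp.coeFn_toLp] with x hx
      rw [hx]
      simp only [RCLike.inner_apply, conj_trivial]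
      ring
    rw [h3]
    refine (ENNReal.ofReal_le_ofReal (le_abs_self _)).trans ?_
    rw [← Real.enorm_eq_ofReal_abs]
    refine (enorm_integral_le_lintegral_enorm _).trans (le_of_eq (lintegral_congr fun x => ?_))
    rw [enorm_mul, Real.enorm_of_nonneg ENNReal.toReal_nonneg, ENNReal.ofReal_toReal (hfin x),
      mul_comm]
  -- The ball contains `0`, so `u > 0`; thus `ENNReal.ofReal` loses nothing in the final comparison.
  have hu0 : 0 < u := by
    have h0 := hK 0 (by
      show X.toFun (fun x => ‖(0 : Lp ℝ 2 μ) x‖ₑ) ≤ r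
      have : X.toFun (fun x => ‖(0 : Lp ℝ 2 μ) x‖ₑ) = 0 := by
        rw [X.eq_zero_iff' _ (Lp.stronglyMeasurable _).enorm]
        filter_upwards [Lp.coeFn_zero ℝ 2 μ] with x hx
        rw [hx]
        simp
      rw [this]
      exact zero_le)
    simpa using h0
  exact absurd (h2.trans h1) (not_le.2 ((ENNReal.ofReal_lt_ofReal_iff_of_nonneg hu0.le).2 hu))

/-- The Lorentz–Luxemburg theorem. -/
theorem associate_associate_toFun (X : RIBanachFunctionNorm μ) {f : R → ℝ≥0∞}
    (hf : Measurable f) : X.associate.associate.toFun f = X.toFun f := by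
  refine le_antisymm (X.associate.associateFun_le fun g hg hgX => ?_) ?_
  · by_cases htop : X.toFun f = ∞
    · by_cases h0 : X.associate.toFun g = 0
      · have hg0 := (X.associate.eq_zero_iff' g hg).1 h0
        have : ∫⁻ x, f x * g x ∂μ = 0 := by
          rw [← lintegral_zero (μ := μ)]
          refine lintegral_congr_ae ?_
          filter_upwards [hg0] with x hx
          simp [hx]
        simp [this]
      · rw [htop, ENNReal.top_mul h0]
        exact le_top
    · have := X.lintegral_mul_le g hf (lt_top_iff_ne_top.2 htop)
      simp only [mul_comm (f _), mul_comm (X.toFun f)]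
      exact this
  · refine X.toFun_le_of_truncation hf fun k => ?_
    exact (X.toFun_le_associate_associate_of_le_indicator (measurable_truncation hf k)
      (measurableSet_spanningSets μ k) (measure_spanningSets_lt_top μ k)
      (truncation_le_indicator f k)).trans
      (X.associate.associateFun_mono (ae_of_all _ (truncation_le f k)))

end LorentzLuxemburg

end RIBanachFunctionNorm

/-! ### Algebra of Cesàro means -/

section CesaroMeans

variable {E : Type*} [AddCommGroup E] [Module ℂ E]

/-- The Cesàro mean as a linear map. -/
noncomputable def cesaroMap (S : E →ₗ[ℂ] E) (n : ℕ) : E →ₗ[ℂ] E :=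
  (n : ℂ)⁻¹ • ∑ i ∈ Finset.range n, S ^ i

theorem cesaroMap_apply (S : E →ₗ[ℂ] E) (n : ℕ) (f : E) : cesaroMap S n f = cesaroMean S n f := by
  simp [cesaroMap, cesaroMean, LinearMap.sum_apply]

theorem cesaroMean_eq_self {S : E →ₗ[ℂ] E} {f : E} (hf : S f = f) {n : ℕ} (hn : n ≠ 0) :
    cesaroMean S n f = f := by
  have h1 : ∀ i, (S ^ i) f = f := fun i => by
    induction i with
    | zero => rfl
    | succ i ih => rw [pow_succ, Module.End.mul_apply, hf, ih]
  simp only [cesaroMean, h1, Finset.sum_const, Finset.card_range, ← Nat.cast_smul_eq_nsmul ℂ]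
  rw [inv_smul_smul₀ (by exact_mod_cast hn)]

theorem cesaroMean_apply_self (S : E →ₗ[ℂ] E) (n : ℕ) (f : E) :
    cesaroMean S n (S f) = S (cesaroMean S n f) := by
  simp only [cesaroMean, map_smul, map_sum]
  congr 1
  refine Finset.sum_congr rfl fun i _ => ?_
  rw [← Module.End.mul_apply, ← Module.End.mul_apply, ← pow_succ, ← pow_succ']

theorem cesaroMean_sub_apply (S : E →ₗ[ℂ] E) (n : ℕ) (f : E) :
    cesaroMean S n (f - S f) = (n : ℂ)⁻¹ • (f - (S ^ n) f) := by
  have h := Finset.sum_range_sub' (fun i => (S ^ i) f) n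
  simp only [pow_zero, Module.End.one_apply] at h
  rw [← h, cesaroMean]
  congr 1
  refine Finset.sum_congr rfl fun i _ => ?_
  rw [map_sub, pow_succ, Module.End.mul_apply]

/-- Each `f - S^i f` telescopes into values of `I - S`. This is what puts an `f` with vanishing
limit of means into the closure of the range. -/
theorem sub_cesaroMean_mem_range (S : E →ₗ[ℂ] E) {n : ℕ} (hn : n ≠ 0) (f : E) :
    f - cesaroMean S n f ∈ LinearMap.range (LinearMap.id - S) := by
  have h1 : ∀ i, f - (S ^ i) f ∈ LinearMap.range (LinearMap.id - S) := fun i => by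
    induction i with
    | zero => simp
    | succ i ih =>
      have : f - (S ^ (i + 1)) f =
          (f - (S ^ i) f) + (LinearMap.id - S : E →ₗ[ℂ] E) ((S ^ i) f) := by
        simp only [LinearMap.sub_apply, LinearMap.id_apply, pow_succ', Module.End.mul_apply]
        abel
      rw [this]
      exact add_mem ih (LinearMap.mem_range_self _ _)
  have h2 : f - cesaroMean S n f = (n : ℂ)⁻¹ • ∑ i ∈ Finset.range n, (f - (S ^ i) f) := by
    rw [Finset.sum_sub_distrib, smul_sub, Finset.sum_const, Finset.card_range,
      ← Nat.cast_smul_eq_nsmul ℂ, inv_smul_smul₀ (by exact_mod_cast hn)]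
    rfl
  rw [h2]
  exact Submodule.smul_mem _ _ (Submodule.sum_mem _ fun i _ => h1 i)

theorem Seminorm.cesaroMean_le (p : Seminorm ℂ E) {S : E →ₗ[ℂ] E} {c : ℝ} {f : E}
    (h : ∀ n, p ((S ^ n) f) ≤ c) (n : ℕ) : p (cesaroMean S n f) ≤ c := by
  have hc : 0 ≤ c := (apply_nonneg p _).trans (h 0)
  rw [cesaroMean, map_smul_eq_mul, norm_inv, Complex.norm_natCast]
  have h1 : p (∑ i ∈ Finset.range n, (S ^ i) f) ≤ n * c := by
    refine (Finset.le_sum_of_subadditive p (map_zero p).le (map_add_le_add p) _ _).trans ?_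
    refine (Finset.sum_le_sum fun i _ => h i).trans (le_of_eq ?_)
    simp
  -- For `n = 0` the mean is `0`, since `0⁻¹ = 0`.
  rcases Nat.eq_zero_or_pos n with rfl | hn
  · simpa using hc
  · rw [inv_mul_le_iff₀ (by exact_mod_cast hn)]
    exact h1

/-- The mean of `f - S f` telescopes to `(f - S^n f) / n`, of size at most `2c / n`. -/
theorem Seminorm.tendsto_cesaroMean_sub (p : Seminorm ℂ E) {S : E →ₗ[ℂ] E} {c : ℝ} {f : E}
    (h : ∀ n, p ((S ^ n) f) ≤ c) :
    Tendsto (fun n => p (cesaroMean S n (f - S f))) atTop (𝓝 0) := by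
  have h0 : Tendsto (fun n : ℕ => (n : ℝ)⁻¹ * (c + c)) atTop (𝓝 0) := by
    simpa using (tendsto_inv_atTop_nhds_zero_nat (𝕜 := ℝ)).mul_const (c + c)
  refine squeeze_zero (fun n => apply_nonneg p _) (fun n => ?_) h0
  rw [cesaroMean_sub_apply, map_smul_eq_mul, norm_inv, Complex.norm_natCast]
  refine mul_le_mul_of_nonneg_left ?_ (by positivity)
  exact (map_sub_le_add p _ _).trans (add_le_add (h 0) (h n))

end CesaroMeans

/-! ### The mean ergodic theorem in Hilbert space -/

section Hilbert

variable {H : Type*} [NormedAddCommGroup H] [InnerProductSpace ℂ H]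

/-- The vectors whose Cesàro means converge. -/
def cesaroConvergent (S : H →ₗ[ℂ] H) : Submodule ℂ H where
  carrier := {f | ∃ g, Tendsto (fun n => cesaroMap S n f) atTop (𝓝 g)}
  add_mem' := by
    rintro a b ⟨g, hg⟩ ⟨g', hg'⟩
    exact ⟨g + g', by simpa using hg.add hg'⟩
  zero_mem' := ⟨0, by simp⟩
  smul_mem' := by
    rintro c a ⟨g, hg⟩
    exact ⟨c • g, by simpa using hg.const_smul c⟩

theorem norm_cesaroMap_le {S : H →ₗ[ℂ] H} {C : ℝ} (hS : ∀ n f, ‖(S ^ n) f‖ ≤ C * ‖f‖) (n : ℕ)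
    (f : H) : ‖cesaroMap S n f‖ ≤ C * ‖f‖ := by
  rw [cesaroMap_apply]
  exact (normSeminorm ℂ H).cesaroMean_le (fun n => hS n f) n

variable [CompleteSpace H]

theorem isClosed_cesaroConvergent {S : H →ₗ[ℂ] H} {C : ℝ}
    (hS : ∀ n f, ‖(S ^ n) f‖ ≤ C * ‖f‖) : IsClosed (cesaroConvergent S : Set H) := by
  refine isClosed_of_closure_subset fun f hf => ?_
  suffices hc : CauchySeq fun n => cesaroMap S n f from cauchySeq_tendsto_of_complete hc
  rw [Metric.cauchySeq_iff']
  intro ε hε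
  -- The means are uniformly bounded by `C`, so convergence at a nearby `u` makes the means of `f`
  -- Cauchy. Using `|C| + 1` keeps the denominator positive without a sign assumption on `C`.
  obtain ⟨u, ⟨g, hg⟩, hu⟩ := Metric.mem_closure_iff.1 hf (ε / (4 * (|C| + 1))) (by positivity)
  obtain ⟨N, hN⟩ := Metric.cauchySeq_iff'.1 hg.cauchySeq (ε / 2) (half_pos hε)
  have hd : ∀ n, dist (cesaroMap S n f) (cesaroMap S n u) < ε / 4 := fun n => by
    rw [dist_eq_norm, ← map_sub]
    refine (norm_cesaroMap_le hS n _).trans_lt ?_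
    rw [← dist_eq_norm]
    calc C * dist f u ≤ (|C| + 1) * dist f u := by
          gcongr
          linarith [le_abs_self C]
      _ < (|C| + 1) * (ε / (4 * (|C| + 1))) := by gcongr
      _ = ε / 4 := by field_simp
  refine ⟨N, fun n hn => ?_⟩
  have h1 := hd n
  have h2 := hd N
  rw [dist_comm] at h2
  have h3 := dist_triangle4 (cesaroMap S n f) (cesaroMap S n u) (cesaroMap S N u)
    (cesaroMap S N f)
  linarith [hN n hn]

/-- The mean ergodic theorem for power bounded operators in a Hilbert space. -/
theorem ContinuousLinearMap.exists_tendsto_cesaroMap {S : H →L[ℂ] H} {C : ℝ}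
    (hS : ∀ n, ‖S ^ n‖ ≤ C) :
    ∃ Q : H →ₗ[ℂ] H, ∀ f, Tendsto (fun n => cesaroMap (S : H →ₗ[ℂ] H) n f) atTop (𝓝 (Q f)) := by
  have hpow : ∀ (A : H →L[ℂ] H) (n : ℕ) f, ((A : H →ₗ[ℂ] H) ^ n) f = (A ^ n) f := fun A n f => by
    rw [← ContinuousLinearMap.toLinearMap_pow]
    rfl
  have hS' : ∀ n f, ‖((S : H →ₗ[ℂ] H) ^ n) f‖ ≤ C * ‖f‖ := fun n f => by
    rw [hpow]
    exact (S ^ n).le_of_opNorm_le (hS n) f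
  set S' : H →L[ℂ] H := adjoint S
  have hadj : ∀ n f, ‖((S' : H →ₗ[ℂ] H) ^ n) f‖ ≤ C * ‖f‖ := fun n f => by
    rw [hpow]
    refine (S' ^ n).le_of_opNorm_le ?_ f
    have : S' ^ n = adjoint (S ^ n) := by
      rw [← ContinuousLinearMap.star_eq_adjoint, star_pow, ContinuousLinearMap.star_eq_adjoint]
    rw [this, LinearIsometryEquiv.norm_map]
    exact hS n
  -- Let `x` be orthogonal to the closed space of convergence. Orthogonality to all `y - S y` means
  -- `S* x = x`, so the means of `S*` at `x` are eventually `x`. Orthogonality to `Ker (I - S)` puts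
  -- `x` into the closure of `Im (I - S*)`, where these means tend to `0`. Hence `x = 0`.
  have htop : (cesaroConvergent (S : H →ₗ[ℂ] H)) = ⊤ := by
    have : CompleteSpace (cesaroConvergent (S : H →ₗ[ℂ] H)) :=
      (isClosed_cesaroConvergent hS').completeSpace_coe
    rw [← Submodule.orthogonal_eq_bot_iff, Submodule.eq_bot_iff]
    intro x hx
    have hfix : S' x = x := by
      refine ext_inner_right ℂ fun y => ?_
      have hmem : y - S y ∈ cesaroConvergent (S : H →ₗ[ℂ] H) := by
        refine ⟨0, ?_⟩
        rw [tendsto_zero_iff_norm_tendsto_zero]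
        simp only [cesaroMap_apply]
        exact (normSeminorm ℂ H).tendsto_cesaroMean_sub (fun n => hS' n y)
      have h := Submodule.inner_left_of_mem_orthogonal hmem hx
      rw [inner_sub_right, sub_eq_zero] at h
      rw [ContinuousLinearMap.adjoint_inner_left, h]
    have hperp : x ∈ (LinearMap.ker ((1 - S : H →L[ℂ] H) : H →ₗ[ℂ] H))ᗮ := by
      rw [Submodule.mem_orthogonal']
      intro y hy
      have hy' : S y = y := by
        have : y - S y = 0 := by simpa using hy
        exact (sub_eq_zero.1 this).symm
      refine Submodule.inner_left_of_mem_orthogonal (K := cesaroConvergent (S : H →ₗ[ℂ] H)) ?_ hx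
      refine ⟨y, tendsto_const_nhds.congr' ?_⟩
      filter_upwards [eventually_ne_atTop 0] with n hn
      rw [cesaroMap_apply, cesaroMean_eq_self hy' hn]
    rw [ContinuousLinearMap.orthogonal_ker, ← SetLike.mem_coe,
      Submodule.topologicalClosure_coe, map_sub] at hperp
    have h1 : Tendsto (fun n => cesaroMap (S' : H →ₗ[ℂ] H) n x) atTop (𝓝 0) := by
      rw [Metric.tendsto_atTop]
      intro ε hε
      obtain ⟨v, ⟨y, rfl⟩, hv⟩ := Metric.mem_closure_iff.1 hperp (ε / (2 * (|C| + 1)))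
        (by positivity)
      have hy : (adjoint (1 : H →L[ℂ] H) - adjoint S) y = y - (S' : H →ₗ[ℂ] H) y := by
        rw [← ContinuousLinearMap.star_eq_adjoint, star_one]
        rfl
      have ht := (normSeminorm ℂ H).tendsto_cesaroMean_sub (fun n => hadj n y)
      obtain ⟨N, hN⟩ := Metric.tendsto_atTop.1 ht (ε / 2) (half_pos hε)
      refine ⟨N, fun n hn => ?_⟩
      have h2 := hN n hn
      rw [Real.dist_0_eq_abs, abs_of_nonneg (apply_nonneg _ _), ← hy, ← cesaroMap_apply] at h2
      rw [dist_zero_right]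
      set v := (adjoint (1 : H →L[ℂ] H) - adjoint S) y
      have h3 : cesaroMap (S' : H →ₗ[ℂ] H) n x =
          cesaroMap (S' : H →ₗ[ℂ] H) n (x - v) + cesaroMap (S' : H →ₗ[ℂ] H) n v := by
        rw [← map_add, sub_add_cancel]
      have h4 : ‖cesaroMap (S' : H →ₗ[ℂ] H) n (x - v)‖ < ε / 2 := by
        refine (norm_cesaroMap_le hadj n _).trans_lt ?_
        rw [← dist_eq_norm]
        calc C * dist x v ≤ (|C| + 1) * dist x v := by
              gcongr
              linarith [le_abs_self C]
          _ < (|C| + 1) * (ε / (2 * (|C| + 1))) := by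
              gcongr
              exact hv
          _ = ε / 2 := by field_simp
      rw [h3]
      refine (norm_add_le _ _).trans_lt ?_
      have h5 : ‖cesaroMap (S' : H →ₗ[ℂ] H) n v‖ < ε / 2 := h2
      linarith
    refine tendsto_nhds_unique (tendsto_const_nhds.congr' ?_) h1
    filter_upwards [eventually_ne_atTop 0] with n hn
    rw [cesaroMap_apply, cesaroMean_eq_self hfix hn]
  have hex : ∀ f, ∃ g, Tendsto (fun n => cesaroMap (S : H →ₗ[ℂ] H) n f) atTop (𝓝 g) := fun f => by
    have : f ∈ cesaroConvergent (S : H →ₗ[ℂ] H) := by rw [htop]; trivial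
    exact this
  choose Q hQ using hex
  exact ⟨linearMapOfTendsto Q (fun n => cesaroMap (S : H →ₗ[ℂ] H) n) (tendsto_pi_nhds.2 hQ), hQ⟩

end Hilbert

/-! ### Extension and convergence from dense subspaces -/

section SeminormFamilies

variable {E ι : Type*} [AddCommGroup E] [Module ℂ E] {p : ι → Seminorm ℂ E}

theorem Seminorm.le_mul_of_tendsto (q : Seminorm ℂ E) {A : ℝ} {u v : ℕ → E} {f g : E}
    (h : ∀ n, q (v n) ≤ A * q (u n)) (hu : Tendsto (fun n => q (u n - f)) atTop (𝓝 0))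
    (hv : Tendsto (fun n => q (v n - g)) atTop (𝓝 0)) : q g ≤ A * q f := by
  have key : ∀ {w : ℕ → E} {a : E}, Tendsto (fun n => q (w n - a)) atTop (𝓝 0) →
      Tendsto (fun n => q (w n)) atTop (𝓝 (q a)) := fun {w a} hw => by
    rw [tendsto_iff_dist_tendsto_zero]
    refine squeeze_zero (fun _ => dist_nonneg) (fun n => ?_) hw
    rw [Real.dist_eq]
    exact abs_sub_map_le_sub q _ _
  exact le_of_tendsto_of_tendsto' (key hv) ((key hu).const_mul A) h

/-- Extension of a linear map by sequential density. -/
theorem exists_linearMap_extension (hsep : ∀ x, (∀ i, p i x = 0) → x = 0) {D : Submodule ℂ E}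
    {W : D →ₗ[ℂ] E} {A : ℝ} (hW : ∀ i (u : D), p i (W u) ≤ A * p i (u : E))
    (happrox : ∀ f : E, ∃ u : ℕ → D, (∀ i, Tendsto (fun n => p i ((u n : E) - f)) atTop (𝓝 0)) ∧
      ∃ g, ∀ i, Tendsto (fun n => p i (W (u n) - g)) atTop (𝓝 0)) :
    ∃ S : E →ₗ[ℂ] E, (∀ u : D, S u = W u) ∧ ∀ i f, p i (S f) ≤ A * p i f := by
  -- `Rel` is the graph of the extension: the limits of pairs `(u n, W (u n))`. The bound passes to
  -- these limits, and with the separation hypothesis it makes the graph single-valued.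
  let Rel : E → E → Prop := fun f g => ∃ u : ℕ → D,
    (∀ i, Tendsto (fun n => p i ((u n : E) - f)) atTop (𝓝 0)) ∧
      ∀ i, Tendsto (fun n => p i (W (u n) - g)) atTop (𝓝 0)
  have hbound : ∀ {f g}, Rel f g → ∀ i, p i g ≤ A * p i f := by
    rintro f g ⟨u, hu, hv⟩ i
    exact (p i).le_mul_of_tendsto (fun n => hW i (u n)) (hu i) (hv i)
  have hlim_add : ∀ {a b : ℕ → E} {x y : E}, (∀ i, Tendsto (fun n => p i (a n - x)) atTop (𝓝 0)) →
      (∀ i, Tendsto (fun n => p i (b n - y)) atTop (𝓝 0)) →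
      ∀ i, Tendsto (fun n => p i (a n + b n - (x + y))) atTop (𝓝 0) := by
    intro a b x y ha hb i
    refine squeeze_zero (fun _ => apply_nonneg _ _) (fun n => ?_)
      (by simpa using (ha i).add (hb i))
    rw [add_sub_add_comm]
    exact map_add_le_add _ _ _
  have hlim_smul : ∀ (c : ℂ) {a : ℕ → E} {x : E},
      (∀ i, Tendsto (fun n => p i (a n - x)) atTop (𝓝 0)) →
      ∀ i, Tendsto (fun n => p i (c • a n - c • x)) atTop (𝓝 0) := by
    intro c a x ha i
    have := (ha i).const_mul ‖c‖
    simp only [mul_zero] at this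
    simpa only [← smul_sub, map_smul_eq_mul] using this
  have hadd : ∀ {f g f' g'}, Rel f g → Rel f' g' → Rel (f + f') (g + g') := by
    rintro f g f' g' ⟨u, hu, hv⟩ ⟨u', hu', hv'⟩
    refine ⟨fun n => u n + u' n, fun i => ?_, fun i => ?_⟩
    · exact hlim_add hu hu' i
    · simp only [map_add]
      exact hlim_add hv hv' i
  have hsmul : ∀ (c : ℂ) {f g}, Rel f g → Rel (c • f) (c • g) := by
    rintro c f g ⟨u, hu, hv⟩
    refine ⟨fun n => c • u n, fun i => ?_, fun i => ?_⟩
    · exact hlim_smul c hu i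
    · simp only [map_smul]
      exact hlim_smul c hv i
  have huniq : ∀ {f g g'}, Rel f g → Rel f g' → g = g' := by
    intro f g g' h h'
    have h1 := hadd h (hsmul (-1) h')
    have h2 : f + (-1 : ℂ) • f = 0 := by rw [neg_one_smul, add_neg_cancel]
    rw [h2] at h1
    have h3 : g + (-1 : ℂ) • g' = 0 := by
      refine hsep _ fun i => le_antisymm ?_ (apply_nonneg _ _)
      simpa using hbound h1 i
    rw [neg_one_smul] at h3
    exact add_neg_eq_zero.1 h3
  have hex : ∀ f, ∃ g, Rel f g := fun f => by
    obtain ⟨u, hu, g, hg⟩ := happrox f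
    exact ⟨g, u, hu, hg⟩
  choose S hS using hex
  refine ⟨{ toFun := S
            map_add' := fun f g => huniq (hS _) (hadd (hS f) (hS g))
            map_smul' := fun c f => huniq (hS _) (hsmul c (hS f)) }, fun u => ?_, fun i f => ?_⟩
  · exact huniq (hS _) ⟨fun _ => u, fun i => by simp, fun i => by simp⟩
  · exact hbound (hS f) i

/-- Mean ergodicity is inherited from a dense set. -/
theorem Seminorm.tendsto_cesaroMean_of_dense (q : Seminorm ℂ E) {S T : E →ₗ[ℂ] E} {A : ℝ}
    (hS : ∀ n f, q ((S ^ n) f) ≤ A * q f) (hT : ∀ f, q (T f) ≤ A * q f) (f : E)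
    (hdense : ∀ ε > 0, ∃ u, q (f - u) < ε ∧
      Tendsto (fun n => q (cesaroMean S n u - T u)) atTop (𝓝 0)) :
    Tendsto (fun n => q (cesaroMean S n f - T f)) atTop (𝓝 0) := by
  rw [Metric.tendsto_atTop]
  intro ε hε
  obtain ⟨u, hu, hlim⟩ := hdense (ε / (3 * (|A| + 1))) (by positivity)
  obtain ⟨N, hN⟩ := Metric.tendsto_atTop.1 hlim (ε / 3) (by positivity)
  refine ⟨N, fun n hn => ?_⟩
  have h1 := hN n hn
  rw [Real.dist_0_eq_abs, abs_of_nonneg (apply_nonneg _ _)] at h1 ⊢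
  have hA : A * q (f - u) < ε / 3 := by
    calc A * q (f - u) ≤ (|A| + 1) * q (f - u) := by
          gcongr
          linarith [le_abs_self A]
      _ < (|A| + 1) * (ε / (3 * (|A| + 1))) := by gcongr
      _ = ε / 3 := by field_simp
  have h2 : q (cesaroMean S n (f - u)) ≤ A * q (f - u) := q.cesaroMean_le (fun k => hS k _) n
  have h3 := hT (f - u)
  -- The two outer terms are controlled by `A * q (f - u)` uniformly in `n`, the middle one by
  -- convergence at `u`; hence the thirds of `ε`.
  have h4 : cesaroMean S n f - T f =
      cesaroMean S n (f - u) + (cesaroMean S n u - T u) - T (f - u) := by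
    simp only [← cesaroMap_apply, map_sub]
    abel
  rw [h4]
  have h5 := map_sub_le_add q (cesaroMean S n (f - u) + (cesaroMean S n u - T u)) (T (f - u))
  have h6 := map_add_le_add q (cesaroMean S n (f - u)) (cesaroMean S n u - T u)
  linarith

end SeminormFamilies

/-! ### The ergodic decomposition -/

section Projections

variable {E : Type*} [AddCommGroup E] [Module ℂ E] [TopologicalSpace E] [IsTopologicalAddGroup E]
  [ContinuousSMul ℂ E] [T2Space E]

/-- The limit of the Cesàro means is the projection onto the fixed space along the closure of
the range of `I - S`. -/
theorem isProj_of_tendsto_cesaroMean {S T : E →ₗ[ℂ] E} (hS : Continuous S) (hT : Continuous T)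
    (hlim : ∀ f, Tendsto (fun n => cesaroMean S n f) atTop (𝓝 (T f)))
    (hrange : ∀ f, Tendsto (fun n => cesaroMean S n (f - S f)) atTop (𝓝 0)) :
    LinearMap.IsProj (LinearMap.ker (LinearMap.id - S)) T ∧
      LinearMap.IsProj (LinearMap.range (LinearMap.id - S)).topologicalClosure
        (LinearMap.id - T) ∧
      IsCompl (LinearMap.ker (LinearMap.id - S))
        (LinearMap.range (LinearMap.id - S)).topologicalClosure := by
  have hTr : ∀ f, T (f - S f) = 0 := fun f => tendsto_nhds_unique (hlim _) (hrange f)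
  have hTS : ∀ f, T (S f) = T f := fun f => by
    have := hTr f
    rw [map_sub, sub_eq_zero] at this
    exact this.symm
  have hST : ∀ f, S (T f) = T f := fun f => by
    have h1 : Tendsto (fun n => S (cesaroMean S n f)) atTop (𝓝 (S (T f))) :=
      (hS.tendsto _).comp (hlim f)
    simp only [← cesaroMean_apply_self] at h1
    exact (tendsto_nhds_unique h1 (hlim (S f))).trans (hTS f)
  have hproj : LinearMap.IsProj (LinearMap.ker (LinearMap.id - S)) T := by
    refine ⟨fun f => ?_, fun f hf => ?_⟩
    · rw [LinearMap.mem_ker, LinearMap.sub_apply, LinearMap.id_apply, hST, sub_self]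
    · have hf' : S f = f := by
        rw [LinearMap.mem_ker, LinearMap.sub_apply, LinearMap.id_apply, sub_eq_zero] at hf
        exact hf.symm
      refine tendsto_nhds_unique (hlim f) (tendsto_const_nhds.congr' ?_)
      filter_upwards [eventually_ne_atTop 0] with n hn
      rw [cesaroMean_eq_self hf' hn]
  -- The closure of the range is `Ker T`: `T` is continuous and kills the range, and if `T f = 0`
  -- then `f` is the limit of `f` minus its means, which lie in the range.
  have hcl : ∀ f, f ∈ (LinearMap.range (LinearMap.id - S)).topologicalClosure ↔ T f = 0 := by
    refine fun f => ⟨fun hf => ?_, fun hf => ?_⟩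
    · have hsub : (LinearMap.range (LinearMap.id - S)).topologicalClosure ≤ LinearMap.ker T := by
        refine Submodule.topologicalClosure_minimal _ ?_ (isClosed_singleton.preimage hT)
        rintro _ ⟨g, rfl⟩
        exact hTr g
      exact hsub hf
    · have h1 : Tendsto (fun n => f - cesaroMean S n f) atTop (𝓝 f) := by
        simpa [hf] using tendsto_const_nhds.sub (hlim f)
      rw [← SetLike.mem_coe, Submodule.topologicalClosure_coe]
      refine mem_closure_of_tendsto h1 ?_
      filter_upwards [eventually_ne_atTop 0] with n hn
      exact sub_cesaroMean_mem_range S hn f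
  have hTT : ∀ f, T (T f) = T f := fun f => hproj.map_id _ (hproj.map_mem f)
  refine ⟨hproj, ⟨fun f => ?_, fun f hf => ?_⟩, ?_⟩
  · rw [hcl, LinearMap.sub_apply, LinearMap.id_apply, map_sub, hTT, sub_self]
  · rw [LinearMap.sub_apply, LinearMap.id_apply, (hcl f).1 hf, sub_zero]
  · have : (LinearMap.range (LinearMap.id - S)).topologicalClosure = LinearMap.ker T := by
      ext f
      rw [hcl, LinearMap.mem_ker]
    rw [this]
    exact hproj.isCompl

end Projections

/-! ### Complex conjugation on `L²`, which turns adjoints into bilinear transposes -/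

section Conjugation

variable {R : Type*} [MeasurableSpace R] {μ : Measure R}

theorem Lp_star_add (f g : Lp ℂ 2 μ) : star (f + g) = star f + star g := by
  refine Lp.ext ?_
  filter_upwards [Lp.coeFn_star (f + g), Lp.coeFn_add f g, Lp.coeFn_add (star f) (star g),
    Lp.coeFn_star f, Lp.coeFn_star g] with x h1 h2 h3 h4 h5
  rw [h1, h3, Pi.add_apply, h4, h5, Pi.star_apply, h2]
  exact star_add _ _

theorem Lp_star_smul (c : ℂ) (f : Lp ℂ 2 μ) : star (c • f) = star c • star f := by
  refine Lp.ext ?_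
  filter_upwards [Lp.coeFn_star (c • f), Lp.coeFn_smul c f, Lp.coeFn_smul (star c) (star f),
    Lp.coeFn_star f] with x h1 h2 h3 h4
  rw [h1, h3, Pi.smul_apply, h4, Pi.star_apply, h2]
  simp

theorem Lp_norm_star (f : Lp ℂ 2 μ) : ‖star f‖ = ‖f‖ := by
  rw [Lp.norm_def, Lp.norm_def, eLpNorm_congr_ae (Lp.coeFn_star f), eLpNorm_star]

theorem integral_mul_eq_inner (f g : Lp ℂ 2 μ) :
    ∫ x, f x * g x ∂μ = inner ℂ (star g) f := by
  rw [L2.inner_def]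
  refine integral_congr_ae ?_
  filter_upwards [Lp.coeFn_star g] with x hx
  rw [hx]
  simp [RCLike.inner_apply]

/-- The operator `g ↦ conj (W (conj g))`. -/
noncomputable def conjOperator (W : Lp ℂ 2 μ →ₗ[ℂ] Lp ℂ 2 μ) : Lp ℂ 2 μ →ₗ[ℂ] Lp ℂ 2 μ where
  toFun g := star (W (star g))
  map_add' f g := by rw [Lp_star_add, map_add, Lp_star_add]
  map_smul' c f := by
    rw [Lp_star_smul, map_smul, Lp_star_smul, star_star, RingHom.id_apply]

theorem conjOperator_apply (W : Lp ℂ 2 μ →ₗ[ℂ] Lp ℂ 2 μ) (g : Lp ℂ 2 μ) :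
    conjOperator W g = star (W (star g)) := rfl

theorem conjOperator_pow (W : Lp ℂ 2 μ →ₗ[ℂ] Lp ℂ 2 μ) (n : ℕ) :
    conjOperator W ^ n = conjOperator (W ^ n) := by
  induction n with
  | zero => ext1 g; simp [conjOperator_apply]
  | succ n ih =>
    ext1 g
    rw [pow_succ, pow_succ, Module.End.mul_apply, ih]
    simp [conjOperator_apply]

theorem cesaroMap_conjOperator (W : Lp ℂ 2 μ →ₗ[ℂ] Lp ℂ 2 μ) (n : ℕ) :
    cesaroMap (conjOperator W) n = conjOperator (cesaroMap W n) := by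
  have hsum : ∀ s : Finset ℕ, ∑ i ∈ s, conjOperator W ^ i = conjOperator (∑ i ∈ s, W ^ i) := by
    intro s
    induction s using Finset.induction_on with
    | empty =>
      ext1 g
      have h0 := Lp_star_smul (μ := μ) 0 0
      rw [zero_smul, star_zero, zero_smul] at h0
      simp [conjOperator_apply, h0]
    | insert a s ha ih =>
      ext1 g
      rw [Finset.sum_insert ha, Finset.sum_insert ha, ih, conjOperator_pow]
      simp [conjOperator_apply, Lp_star_add]
  ext1 g
  simp [cesaroMap, hsum, conjOperator_apply, Lp_star_smul]

end Conjugation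

/-! ### Stability of the pairing estimate -/

section PairingBounded

variable {R : Type*} [MeasurableSpace R] {μ : Measure R}

/-- Operators on `L²` with `∫₀^∞ (W f)^* ψ^* dλ ≤ A ∫₀^∞ f^* ψ^* dλ`. -/
def PairingBounded (A : ℝ≥0) (W : Lp ℂ 2 μ →ₗ[ℂ] Lp ℂ 2 μ) : Prop :=
  ∀ (f : Lp ℂ 2 μ) (ψ : R → ℝ≥0∞), Measurable ψ →
    rearrangementPairing μ (fun x => ‖W f x‖ₑ) ψ ≤
      A * rearrangementPairing μ (fun x => ‖f x‖ₑ) ψ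

/-- Transposed operators with respect to the bilinear form `∫ f g`. -/
def AreTransposed (W W' : Lp ℂ 2 μ →ₗ[ℂ] Lp ℂ 2 μ) : Prop :=
  ∀ f g : Lp ℂ 2 μ, ∫ x, W f x * g x ∂μ = ∫ x, f x * W' g x ∂μ

theorem measurable_enorm_Lp (f : Lp ℂ 2 μ) : Measurable fun x => ‖f x‖ₑ :=
  (Lp.stronglyMeasurable f).enorm

theorem PairingBounded.enorm_integral_le [IsResonant μ] {A : ℝ≥0}
    {W : Lp ℂ 2 μ →ₗ[ℂ] Lp ℂ 2 μ} (hW : PairingBounded A W) (f g : Lp ℂ 2 μ) :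
    ‖∫ x, W f x * g x ∂μ‖ₑ ≤
      A * rearrangementPairing μ (fun x => ‖f x‖ₑ) (fun x => ‖g x‖ₑ) := by
  refine (enorm_integral_le_lintegral_enorm _).trans ?_
  simp only [enorm_mul]
  exact (lintegral_mul_le_rearrangementPairing (measurable_enorm_Lp _)
    (measurable_enorm_Lp _)).trans (hW f _ (measurable_enorm_Lp _))

/-- By resonance the pairing of `W f` with `ψ` is a supremum of integrals of `|W f| h` with `h`
equimeasurable with `ψ`. After truncating `h` into `L²`, multiplication by the conjugate sign of `W
f` writes such an integral as `∫ W f · g` with `|g| ≤ h`. -/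
theorem pairingBounded_of_enorm_integral_le [SigmaFinite μ] [IsResonant μ] {A : ℝ≥0}
    {W : Lp ℂ 2 μ →ₗ[ℂ] Lp ℂ 2 μ}
    (hW : ∀ f g : Lp ℂ 2 μ, ‖∫ x, W f x * g x ∂μ‖ₑ ≤
      A * rearrangementPairing μ (fun x => ‖f x‖ₑ) (fun x => ‖g x‖ₑ)) :
    PairingBounded A W := by
  intro f ψ hψ
  refine rearrangementPairing_le (measurable_enorm_Lp _) hψ fun h hh e => ?_
  have e' : rearrangementPairing μ (fun x => ‖f x‖ₑ) ψ =
      rearrangementPairing μ (fun x => ‖f x‖ₑ) h := by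
    simp only [rearrangementPairing, e]
  rw [e']
  refine RIBanachFunctionNorm.lintegral_le_of_truncation (measurable_enorm_Lp _) hh fun k => ?_
  set w := RIBanachFunctionNorm.truncation μ h k
  have hw : Measurable w := RIBanachFunctionNorm.measurable_truncation hh k
  have hLp : MemLp (fun x => (w x).toReal) 2 μ :=
    RIBanachFunctionNorm.memLp_toReal_of_le_indicator hw (measurableSet_spanningSets μ k)
      (measure_spanningSets_lt_top μ k) (RIBanachFunctionNorm.truncation_le_indicator h k) 2
  have hfin : ∀ x, w x ≠ ∞ := fun x => ne_top_of_le_ne_top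
    (b := (k : ℝ≥0∞)) (ENNReal.natCast_ne_top k)
    ((Set.indicator_le_self _ _ _).trans (min_le_right _ _))
  have hWm : Measurable (W f : R → ℂ) := (Lp.stronglyMeasurable (W f)).measurable
  -- The conjugate sign of `W f`; it is `0` where `W f = 0`, because `0 / 0 = 0`.
  set s : R → ℂ := fun x => star (W f x) / (‖W f x‖ : ℂ)
  have hsm : Measurable s := by fun_prop
  have hs1 : ∀ x, ‖s x‖ ≤ 1 := fun x => by
    simp only [s, norm_div, norm_star, Complex.norm_real, norm_norm]
    exact div_self_le_one _
  have hs : ∀ x, W f x * s x = (‖W f x‖ : ℂ) := fun x => by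
    by_cases h0 : W f x = 0
    · simp [s, h0]
    · have h1 : (‖W f x‖ : ℂ) ≠ 0 := by simpa using h0
      simp only [s]
      rw [← mul_div_assoc, div_eq_iff h1]
      have := Complex.mul_conj (W f x)
      rw [Complex.normSq_eq_norm_sq] at this
      rw [← sq]
      simpa using this
  have hLp' : MemLp (fun x => s x * ((w x).toReal : ℂ)) 2 μ := by
    refine hLp.mono (by fun_prop) (ae_of_all _ fun x => ?_)
    rw [norm_mul, Complex.norm_real]
    exact mul_le_of_le_one_left (norm_nonneg _) (hs1 x)
  have hcoe := hLp'.coeFn_toLp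
  have h1 := hW f (hLp'.toLp _)
  have h2 : ∫ x, W f x * hLp'.toLp _ x ∂μ = ((∫ x, ‖W f x‖ * (w x).toReal ∂μ : ℝ) : ℂ) := by
    rw [← integral_complex_ofReal]
    refine integral_congr_ae ?_
    filter_upwards [hcoe] with x hx
    rw [hx, ← mul_assoc, hs]
    simp
  have hint : Integrable (fun x => ‖W f x‖ * (w x).toReal) μ :=
    (Lp.memLp (W f)).norm.integrable_mul hLp
  have h3 : ‖∫ x, W f x * hLp'.toLp _ x ∂μ‖ₑ = ∫⁻ x, ‖W f x‖ₑ * w x ∂μ := by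
    have hnn : ∀ x, 0 ≤ ‖W f x‖ * (w x).toReal := fun x =>
      mul_nonneg (norm_nonneg _) ENNReal.toReal_nonneg
    rw [h2, ← ofReal_norm, Complex.norm_real,
      Real.norm_of_nonneg (integral_nonneg hnn),
      ofReal_integral_eq_lintegral_ofReal hint (ae_of_all _ hnn)]
    refine lintegral_congr fun x => ?_
    rw [ENNReal.ofReal_mul (norm_nonneg _), ENNReal.ofReal_toReal (hfin x), ofReal_norm]
  rw [← h3]
  refine h1.trans (mul_le_mul_right (rearrangementPairing_mono (ae_eq_refl _).le ?_) _)
  filter_upwards [hcoe] with x hx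
  rw [hx, enorm_mul]
  have h4 : ‖s x‖ₑ ≤ 1 := by
    rw [← ofReal_norm]
    exact ENNReal.ofReal_le_one.2 (hs1 x)
  have h5 : ‖((w x).toReal : ℂ)‖ₑ = w x := by
    rw [← ofReal_norm, Complex.norm_real, Real.norm_of_nonneg ENNReal.toReal_nonneg,
      ENNReal.ofReal_toReal (hfin x)]
  rw [h5]
  exact (mul_le_of_le_one_left zero_le h4).trans
    (RIBanachFunctionNorm.truncation_le h k x)

/-- In its bilinear form the estimate is symmetric under exchanging the two arguments. -/
theorem PairingBounded.transposed [SigmaFinite μ] [IsResonant μ] {A : ℝ≥0}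
    {W W' : Lp ℂ 2 μ →ₗ[ℂ] Lp ℂ 2 μ} (hW : PairingBounded A W) (h : AreTransposed W W') :
    PairingBounded A W' := by
  refine pairingBounded_of_enorm_integral_le fun f g => ?_
  have h1 := hW.enorm_integral_le g f
  rw [h, rearrangementPairing_comm] at h1
  simpa only [mul_comm] using h1

theorem AreTransposed.pow {W W' : Lp ℂ 2 μ →ₗ[ℂ] Lp ℂ 2 μ} (h : AreTransposed W W') (n : ℕ) :
    AreTransposed (W ^ n) (W' ^ n) := by
  induction n with
  | zero => exact fun f g => rfl
  | succ n ih =>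
    intro f g
    rw [pow_succ, pow_succ', Module.End.mul_apply, Module.End.mul_apply, ih, h]

theorem tendsto_integral_mul {u : ℕ → Lp ℂ 2 μ} {f : Lp ℂ 2 μ} (hu : Tendsto u atTop (𝓝 f))
    (g : Lp ℂ 2 μ) :
    Tendsto (fun n => ∫ x, u n x * g x ∂μ) atTop (𝓝 (∫ x, f x * g x ∂μ)) := by
  simp only [integral_mul_eq_inner]
  exact tendsto_const_nhds.inner hu

theorem enorm_integral_cesaroMap_le [IsResonant μ] {A : ℝ≥0} {S : Lp ℂ 2 μ →ₗ[ℂ] Lp ℂ 2 μ}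
    (hS : ∀ n, PairingBounded A (S ^ n)) (n : ℕ) (f g : Lp ℂ 2 μ) :
    ‖∫ x, cesaroMap S n f x * g x ∂μ‖ₑ ≤
      A * rearrangementPairing μ (fun x => ‖f x‖ₑ) (fun x => ‖g x‖ₑ) := by
  -- Seminorms are real valued, so an infinite bound is set aside. Otherwise `u ↦ |∫ u g|` is a
  -- seminorm bounded along the orbit of `f`, hence on its means.
  by_cases htop : A * rearrangementPairing μ (fun x => ‖f x‖ₑ) (fun x => ‖g x‖ₑ) = ∞
  · rw [htop]; exact le_top
  · let q : Seminorm ℂ (Lp ℂ 2 μ) :=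
      (normSeminorm ℂ ℂ).comp (innerSL ℂ (star g) : Lp ℂ 2 μ →ₗ[ℂ] ℂ)
    have hq : ∀ u : Lp ℂ 2 μ, q u = ‖∫ x, u x * g x ∂μ‖ := fun u => by
      rw [integral_mul_eq_inner]
      rfl
    have h1 := q.cesaroMean_le (S := S) (f := f)
      (c := (A * rearrangementPairing μ (fun x => ‖f x‖ₑ) (fun x => ‖g x‖ₑ)).toReal)
      (fun n => by
        rw [hq, ← toReal_enorm]
        exact ENNReal.toReal_mono htop ((hS n).enorm_integral_le f g)) n
    rw [hq, ← cesaroMap_apply, ← toReal_enorm] at h1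
    exact (ENNReal.toReal_le_toReal enorm_ne_top htop).1 h1

theorem PairingBounded.of_tendsto_cesaroMap [SigmaFinite μ] [IsResonant μ] {A : ℝ≥0}
    {S Q : Lp ℂ 2 μ →ₗ[ℂ] Lp ℂ 2 μ} (hS : ∀ n, PairingBounded A (S ^ n))
    (hQ : ∀ f, Tendsto (fun n => cesaroMap S n f) atTop (𝓝 (Q f))) : PairingBounded A Q := by
  refine pairingBounded_of_enorm_integral_le fun f g => ?_
  exact le_of_tendsto' ((continuous_enorm.tendsto _).comp (tendsto_integral_mul (hQ f) g))
    fun n => enorm_integral_cesaroMap_le hS n f g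

theorem PairingBounded.cesaroMap [SigmaFinite μ] [IsResonant μ] {A : ℝ≥0}
    {S : Lp ℂ 2 μ →ₗ[ℂ] Lp ℂ 2 μ} (hS : ∀ n, PairingBounded A (S ^ n)) (n : ℕ) :
    PairingBounded A (cesaroMap S n) :=
  pairingBounded_of_enorm_integral_le fun f g => enorm_integral_cesaroMap_le hS n f g

theorem AreTransposed.of_tendsto_cesaroMap {S S' Q Q' : Lp ℂ 2 μ →ₗ[ℂ] Lp ℂ 2 μ}
    (h : AreTransposed S S') (hQ : ∀ f, Tendsto (fun n => cesaroMap S n f) atTop (𝓝 (Q f)))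
    (hQ' : ∀ f, Tendsto (fun n => cesaroMap S' n f) atTop (𝓝 (Q' f))) :
    AreTransposed Q Q' := by
  intro f g
  have h1 := tendsto_integral_mul (hQ f) g
  have h2 := tendsto_integral_mul (hQ' g) f
  have h3 : ∀ n, ∫ x, cesaroMap S n f x * g x ∂μ = ∫ x, cesaroMap S' n g x * f x ∂μ := fun n => by
    have hp : ∀ i, inner ℂ (star g) ((S ^ i) f) = inner ℂ (star f) ((S' ^ i) g) := fun i => by
      rw [← integral_mul_eq_inner, ← integral_mul_eq_inner, h.pow i]
      simp only [mul_comm]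
    rw [integral_mul_eq_inner, integral_mul_eq_inner]
    simp only [cesaroMap, LinearMap.smul_apply, LinearMap.sum_apply, inner_smul_right, inner_sum,
      hp]
  simp only [h3] at h1
  rw [tendsto_nhds_unique h1 h2]
  simp only [mul_comm]

end PairingBounded

/-! ### The composition operator on `L²` -/

section CompositionL2

variable {R : Type*} [MeasurableSpace R] {μ : Measure R}

/-- The hypothesis says that the image of `μ` under `τ` is at most `A μ`; change of variables does
the rest. -/
theorem eLpNorm_comp_le {A : ℝ≥0} {τ : R → R} (hτ : Measure.QuasiMeasurePreserving τ μ μ)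
    (hA : ∀ E, MeasurableSet E → μ (τ ⁻¹' E) ≤ A * μ E) {f : R → ℂ}
    (hf : AEStronglyMeasurable f μ) :
    eLpNorm (f ∘ τ) 2 μ ≤ (A : ℝ≥0∞) ^ (1 / (2 : ℝ≥0∞)).toReal * eLpNorm f 2 μ := by
  rw [← eLpNorm_map_measure (hf.mono_ac hτ.absolutelyContinuous) hτ.measurable.aemeasurable,
    ← smul_eq_mul, ← eLpNorm_smul_measure_of_ne_top (by simp)]
  refine eLpNorm_mono_measure f (Measure.le_iff.2 fun E hE => ?_)
  rw [Measure.map_apply hτ.measurable hE, Measure.smul_apply, smul_eq_mul]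
  exact hA E hE

/-- The composition operator on `L²`. -/
noncomputable def compositionL2 {A : ℝ≥0} {τ : R → R}
    (hτ : Measure.QuasiMeasurePreserving τ μ μ)
    (hA : ∀ E, MeasurableSet E → μ (τ ⁻¹' E) ≤ A * μ E) : Lp ℂ 2 μ →L[ℂ] Lp ℂ 2 μ :=
  LinearMap.mkContinuous
    { toFun := fun f => ⟨(f : R →ₘ[μ] ℂ).compQuasiMeasurePreserving τ hτ, by
        rw [Lp.mem_Lp_iff_eLpNorm_lt_top,
          eLpNorm_congr_ae (AEEqFun.coeFn_compQuasiMeasurePreserving _ hτ)]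
        refine (eLpNorm_comp_le hτ hA (Lp.aestronglyMeasurable f)).trans_lt
          (ENNReal.mul_lt_top ?_ (Lp.eLpNorm_lt_top f))
        exact ENNReal.rpow_lt_top_of_nonneg (by positivity) ENNReal.coe_ne_top⟩
      map_add' := fun f g => by
        refine Lp.ext ?_
        filter_upwards [AEEqFun.coeFn_compQuasiMeasurePreserving (f + g : R →ₘ[μ] ℂ) hτ,
          AEEqFun.coeFn_compQuasiMeasurePreserving (f : R →ₘ[μ] ℂ) hτ,
          AEEqFun.coeFn_compQuasiMeasurePreserving (g : R →ₘ[μ] ℂ) hτ,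
          hτ.ae_eq_comp (AEEqFun.coeFn_add (f : R →ₘ[μ] ℂ) g),
          AEEqFun.coeFn_add ((f : R →ₘ[μ] ℂ).compQuasiMeasurePreserving τ hτ)
            ((g : R →ₘ[μ] ℂ).compQuasiMeasurePreserving τ hτ)] with x h1 h2 h3 h4 h5
        refine h1.trans (h4.trans ?_)
        refine Eq.trans ?_ h5.symm
        rw [Pi.add_apply, h2, h3]
        rfl
      map_smul' := fun c f => by
        refine Lp.ext ?_
        filter_upwards [AEEqFun.coeFn_compQuasiMeasurePreserving (c • f : R →ₘ[μ] ℂ) hτ,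
          AEEqFun.coeFn_compQuasiMeasurePreserving (f : R →ₘ[μ] ℂ) hτ,
          hτ.ae_eq_comp (AEEqFun.coeFn_smul c (f : R →ₘ[μ] ℂ)),
          AEEqFun.coeFn_smul c ((f : R →ₘ[μ] ℂ).compQuasiMeasurePreserving τ hτ)]
          with x h1 h2 h4 h5
        refine h1.trans (h4.trans ?_)
        refine Eq.trans ?_ h5.symm
        rw [Pi.smul_apply, h2]
        rfl }
    ((A : ℝ≥0∞) ^ (1 / (2 : ℝ≥0∞)).toReal).toReal (fun f => by
      rw [Lp.norm_def, Lp.norm_def, ← ENNReal.toReal_mul]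
      refine ENNReal.toReal_mono (ENNReal.mul_lt_top
        (ENNReal.rpow_lt_top_of_nonneg (by positivity) ENNReal.coe_ne_top)
        (Lp.eLpNorm_lt_top f)).ne ?_
      refine le_of_eq_of_le ?_ (eLpNorm_comp_le hτ hA (Lp.aestronglyMeasurable f))
      exact eLpNorm_congr_ae (AEEqFun.coeFn_compQuasiMeasurePreserving (f : R →ₘ[μ] ℂ) hτ))

theorem coe_compositionL2 {A : ℝ≥0} {τ : R → R} (hτ : Measure.QuasiMeasurePreserving τ μ μ)
    (hA : ∀ E, MeasurableSet E → μ (τ ⁻¹' E) ≤ A * μ E) (f : Lp ℂ 2 μ) :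
    (compositionL2 hτ hA f : R →ₘ[μ] ℂ) = (f : R →ₘ[μ] ℂ).compQuasiMeasurePreserving τ hτ := rfl

theorem coeFn_compositionL2_pow {A : ℝ≥0} {τ : R → R}
    (hτ : Measure.QuasiMeasurePreserving τ μ μ)
    (hA : ∀ E, MeasurableSet E → μ (τ ⁻¹' E) ≤ A * μ E) (n : ℕ) (f : Lp ℂ 2 μ) :
    (compositionL2 hτ hA ^ n) f =ᵐ[μ] f ∘ τ^[n] := by
  induction n generalizing f with
  | zero => exact ae_eq_refl _
  | succ n ih =>
    rw [pow_succ', mul_apply_eq_comp]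
    have h1 := AEEqFun.coeFn_compQuasiMeasurePreserving
      ((compositionL2 hτ hA ^ n) f : R →ₘ[μ] ℂ) hτ
    refine h1.trans ((hτ.ae_eq_comp (ih f)).trans (ae_of_all _ fun x => ?_))
    simp

/-- The `L²` part of the ergodic theorem. -/
theorem exists_L2_operators [SigmaFinite μ] [IsResonant μ] {φ : R → R}
    (hφ : PowerMeasureBounded μ φ) :
    ∃ (A : ℝ≥0) (V V' Q Q' : Lp ℂ 2 μ →ₗ[ℂ] Lp ℂ 2 μ),
      (∀ f : Lp ℂ 2 μ, (V f : R →ₘ[μ] ℂ) =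
        (f : R →ₘ[μ] ℂ).compQuasiMeasurePreserving φ hφ.quasiMeasurePreserving) ∧
      (∀ n, PairingBounded A (V ^ n)) ∧ (∀ n, PairingBounded A (V' ^ n)) ∧
      PairingBounded A Q ∧ PairingBounded A Q' ∧ AreTransposed V V' ∧ AreTransposed Q Q' ∧
      (∀ f, Tendsto (fun n => cesaroMap V n f) atTop (𝓝 (Q f))) ∧
      (∀ f, Tendsto (fun n => cesaroMap V' n f) atTop (𝓝 (Q' f))) := by
  obtain ⟨A₀, -, hA₀⟩ := hφ.bound
  -- A constant at least `1` also covers the power `n = 0`, and the dilation estimate requires it.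
  set A : ℝ≥0 := max A₀ 1
  have hA1 : 1 ≤ A := le_max_right _ _
  have hA : ∀ n E, MeasurableSet E → μ (φ^[n] ⁻¹' E) ≤ A * μ E := fun n E hE => by
    rcases Nat.eq_zero_or_pos n with rfl | hn
    · simpa using le_mul_of_one_le_left (zero_le (a := μ E)) (ENNReal.one_le_coe_iff.2 hA1)
    · refine (hA₀ n hn E hE).trans ?_
      gcongr
      exact le_max_left _ _
  have hτ := hφ.quasiMeasurePreserving
  have hA' : ∀ E, MeasurableSet E → μ (φ ⁻¹' E) ≤ A * μ E := fun E hE => by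
    simpa using hA 1 E hE
  set V := compositionL2 hτ hA'
  have hVn : ∀ n, ‖V ^ n‖ ≤ ((A : ℝ≥0∞) ^ (1 / (2 : ℝ≥0∞)).toReal).toReal := fun n => by
    refine ContinuousLinearMap.opNorm_le_bound _ ENNReal.toReal_nonneg fun f => ?_
    rw [Lp.norm_def, Lp.norm_def, ← ENNReal.toReal_mul]
    refine ENNReal.toReal_mono (ENNReal.mul_lt_top
      (ENNReal.rpow_lt_top_of_nonneg (by positivity) ENNReal.coe_ne_top)
      (Lp.eLpNorm_lt_top f)).ne ?_
    rw [eLpNorm_congr_ae (coeFn_compositionL2_pow hτ hA' n f)]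
    exact eLpNorm_comp_le (hτ.iterate n) (hA n) (Lp.aestronglyMeasurable f)
  have hpow : ∀ (B : Lp ℂ 2 μ →L[ℂ] Lp ℂ 2 μ) (n : ℕ) f,
      ((B : Lp ℂ 2 μ →ₗ[ℂ] Lp ℂ 2 μ) ^ n) f = (B ^ n) f := fun B n f => by
    rw [← ContinuousLinearMap.toLinearMap_pow]
    rfl
  have hV : ∀ n, PairingBounded A ((V : Lp ℂ 2 μ →ₗ[ℂ] Lp ℂ 2 μ) ^ n) := fun n f ψ hψ => by
    rw [hpow]
    have h1 : (fun x => ‖(V ^ n) f x‖ₑ) =ᵐ[μ] (fun x => ‖f x‖ₑ) ∘ φ^[n] := by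
      filter_upwards [coeFn_compositionL2_pow hτ hA' n f] with x hx
      rw [hx]
      rfl
    rw [rearrangementPairing_congr h1 (ae_eq_refl ψ)]
    exact rearrangementPairing_le_of_dilation hA1 (fun t _ => rearrangement_comp_le
      (lt_of_lt_of_le one_pos hA1) (hA n) (measurable_enorm_Lp f) t) ψ
  -- The Hilbert adjoint is sesquilinear in nature; conjugating before and after gives the transpose
  -- for `∫ f g`.
  set V' := conjOperator (ContinuousLinearMap.adjoint V : Lp ℂ 2 μ →ₗ[ℂ] Lp ℂ 2 μ)
  have hVV' : AreTransposed (V : Lp ℂ 2 μ →ₗ[ℂ] Lp ℂ 2 μ) V' := fun f g => by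
    rw [integral_mul_eq_inner]
    simp only [mul_comm (f _)]
    have : ∫ x, V' g x * f x ∂μ = ∫ x, f x * V' g x ∂μ := by simp only [mul_comm]
    rw [this, integral_mul_eq_inner, conjOperator_apply, star_star]
    exact (ContinuousLinearMap.adjoint_inner_left V _ _).symm
  obtain ⟨Q, hQ⟩ := ContinuousLinearMap.exists_tendsto_cesaroMap hVn
  have hadj : ∀ n, ‖ContinuousLinearMap.adjoint V ^ n‖ ≤
      ((A : ℝ≥0∞) ^ (1 / (2 : ℝ≥0∞)).toReal).toReal := fun n => by
    have : ContinuousLinearMap.adjoint V ^ n = ContinuousLinearMap.adjoint (V ^ n) := by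
      rw [← ContinuousLinearMap.star_eq_adjoint, ← star_pow, ContinuousLinearMap.star_eq_adjoint]
    rw [this, LinearIsometryEquiv.norm_map]
    exact hVn n
  obtain ⟨P, hP⟩ := ContinuousLinearMap.exists_tendsto_cesaroMap hadj
  have hQ' : ∀ f, Tendsto (fun n => cesaroMap V' n f) atTop (𝓝 (conjOperator P f)) := fun f => by
    have h1 := tendsto_iff_norm_sub_tendsto_zero.1 (hP (star f))
    rw [tendsto_iff_norm_sub_tendsto_zero]
    refine h1.congr fun n => ?_
    rw [cesaroMap_conjOperator, conjOperator_apply, conjOperator_apply, ← Lp_norm_star]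
    congr 1
    rw [sub_eq_add_neg, sub_eq_add_neg, Lp_star_add, ← neg_one_smul ℂ, Lp_star_smul,
      ← neg_one_smul ℂ (star _)]
    simp
  have hV' : ∀ n, PairingBounded A (V' ^ n) := fun n => (hV n).transposed (hVV'.pow n)
  exact ⟨A, V, V', Q, conjOperator P, fun f => coe_compositionL2 hτ hA' f, hV, hV',
    .of_tendsto_cesaroMap hV hQ, .of_tendsto_cesaroMap hV' hQ', hVV',
    hVV'.of_tendsto_cesaroMap hQ hQ', hQ, hQ'⟩

end CompositionL2

/-! ### Middle parts, strictly positive weights and a.e. convergent subsequences -/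

namespace RIBanachFunctionNorm

section Spaces

variable {R : Type*} [MeasurableSpace R] {μ : Measure R}

theorem coe_sub (X : RIBanachFunctionNorm μ) (f g : X.Space) :
    ((f - g : X.Space) : R →ₘ[μ] ℂ) = (f : R →ₘ[μ] ℂ) - (g : R →ₘ[μ] ℂ) := rfl

theorem exists_aeeqFun_enorm_eq {ψ : R → ℝ≥0∞} (hψ : Measurable ψ) (hfin : ∀ x, ψ x ≠ ∞) :
    ∃ g : R →ₘ[μ] ℂ, (fun x => ‖g x‖ₑ) =ᵐ[μ] ψ := by
  have hm : AEStronglyMeasurable (fun x => ((ψ x).toReal : ℂ)) μ :=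
    (Complex.measurable_ofReal.comp hψ.ennreal_toReal).aestronglyMeasurable
  refine ⟨AEEqFun.mk _ hm, ?_⟩
  filter_upwards [AEEqFun.coeFn_mk _ hm] with x hx
  rw [hx, ← ofReal_norm, Complex.norm_real, Real.norm_of_nonneg ENNReal.toReal_nonneg,
    ENNReal.ofReal_toReal (hfin x)]

theorem enorm_eq_of_ae (X : RIBanachFunctionNorm μ) {g : R →ₘ[μ] ℂ} {ψ : R → ℝ≥0∞}
    (hψ : Measurable ψ) (h : (fun x => ‖g x‖ₑ) =ᵐ[μ] ψ) : X.enorm g = X.toFun ψ :=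
  X.congr_ae (measurable_enorm_coe g) hψ h

theorem enorm_mono (X : RIBanachFunctionNorm μ) {f g : R →ₘ[μ] ℂ}
    (h : ∀ᵐ x ∂μ, ‖f x‖ₑ ≤ ‖g x‖ₑ) : X.enorm f ≤ X.enorm g :=
  X.mono' _ _ (measurable_enorm_coe f) (measurable_enorm_coe g) h

/-- The restriction of `f` to the set `1 / (k + 1) < |f| ≤ k + 1`. -/
noncomputable def middlePart (f : R →ₘ[μ] ℂ) (k : ℕ) : R →ₘ[μ] ℂ :=
  AEEqFun.mk ((middleSet (fun x => ‖f x‖ₑ) k).indicator f)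
    (f.aestronglyMeasurable.indicator (measurableSet_middleSet (measurable_enorm_coe f) k))

theorem coeFn_middlePart (f : R →ₘ[μ] ℂ) (k : ℕ) :
    middlePart f k =ᵐ[μ] (middleSet (fun x => ‖f x‖ₑ) k).indicator f :=
  AEEqFun.coeFn_mk _ _

theorem enorm_middlePart_le (f : R →ₘ[μ] ℂ) (k : ℕ) :
    ∀ᵐ x ∂μ, ‖middlePart f k x‖ₑ ≤ ‖f x‖ₑ := by
  filter_upwards [coeFn_middlePart f k] with x hx
  rw [hx]
  by_cases h : x ∈ middleSet (fun x => ‖f x‖ₑ) k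
  · rw [Set.indicator_of_mem h]
  · simp [Set.indicator_of_notMem h]

theorem enorm_middlePart_le_indicator (f : R →ₘ[μ] ℂ) (k : ℕ) :
    ∀ᵐ x ∂μ, ‖middlePart f k x‖ₑ ≤
      (middleSet (fun x => ‖f x‖ₑ) k).indicator (fun _ => ((k + 1 : ℝ≥0) : ℝ≥0∞)) x := by
  filter_upwards [coeFn_middlePart f k] with x hx
  rw [hx]
  by_cases h : x ∈ middleSet (fun x => ‖f x‖ₑ) k
  · rw [Set.indicator_of_mem h, Set.indicator_of_mem h]
    exact h.2
  · simp [Set.indicator_of_notMem h]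

theorem enorm_sub_middlePart (f : R →ₘ[μ] ℂ) (k : ℕ) :
    (fun x => ‖(f - middlePart f k) x‖ₑ) =ᵐ[μ]
      (middleSet (fun x => ‖f x‖ₑ) k)ᶜ.indicator fun x => ‖f x‖ₑ := by
  filter_upwards [coeFn_middlePart f k, AEEqFun.coeFn_sub f (middlePart f k)] with x hx hx'
  rw [hx', Pi.sub_apply, hx]
  by_cases h : x ∈ middleSet (fun x => ‖f x‖ₑ) k
  · rw [Set.indicator_of_mem h, Set.indicator_of_notMem (by simpa using h)]
    simp
  · rw [Set.indicator_of_notMem h, Set.indicator_of_mem (by simpa using h), sub_zero]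

theorem measure_middleSet_lt_top {f : R → ℝ≥0∞}
    (h0 : Tendsto (rearrangement μ f) atTop (𝓝 0)) (k : ℕ) : μ (middleSet f k) < ∞ :=
  lt_of_le_of_lt (measure_mono fun _ hx => hx.1)
    (measure_lt_top_of_tendsto_rearrangement h0 (s := (k + 1 : ℝ≥0)⁻¹) (by positivity))

theorem middlePart_mem_Lp {f : R →ₘ[μ] ℂ}
    (h0 : Tendsto (rearrangement μ fun x => ‖f x‖ₑ) atTop (𝓝 0)) (k : ℕ) :
    middlePart f k ∈ Lp ℂ 2 μ := by
  have hE := measurableSet_middleSet (measurable_enorm_coe f) k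
  have h1 := memLp_indicator_const (μ := μ) 2 hE (k + 1 : ℝ)
    (Or.inr (measure_middleSet_lt_top h0 k).ne)
  rw [Lp.mem_Lp_iff_eLpNorm_lt_top]
  refine (eLpNorm_mono_enorm_ae ?_).trans_lt h1.2
  filter_upwards [enorm_middlePart_le_indicator f k] with x hx
  refine hx.trans (le_of_eq ?_)
  by_cases h : x ∈ middleSet (fun x => ‖f x‖ₑ) k
  · rw [Set.indicator_of_mem h, Set.indicator_of_mem h,
      Real.enorm_of_nonneg (by positivity), ENNReal.ofReal_eq_coe_nnreal (by positivity)]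
    congr 1
  · simp [Set.indicator_of_notMem h]

/-- A strictly positive function of finite norm. -/
theorem exists_pos_toFun_lt_top [SigmaFinite μ] (X : RIBanachFunctionNorm μ) :
    ∃ w : R → ℝ≥0∞, Measurable w ∧ (∀ x, w x ≠ 0) ∧ (∀ x, w x ≠ ∞) ∧ X.toFun w < ∞ := by
  obtain ⟨e, he, hsum⟩ := ENNReal.exists_pos_sum_of_countable (ε := 1) one_ne_zero ℕ
  set χ : ℕ → R → ℝ≥0∞ := fun k => (spanningSets μ k).indicator fun _ => 1
  have hχm : ∀ k, Measurable (χ k) := fun k =>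
    measurable_const.indicator (measurableSet_spanningSets μ k)
  have hχ : ∀ k, X.toFun (χ k) < ∞ := fun k =>
    X.indicator_lt_top' _ (measurableSet_spanningSets μ k) (measure_spanningSets_lt_top μ k)
  -- This choice gives both `c k ≤ e k`, so that the series is finite pointwise, and `c k * ‖χ k‖ ≤
  -- e k`, so that its norm is finite.
  set c : ℕ → ℝ≥0 := fun k => e k / (1 + (X.toFun (χ k)).toNNReal)
  have hc0 : ∀ k, 0 < c k := fun k => div_pos (he k) (by positivity)
  have hce : ∀ k, c k ≤ e k := fun k => div_le_self (zero_le) (by simp)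
  have hcX : ∀ k, c k * X.toFun (χ k) ≤ e k := fun k => by
    rw [← ENNReal.coe_toNNReal (hχ k).ne, ← ENNReal.coe_mul, ENNReal.coe_le_coe]
    simp only [c]
    rw [div_mul_eq_mul_div, div_le_iff₀ (by positivity)]
    gcongr
    simp
  have hm : ∀ n, Measurable fun x => ∑ k ∈ Finset.range n, (c k : ℝ≥0∞) * χ k x := fun n =>
    Finset.measurable_fun_sum _ fun k _ => (hχm k).const_mul _
  have hpart : ∀ n, X.toFun (fun x => ∑ k ∈ Finset.range n, (c k : ℝ≥0∞) * χ k x) ≤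
      ∑ k ∈ Finset.range n, (e k : ℝ≥0∞) := fun n => by
    induction n with
    | zero =>
      simp only [Finset.range_zero, Finset.sum_empty, nonpos_iff_eq_zero]
      exact (X.eq_zero_iff' _ measurable_const).2 (ae_eq_refl _)
    | succ n ih =>
      simp only [Finset.sum_range_succ]
      refine (X.add_le' _ _ (hm n) ((hχm n).const_mul _)).trans (add_le_add ih ?_)
      rw [X.smul' _ _ (hχm n)]
      exact hcX n
  have hwm : Measurable fun x => ∑' k, (c k : ℝ≥0∞) * χ k x :=
    Measurable.tsum fun k => (hχm k).const_mul _
  refine ⟨_, hwm, fun x => ?_, fun x => ?_, ?_⟩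
  · have hx : x ∈ ⋃ k, spanningSets μ k := by rw [iUnion_spanningSets]; trivial
    obtain ⟨k, hk⟩ := Set.mem_iUnion.1 hx
    intro h0
    have := ENNReal.tsum_eq_zero.1 h0 k
    simp only [χ, Set.indicator_of_mem hk, mul_one, ENNReal.coe_eq_zero] at this
    exact (hc0 k).ne' this
  · refine ne_top_of_le_ne_top (hsum.trans ENNReal.one_lt_top).ne (ENNReal.tsum_le_tsum fun k => ?_)
    refine (mul_le_of_le_one_right zero_le (Set.indicator_le_self' (fun _ _ => zero_le) x)).trans ?_
    exact_mod_cast hce k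
  · refine lt_of_le_of_lt (X.toFun_le_of_tendsto hm hwm (fun n => (hpart n).trans
      (ENNReal.sum_le_tsum _)) (ae_of_all _ fun x => ?_)) (hsum.trans ENNReal.one_lt_top)
    exact ENNReal.tendsto_nat_tsum _

/-- Since `w > 0`, the measures `w μ` and `μ` have the same null sets, and the hypothesis is
convergence in `L¹(w μ)`. -/
theorem exists_subseq_tendsto_ae_of_weight {w : R → ℝ≥0∞} (hw : Measurable w)
    (hw0 : ∀ x, w x ≠ 0) {u : ℕ → R →ₘ[μ] ℂ} {f : R →ₘ[μ] ℂ}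
    (h : Tendsto (fun n => ∫⁻ x, ‖(u n - f) x‖ₑ * w x ∂μ) atTop (𝓝 0)) :
    ∃ ns : ℕ → ℕ, StrictMono ns ∧
      ∀ᵐ x ∂μ, Tendsto (fun i => u (ns i) x) atTop (𝓝 (f x)) := by
  have hac : μ.withDensity w ≪ μ := withDensity_absolutelyContinuous μ w
  have hac' : μ ≪ μ.withDensity w :=
    withDensity_absolutelyContinuous' hw.aemeasurable (ae_of_all _ hw0)
  have h1 : ∀ n, eLpNorm (⇑(u n) - ⇑f) 1 (μ.withDensity w) = ∫⁻ x, ‖(u n - f) x‖ₑ * w x ∂μ := by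
    intro n
    rw [eLpNorm_one_eq_lintegral_enorm, lintegral_withDensity_eq_lintegral_mul _ hw
      ((u n).stronglyMeasurable.sub f.stronglyMeasurable).enorm]
    refine lintegral_congr_ae ?_
    filter_upwards [AEEqFun.coeFn_sub (u n) f] with x hx
    rw [hx, Pi.mul_apply, mul_comm]
  have h2 : TendstoInMeasure (μ.withDensity w) (fun n => ⇑(u n)) atTop f := by
    refine tendstoInMeasure_of_tendsto_eLpNorm one_ne_zero
      (fun n => (u n).stronglyMeasurable.aestronglyMeasurable)
      f.stronglyMeasurable.aestronglyMeasurable ?_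
    simpa only [h1] using h
  obtain ⟨ns, hns, hlim⟩ := h2.exists_seq_tendsto_ae
  exact ⟨ns, hns, hac'.ae_le hlim⟩

/-- Completeness of `L¹(w μ)`, again with the null sets of `μ`. -/
theorem exists_limit_of_cauchy_weight {w : R → ℝ≥0∞} (hw : Measurable w)
    (hw0 : ∀ x, w x ≠ 0) {u : ℕ → R →ₘ[μ] ℂ} (hfin : ∀ n, ∫⁻ x, ‖u n x‖ₑ * w x ∂μ ≠ ∞)
    (h : ∀ ε > 0, ∃ N, ∀ m ≥ N, ∀ n ≥ N, ∫⁻ x, ‖(u m - u n) x‖ₑ * w x ∂μ ≤ ENNReal.ofReal ε) :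
    ∃ (g : R →ₘ[μ] ℂ) (ns : ℕ → ℕ), StrictMono ns ∧
      ∀ᵐ x ∂μ, Tendsto (fun i => u (ns i) x) atTop (𝓝 (g x)) := by
  have hac : μ.withDensity w ≪ μ := withDensity_absolutelyContinuous μ w
  have hac' : μ ≪ μ.withDensity w :=
    withDensity_absolutelyContinuous' hw.aemeasurable (ae_of_all _ hw0)
  have hmem : ∀ n, MemLp (u n) 1 (μ.withDensity w) := fun n => by
    refine ⟨(u n).stronglyMeasurable.aestronglyMeasurable, ?_⟩
    rw [eLpNorm_one_eq_lintegral_enorm, lintegral_withDensity_eq_lintegral_mul _ hw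
      (measurable_enorm_coe _), lt_top_iff_ne_top]
    simpa only [Pi.mul_apply, mul_comm] using hfin n
  have hdist : ∀ m n, ENNReal.ofReal (dist ((hmem m).toLp _) ((hmem n).toLp _)) =
      ∫⁻ x, ‖(u m - u n) x‖ₑ * w x ∂μ := fun m n => by
    rw [← edist_dist, Lp.edist_toLp_toLp, eLpNorm_one_eq_lintegral_enorm,
      lintegral_withDensity_eq_lintegral_mul _ hw
      ((u m).stronglyMeasurable.sub (u n).stronglyMeasurable).enorm]
    refine lintegral_congr_ae ?_
    filter_upwards [AEEqFun.coeFn_sub (u m) (u n)] with x hx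
    rw [hx, Pi.mul_apply, mul_comm]
  have hc : CauchySeq fun n => (hmem n).toLp (u n) := by
    rw [Metric.cauchySeq_iff]
    intro ε hε
    obtain ⟨N, hN⟩ := h (ε / 2) (half_pos hε)
    refine ⟨N, fun m hm n hn => ?_⟩
    have h1 := hN m hm n hn
    rw [← hdist] at h1
    have := (ENNReal.ofReal_le_ofReal_iff (half_pos hε).le).1 h1
    linarith
  obtain ⟨G, hG⟩ := cauchySeq_tendsto_of_complete hc
  obtain ⟨ns, hns, hlim⟩ := (tendstoInMeasure_of_tendsto_Lp hG).exists_seq_tendsto_ae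
  have hGm : AEStronglyMeasurable (G : R → ℂ) μ := (Lp.stronglyMeasurable G).aestronglyMeasurable
  refine ⟨AEEqFun.mk G hGm, ns, hns, ?_⟩
  have hae : ∀ᵐ x ∂μ.withDensity w, ∀ i, (hmem (ns i)).toLp (u (ns i)) x = u (ns i) x :=
    ae_all_iff.2 fun i => (hmem (ns i)).coeFn_toLp
  filter_upwards [hac'.ae_le hlim, hac'.ae_le hae, AEEqFun.coeFn_mk _ hGm] with x h1 h2 h3
  rw [h3]
  simpa only [h2] using h1

end Spaces

end RIBanachFunctionNorm

/-! ### Separation and sequential completeness of `ξ` -/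

namespace RIBanachFunctionNorm

section XiTopology

variable {R : Type*} [MeasurableSpace R] {μ : Measure R} [SigmaFinite μ] [IsResonant μ]
  (X : RIBanachFunctionNorm μ)

theorem xiSeminorm_apply (ψ : X.associate.Space) (f : X.Space) :
    X.xiSeminorm ψ f = (rearrangementPairing μ (fun x => ‖(ψ : R →ₘ[μ] ℂ) x‖ₑ)
      (fun x => ‖(f : R →ₘ[μ] ℂ) x‖ₑ)).toReal := rfl

theorem ofReal_xiSeminorm (ψ : X.associate.Space) (f : X.Space) :
    ENNReal.ofReal (X.xiSeminorm ψ f) = rearrangementPairing μ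
      (fun x => ‖(ψ : R →ₘ[μ] ℂ) x‖ₑ) (fun x => ‖(f : R →ₘ[μ] ℂ) x‖ₑ) :=
  ENNReal.ofReal_toReal (X.rearrangementPairing_ne_top ψ f)

variable {X}

/-- By the Lorentz–Luxemburg theorem `‖g‖_X` is computed by testing against `X'`. Truncation makes
the test functions finite, so that they come from classes of complex functions. -/
theorem enorm_le_of_rearrangementPairing_le {A : ℝ≥0} {f g : R →ₘ[μ] ℂ} (hf : X.enorm f < ∞)
    (h : ∀ ψ : R →ₘ[μ] ℂ, X.associate.enorm ψ < ∞ →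
      rearrangementPairing μ (fun x => ‖ψ x‖ₑ) (fun x => ‖g x‖ₑ) ≤
        A * rearrangementPairing μ (fun x => ‖ψ x‖ₑ) (fun x => ‖f x‖ₑ)) :
    X.enorm g ≤ A * X.enorm f := by
  rw [enorm, ← X.associate_associate_toFun (measurable_enorm_coe g)]
  refine X.associate.associateFun_le fun ψ hψ hψX => ?_
  refine lintegral_le_of_truncation (measurable_enorm_coe g) hψ fun k => ?_
  have hm := measurable_truncation (μ := μ) hψ k
  have hfin : ∀ x, truncation μ ψ k x ≠ ∞ := fun x => ne_top_of_le_ne_top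
    (b := (k : ℝ≥0∞)) (ENNReal.natCast_ne_top k)
    ((Set.indicator_le_self _ _ _).trans (min_le_right _ _))
  obtain ⟨η, hη⟩ := exists_aeeqFun_enorm_eq (μ := μ) hm hfin
  have h1 : X.associate.enorm η ≤ X.associate.toFun ψ := by
    rw [X.associate.enorm_eq_of_ae hm hη]
    exact X.associate.mono' _ _ hm hψ (ae_of_all _ (truncation_le ψ k))
  calc ∫⁻ x, ‖g x‖ₑ * truncation μ ψ k x ∂μ
      = ∫⁻ x, ‖η x‖ₑ * ‖g x‖ₑ ∂μ := by
        refine lintegral_congr_ae ?_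
        filter_upwards [hη] with x hx
        rw [hx, mul_comm]
    _ ≤ rearrangementPairing μ (fun x => ‖η x‖ₑ) (fun x => ‖g x‖ₑ) :=
        lintegral_mul_le_rearrangementPairing (measurable_enorm_coe η) (measurable_enorm_coe g)
    _ ≤ A * rearrangementPairing μ (fun x => ‖η x‖ₑ) (fun x => ‖f x‖ₑ) :=
        h η (h1.trans_lt hψX)
    _ ≤ A * (X.associate.toFun ψ * X.enorm f) := by
        gcongr
        exact (X.rearrangementPairing_le_enorm η f hf).trans (by gcongr)
    _ = A * X.enorm f * X.associate.toFun ψ := by ring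

-- A strictly positive member of `X'` makes `ξ` finer than the topology of `L¹(w μ)`. This yields
-- separation, a.e. convergent subsequences and candidates for limits.
variable (X) in
theorem exists_weight : ∃ (w : R → ℝ≥0∞) (ψ : X.associate.Space), Measurable w ∧
    (∀ x, w x ≠ 0) ∧ ∀ f : R →ₘ[μ] ℂ, ∫⁻ x, ‖f x‖ₑ * w x ∂μ ≤
      rearrangementPairing μ (fun x => ‖(ψ : R →ₘ[μ] ℂ) x‖ₑ) (fun x => ‖f x‖ₑ) := by
  obtain ⟨w, hw, hw0, hwt, hwX⟩ := X.associate.exists_pos_toFun_lt_top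
  obtain ⟨η, hη⟩ := exists_aeeqFun_enorm_eq (μ := μ) hw hwt
  have hmem : X.associate.enorm η < ∞ := by rwa [X.associate.enorm_eq_of_ae hw hη]
  refine ⟨w, ⟨η, hmem⟩, hw, hw0, fun f => ?_⟩
  rw [rearrangementPairing_comm]
  refine (lintegral_mul_le_rearrangementPairing (measurable_enorm_coe f) hw).trans ?_
  exact rearrangementPairing_mono (ae_eq_refl _).le hη.symm.le

theorem eq_zero_of_xiSeminorm_eq_zero {f : X.Space} (h : ∀ ψ, X.xiSeminorm ψ f = 0) : f = 0 := by
  obtain ⟨w, ψ, hw, hw0, hwψ⟩ := X.exists_weight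
  have h1 := hwψ (f : R →ₘ[μ] ℂ)
  rw [← X.ofReal_xiSeminorm, h ψ, ENNReal.ofReal_zero, nonpos_iff_eq_zero] at h1
  have h2 := (lintegral_eq_zero_iff ((measurable_enorm_coe (f : R →ₘ[μ] ℂ)).mul hw)).1 h1
  refine Subtype.ext (AEEqFun.ext ?_)
  filter_upwards [h2, AEEqFun.coeFn_zero (μ := μ) (β := ℂ)] with x hx h0
  rw [coe_zero, h0]
  simpa [hw0 x] using hx

theorem exists_subseq_tendsto_ae {u : ℕ → X.Space} {f : X.Space}
    (h : ∀ ψ, Tendsto (fun n => X.xiSeminorm ψ (u n - f)) atTop (𝓝 0)) :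
    ∃ ns : ℕ → ℕ, StrictMono ns ∧ ∀ᵐ x ∂μ,
      Tendsto (fun i => (u (ns i) : R →ₘ[μ] ℂ) x) atTop (𝓝 ((f : R →ₘ[μ] ℂ) x)) := by
  obtain ⟨w, ψ, hw, hw0, hwψ⟩ := X.exists_weight
  refine exists_subseq_tendsto_ae_of_weight (u := fun n => (u n : R →ₘ[μ] ℂ))
    (f := (f : R →ₘ[μ] ℂ)) hw hw0 ?_
  have h1 := ENNReal.tendsto_ofReal (h ψ)
  rw [ENNReal.ofReal_zero] at h1
  refine tendsto_of_tendsto_of_tendsto_of_le_of_le tendsto_const_nhds h1 (fun _ => zero_le)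
    fun n => ?_
  rw [ofReal_xiSeminorm]
  exact hwψ _

/-- Norm bounded `ξ`-Cauchy sequences converge. -/
theorem exists_xi_limit {u : ℕ → X.Space} {C : ℝ≥0∞} (hC : C < ∞)
    (hu : ∀ n, X.enorm (u n : R →ₘ[μ] ℂ) ≤ C)
    (hcauchy : ∀ ψ, ∀ ε > 0, ∃ N, ∀ m ≥ N, ∀ n ≥ N, X.xiSeminorm ψ (u m - u n) ≤ ε) :
    ∃ g : X.Space, ∀ ψ, Tendsto (fun n => X.xiSeminorm ψ (u n - g)) atTop (𝓝 0) := by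
  obtain ⟨w, ψ₀, hw, hw0, hwψ⟩ := X.exists_weight
  obtain ⟨g, ns, hns, hlim⟩ := exists_limit_of_cauchy_weight hw hw0
    (u := fun n => (u n : R →ₘ[μ] ℂ))
    (fun n => ne_top_of_le_ne_top (X.rearrangementPairing_ne_top ψ₀ (u n)) (hwψ _))
    (fun ε hε => by
      obtain ⟨N, hN⟩ := hcauchy ψ₀ ε hε
      refine ⟨N, fun m hm n hn => (hwψ _).trans ?_⟩
      rw [← X.coe_sub, ← X.ofReal_xiSeminorm]
      exact ENNReal.ofReal_le_ofReal (hN m hm n hn))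
  -- The a.e. limit lies in `X` by the norm bound and Fatou; the `ξ`-Cauchy property alone is not
  -- used for this.
  have hg : X.enorm g < ∞ := by
    refine lt_of_le_of_lt (X.toFun_le_of_tendsto (fun n => measurable_enorm_coe _)
      (measurable_enorm_coe g) (fun n => hu (ns n)) ?_) hC
    filter_upwards [hlim] with x hx
    exact (continuous_enorm.tendsto _).comp hx
  refine ⟨⟨g, hg⟩, fun ψ => ?_⟩
  rw [Metric.tendsto_atTop]
  intro ε hε
  obtain ⟨N, hN⟩ := hcauchy ψ (ε / 2) (half_pos hε)
  refine ⟨N, fun n hn => ?_⟩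
  rw [Real.dist_0_eq_abs, abs_of_nonneg (apply_nonneg _ _)]
  suffices hs : X.xiSeminorm ψ (u n - ⟨g, hg⟩) ≤ ε / 2 by linarith
  rw [← ENNReal.ofReal_le_ofReal_iff (half_pos hε).le, ofReal_xiSeminorm,
    rearrangementPairing_comm]
  -- Resonance reduces the claim to integrals against a fixed `h` equimeasurable with `ψ`. There
  -- Fatou's lemma lets `i → ∞` in the Cauchy estimate, whose `N` does not depend on `h`.
  refine rearrangementPairing_le (measurable_enorm_coe _) (measurable_enorm_coe _)
    fun h hh e => ?_
  have hbound : ∀ i, N ≤ i → ∫⁻ x, ‖(u n - u (ns i) : R →ₘ[μ] ℂ) x‖ₑ * h x ∂μ ≤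
      ENNReal.ofReal (ε / 2) := fun i hi => by
    refine (lintegral_le_rearrangementPairing (measurable_enorm_coe _)
      (measurable_enorm_coe (ψ : R →ₘ[μ] ℂ)) hh e).trans ?_
    rw [rearrangementPairing_comm, ← X.coe_sub, ← X.ofReal_xiSeminorm]
    exact ENNReal.ofReal_le_ofReal (hN n hn _ (hi.trans (hns.id_le i)))
  have hae : ∀ᵐ x ∂μ, ∀ i, (u n - u (ns i) : R →ₘ[μ] ℂ) x =
      (u n : R →ₘ[μ] ℂ) x - (u (ns i) : R →ₘ[μ] ℂ) x :=
    ae_all_iff.2 fun i => AEEqFun.coeFn_sub _ _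
  have hle : (fun x => ‖((u n : R →ₘ[μ] ℂ) - g) x‖ₑ * h x) ≤ᵐ[μ]
      fun x => liminf (fun i => ‖(u n - u (ns i) : R →ₘ[μ] ℂ) x‖ₑ * h x) atTop := by
    filter_upwards [hlim, hae, AEEqFun.coeFn_sub (u n : R →ₘ[μ] ℂ) g] with x h1 h2 h3
    -- As `h x` may be `∞`, the product need not converge where the limit factor is `0`; the
    -- inequality is trivial there.
    by_cases hz : ‖((u n : R →ₘ[μ] ℂ) - g) x‖ₑ = 0
    · rw [hz, zero_mul]
      exact zero_le
    · have h4 : Tendsto (fun i => ‖(u n - u (ns i) : R →ₘ[μ] ℂ) x‖ₑ * h x) atTop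
          (𝓝 (‖((u n : R →ₘ[μ] ℂ) - g) x‖ₑ * h x)) := by
        refine ENNReal.Tendsto.mul_const ?_ (Or.inl hz)
        rw [h3, Pi.sub_apply]
        simp only [h2]
        exact (continuous_enorm.tendsto _).comp (tendsto_const_nhds.sub h1)
      exact h4.liminf_eq.ge
  calc ∫⁻ x, ‖((u n : R →ₘ[μ] ℂ) - g) x‖ₑ * h x ∂μ
      ≤ ∫⁻ x, liminf (fun i => ‖(u n - u (ns i) : R →ₘ[μ] ℂ) x‖ₑ * h x) atTop ∂μ :=
        lintegral_mono_ae hle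
    _ ≤ liminf (fun i => ∫⁻ x, ‖(u n - u (ns i) : R →ₘ[μ] ℂ) x‖ₑ * h x ∂μ) atTop :=
        lintegral_liminf_le fun i => (measurable_enorm_coe _).mul hh
    _ ≤ ENNReal.ofReal (ε / 2) := by
        refine liminf_le_of_frequently_le' (Eventually.frequently ?_)
        filter_upwards [eventually_ge_atTop N] with i hi using hbound i hi

end XiTopology

/-! ### Extending pairing bounded operators from `X ∩ L²` to `X` -/

section Extension

variable {R : Type*} [MeasurableSpace R] {μ : Measure R} [SigmaFinite μ] [IsResonant μ]
  {X : RIBanachFunctionNorm μ}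

variable (X) in
/-- The subspace `X ∩ L²` of `X`. -/
def interL2 : Submodule ℂ X.Space where
  carrier := {f | (f : R →ₘ[μ] ℂ) ∈ Lp ℂ 2 μ}
  add_mem' ha hb := (Lp ℂ 2 μ).add_mem ha hb
  zero_mem' := (Lp ℂ 2 μ).zero_mem
  smul_mem' c f hf := Lp.mem_Lp_iff_memLp.2 (by
    have h : MemLp (c • ⇑(f : R →ₘ[μ] ℂ)) 2 μ := (Lp.mem_Lp_iff_memLp.1 hf).const_smul c
    exact h.ae_eq (AEEqFun.coeFn_smul c (f : R →ₘ[μ] ℂ)).symm)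

theorem enorm_le_of_pairingBounded {A : ℝ≥0} {W : Lp ℂ 2 μ →ₗ[ℂ] Lp ℂ 2 μ}
    (hW : PairingBounded A W) (u : Lp ℂ 2 μ) (hu : X.enorm (u : R →ₘ[μ] ℂ) < ∞) :
    X.enorm (W u : R →ₘ[μ] ℂ) ≤ A * X.enorm (u : R →ₘ[μ] ℂ) := by
  refine enorm_le_of_rearrangementPairing_le hu fun ψ _ => ?_
  simp only [rearrangementPairing_comm μ fun x => ‖ψ x‖ₑ]
  exact hW u _ (measurable_enorm_coe ψ)

/-- The operator `W` on `X ∩ L²`. -/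
noncomputable def restrictToInterL2 {A : ℝ≥0} {W : Lp ℂ 2 μ →ₗ[ℂ] Lp ℂ 2 μ}
    (hW : PairingBounded A W) : X.interL2 →ₗ[ℂ] X.Space where
  toFun u := ⟨W ⟨u.1.1, u.2⟩, (enorm_le_of_pairingBounded hW ⟨u.1.1, u.2⟩ u.1.2).trans_lt
    (ENNReal.mul_lt_top ENNReal.coe_lt_top u.1.2)⟩
  map_add' u v := by
    have h := congrArg Subtype.val (map_add W (⟨u.1.1, u.2⟩ : Lp ℂ 2 μ) ⟨v.1.1, v.2⟩)
    exact Subtype.ext h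
  map_smul' c u := by
    have h := congrArg Subtype.val (map_smul W c (⟨u.1.1, u.2⟩ : Lp ℂ 2 μ))
    exact Subtype.ext h

/-- `S` is the extension to `X` of the operator `W` on `L²`. -/
structure IsExtension (A : ℝ≥0) (W : Lp ℂ 2 μ →ₗ[ℂ] Lp ℂ 2 μ) (S : X.Space →ₗ[ℂ] X.Space) :
    Prop where
  apply_eq : ∀ (f : X.Space) (u : Lp ℂ 2 μ), (f : R →ₘ[μ] ℂ) = u →
    (S f : R →ₘ[μ] ℂ) = (W u : R →ₘ[μ] ℂ)
  seminorm_le : ∀ ψ f, X.xiSeminorm ψ (S f) ≤ A * X.xiSeminorm ψ f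

/-- Every element of `X` is the `ξ`-limit of its middle parts. -/
theorem exists_seq_interL2 (hX : X.HasACR) (f : X.Space) :
    ∃ u : ℕ → X.interL2, (∀ n, X.enorm ((u n : X.Space) : R →ₘ[μ] ℂ) ≤ X.enorm (f : R →ₘ[μ] ℂ)) ∧
      (∀ n, ((u n : X.Space) : R →ₘ[μ] ℂ) = middlePart (f : R →ₘ[μ] ℂ) n) ∧
      ∀ ψ, Tendsto (fun n => X.xiSeminorm ψ ((u n : X.Space) - f)) atTop (𝓝 0) := by
  have hle : ∀ n, X.enorm (middlePart (f : R →ₘ[μ] ℂ) n) ≤ X.enorm (f : R →ₘ[μ] ℂ) := fun n =>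
    X.enorm_mono (enorm_middlePart_le _ n)
  refine ⟨fun n => ⟨⟨middlePart (f : R →ₘ[μ] ℂ) n, (hle n).trans_lt f.2⟩,
    middlePart_mem_Lp (hX f) n⟩, hle, fun n => rfl, fun ψ => ?_⟩
  have h1 := tendsto_rearrangementPairing_compl_middleSet (measurable_enorm_coe (f : R →ₘ[μ] ℂ))
    (ae_of_all _ fun x => enorm_lt_top) (hX f)
    (g := fun x => ‖(ψ : R →ₘ[μ] ℂ) x‖ₑ)
    (by rw [rearrangementPairing_comm]; exact X.rearrangementPairing_ne_top ψ f)
  have h2 := (ENNReal.tendsto_toReal ENNReal.zero_ne_top).comp h1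
  rw [ENNReal.toReal_zero] at h2
  refine h2.congr fun n => ?_
  rw [map_sub_rev, xiSeminorm_apply, rearrangementPairing_comm, coe_sub]
  exact congrArg ENNReal.toReal
    (rearrangementPairing_congr (enorm_sub_middlePart _ n).symm (ae_eq_refl _))

/-- The middle parts of `f` are `ξ`-Cauchy with norms at most `‖f‖_X`. The pairing estimate makes
their images `ξ`-Cauchy with norms at most `A ‖f‖_X`, so `exists_xi_limit` supplies the value at
`f`. -/
theorem exists_isExtension (hX : X.HasACR) {A : ℝ≥0} {W : Lp ℂ 2 μ →ₗ[ℂ] Lp ℂ 2 μ}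
    (hW : PairingBounded A W) : ∃ S : X.Space →ₗ[ℂ] X.Space, IsExtension A W S := by
  have hbound : ∀ ψ (u : X.interL2), X.xiSeminorm ψ (restrictToInterL2 hW u) ≤
      A * X.xiSeminorm ψ (u : X.Space) := fun ψ u => by
    rw [← ENNReal.ofReal_le_ofReal_iff (mul_nonneg A.coe_nonneg (apply_nonneg _ _)),
      ENNReal.ofReal_mul A.coe_nonneg, ofReal_xiSeminorm, ofReal_xiSeminorm,
      ENNReal.ofReal_coe_nnreal]
    simp only [rearrangementPairing_comm μ fun x => ‖(ψ : R →ₘ[μ] ℂ) x‖ₑ]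
    exact hW ⟨u.1.1, u.2⟩ _ (measurable_enorm_coe _)
  obtain ⟨S, hS, hSb⟩ := exists_linearMap_extension (p := X.xiSeminorm)
    (fun f hf => eq_zero_of_xiSeminorm_eq_zero hf) hbound fun f => by
      obtain ⟨u, hu, -, hlim⟩ := exists_seq_interL2 hX f
      refine ⟨u, hlim, exists_xi_limit (C := A * X.enorm (f : R →ₘ[μ] ℂ))
        (ENNReal.mul_lt_top ENNReal.coe_lt_top f.2) (fun n => ?_) fun ψ ε hε => ?_⟩
      · exact (enorm_le_of_pairingBounded hW ⟨(u n).1.1, (u n).2⟩ (u n).1.2).trans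
          (mul_le_mul_right (hu n) _)
      · obtain ⟨N, hN⟩ := Metric.tendsto_atTop.1 (hlim ψ) (ε / (2 * (A + 1))) (by positivity)
        refine ⟨N, fun m hm n hn => ?_⟩
        have h1 := hN m hm
        have h2 := hN n hn
        rw [Real.dist_0_eq_abs, abs_of_nonneg (apply_nonneg _ _)] at h1 h2
        rw [← map_sub]
        refine (hbound ψ _).trans ?_
        have h3 : X.xiSeminorm ψ ((u m - u n : X.interL2) : X.Space) ≤
            X.xiSeminorm ψ ((u m : X.Space) - f) + X.xiSeminorm ψ ((u n : X.Space) - f) := by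
          have : ((u m - u n : X.interL2) : X.Space) =
              ((u m : X.Space) - f) - ((u n : X.Space) - f) := by
            rw [Submodule.coe_sub]
            abel
          rw [this]
          exact map_sub_le_add _ _ _
        calc (A : ℝ) * X.xiSeminorm ψ ((u m - u n : X.interL2) : X.Space)
            ≤ (A + 1) * (ε / (2 * (A + 1)) + ε / (2 * (A + 1))) := by
              gcongr
              · linarith
              · linarith
          _ = ε := by field_simp; ring
  refine ⟨S, ⟨fun f u hfu => ?_, hSb⟩⟩
  have hmem : f ∈ X.interL2 := by
    show (f : R →ₘ[μ] ℂ) ∈ Lp ℂ 2 μ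
    rw [hfu]
    exact u.2
  have h1 := hS ⟨f, hmem⟩
  have h2 : (⟨(f : R →ₘ[μ] ℂ), hmem⟩ : Lp ℂ 2 μ) = u := Subtype.ext hfu
  rw [← h2]
  exact congrArg Subtype.val h1

end Extension

end RIBanachFunctionNorm

/-! ### From `L²` convergence to `ξ` convergence -/

section L2Limits

variable {R : Type*} [MeasurableSpace R] {μ : Measure R}

theorem lintegral_enorm_rpow_two (g : Lp ℂ 2 μ) :
    (∫⁻ x, ‖g x‖ₑ ^ (2 : ℝ) ∂μ) ^ (1 / 2 : ℝ) = ‖g‖ₑ := by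
  rw [Lp.enorm_def, eLpNorm_eq_lintegral_rpow_enorm_toReal (by simp) (by simp)]
  simp

variable [IsResonant μ]

/-- `L²`-null sequences that are dominated in the sense of the pairing are `ξ`-null. -/
theorem tendsto_rearrangementPairing_of_tendsto_L2 {ψ : R → ℝ≥0∞} (hψ : Measurable ψ)
    (hfin : ∀ᵐ x ∂μ, ψ x < ∞) (h0 : Tendsto (rearrangement μ ψ) atTop (𝓝 0)) {u : R → ℝ≥0∞}
    (hu : rearrangementPairing μ ψ u ≠ ∞) {g : ℕ → Lp ℂ 2 μ} (hg : Tendsto g atTop (𝓝 0))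
    {B : ℝ≥0} (hB : ∀ n h, Measurable h → rearrangementPairing μ (fun x => ‖g n x‖ₑ) h ≤
      B * rearrangementPairing μ h u) :
    Tendsto (fun n => rearrangementPairing μ (fun x => ‖g n x‖ₑ) ψ) atTop (𝓝 0) := by
  rw [ENNReal.tendsto_nhds_zero]
  intro ε hε
  have hε2 : (0 : ℝ≥0∞) < ε / 2 := ENNReal.half_pos hε.ne'
  have h1 := ENNReal.Tendsto.const_mul
    (tendsto_rearrangementPairing_compl_middleSet hψ hfin h0 hu)
    (Or.inr (ENNReal.coe_ne_top (r := B)))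
  rw [mul_zero] at h1
  -- `ψ` is split at level `k`. Outside the middle set domination by `u` gives a bound uniform in
  -- `n`. The middle part `m` is bounded with support of finite measure, so Cauchy–Schwarz and `g n
  -- → 0` in `L²` apply.
  obtain ⟨k, hk⟩ := (h1.eventually (ge_mem_nhds hε2)).exists
  have hE := measurableSet_middleSet hψ k
  set m := (middleSet ψ k).indicator ψ
  have hm : Measurable m := hψ.indicator hE
  have hmc : ∀ᵐ x ∂μ, m x ≤ (k + 1 : ℝ≥0) := ae_of_all _ fun x => by
    by_cases hx : x ∈ middleSet ψ k
    · simp only [m, Set.indicator_of_mem hx]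
      exact hx.2
    · simp [m, Set.indicator_of_notMem hx]
  have hmfin : μ {x | 0 < m x} ^ (1 / 2 : ℝ) ≠ ∞ := by
    refine (ENNReal.rpow_lt_top_of_nonneg (by norm_num) (ne_top_of_le_ne_top
      (RIBanachFunctionNorm.measure_middleSet_lt_top h0 k).ne (measure_mono fun x hx => ?_))).ne
    by_contra hx'
    have hx0 : 0 < m x := hx
    simp [m, Set.indicator_of_notMem hx'] at hx0
  have h2 : Tendsto (fun n => ((k + 1 : ℝ≥0) : ℝ≥0∞) *
      (‖g n‖ₑ * μ {x | 0 < m x} ^ (1 / 2 : ℝ))) atTop (𝓝 0) := by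
    have h3 := (continuous_enorm.tendsto (0 : Lp ℂ 2 μ)).comp hg
    rw [_root_.enorm_zero] at h3
    have h4 := ENNReal.Tendsto.const_mul (ENNReal.Tendsto.mul_const h3 (Or.inr hmfin))
      (Or.inr (ENNReal.coe_ne_top (r := (k + 1 : ℝ≥0))))
    simpa using h4
  filter_upwards [h2.eventually (ge_mem_nhds hε2)] with n hn
  have hsplit : ψ = fun x => m x + (middleSet ψ k)ᶜ.indicator ψ x :=
    (Set.indicator_self_add_compl (middleSet ψ k) ψ).symm
  calc rearrangementPairing μ (fun x => ‖g n x‖ₑ) ψ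
      = rearrangementPairing μ (fun x => ‖g n x‖ₑ)
          (fun x => m x + (middleSet ψ k)ᶜ.indicator ψ x) :=
        congrArg (rearrangementPairing μ _) hsplit
    _ ≤ rearrangementPairing μ (fun x => ‖g n x‖ₑ) m +
          rearrangementPairing μ (fun x => ‖g n x‖ₑ) ((middleSet ψ k)ᶜ.indicator ψ) :=
        rearrangementPairing_add_right_le (measurable_enorm_Lp _) hm (hψ.indicator hE.compl)
    _ ≤ ε / 2 + ε / 2 := by
        refine add_le_add (le_trans ?_ hn) ((hB n _ (hψ.indicator hE.compl)).trans hk)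
        rw [← lintegral_enorm_rpow_two]
        exact rearrangementPairing_le_eLpNorm_two (measurable_enorm_Lp _) hm hmc
    _ = ε := ENNReal.add_halves ε

end L2Limits

/-! ### Continuity, mean ergodicity and projections for the extensions -/

namespace RIBanachFunctionNorm

section ExtensionProperties

variable {R : Type*} [MeasurableSpace R] {μ : Measure R} [SigmaFinite μ] [IsResonant μ]
  {X : RIBanachFunctionNorm μ} {A : ℝ≥0}

theorem IsExtension.pow_apply_eq {W : Lp ℂ 2 μ →ₗ[ℂ] Lp ℂ 2 μ} {S : X.Space →ₗ[ℂ] X.Space}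
    (hS : IsExtension A W S) {f : X.Space} {u : Lp ℂ 2 μ}
    (hfu : (f : R →ₘ[μ] ℂ) = (u : R →ₘ[μ] ℂ)) (n : ℕ) :
    ((S ^ n) f : R →ₘ[μ] ℂ) = ((W ^ n) u : R →ₘ[μ] ℂ) := by
  induction n with
  | zero => exact hfu
  | succ n ih =>
    rw [pow_succ', pow_succ', Module.End.mul_apply, Module.End.mul_apply]
    exact hS.apply_eq _ _ ih

theorem IsExtension.cesaroMean_apply_eq {W : Lp ℂ 2 μ →ₗ[ℂ] Lp ℂ 2 μ}
    {S : X.Space →ₗ[ℂ] X.Space} (hS : IsExtension A W S) {f : X.Space} {u : Lp ℂ 2 μ}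
    (hfu : (f : R →ₘ[μ] ℂ) = (u : R →ₘ[μ] ℂ)) (n : ℕ) :
    ((cesaroMean S n f : X.Space) : R →ₘ[μ] ℂ) = (cesaroMap W n u : R →ₘ[μ] ℂ) := by
  have hsum : ∀ s : Finset ℕ, ((∑ i ∈ s, (S ^ i) f : X.Space) : R →ₘ[μ] ℂ) =
      ((∑ i ∈ s, (W ^ i) u : Lp ℂ 2 μ) : R →ₘ[μ] ℂ) := fun s => by
    induction s using Finset.induction_on with
    | empty => simp only [Finset.sum_empty]; rfl
    | insert a s ha ih =>
      rw [Finset.sum_insert ha, Finset.sum_insert ha, coe_add, ih, hS.pow_apply_eq hfu]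
      rfl
  rw [cesaroMap_apply, cesaroMean, cesaroMean, coe_smul, hsum]
  rfl

/-- Iterating the bound for `S` gives only `A ^ n`. The uniform constant holds on `X ∩ L²`, where `S
^ n` is `W ^ n`, and extends by density; the crude bound serves only as continuity of `S ^ n` for
fixed `n`. -/
theorem IsExtension.xiSeminorm_pow_le (hX : X.HasACR) {W : Lp ℂ 2 μ →ₗ[ℂ] Lp ℂ 2 μ}
    {S : X.Space →ₗ[ℂ] X.Space} (hS : IsExtension A W S) (hW : ∀ n, PairingBounded A (W ^ n))
    (ψ : X.associate.Space) (n : ℕ) (f : X.Space) :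
    X.xiSeminorm ψ ((S ^ n) f) ≤ A * X.xiSeminorm ψ f := by
  have hn : ∀ n g, X.xiSeminorm ψ ((S ^ n) g) ≤ A ^ n * X.xiSeminorm ψ g := fun n => by
    induction n with
    | zero => intro g; simp
    | succ n ih =>
      intro g
      rw [pow_succ, Module.End.mul_apply]
      refine (ih _).trans ?_
      rw [pow_succ, mul_assoc]
      gcongr
      exact hS.seminorm_le ψ g
  obtain ⟨u, -, -, hlim⟩ := exists_seq_interL2 hX f
  refine (X.xiSeminorm ψ).le_mul_of_tendsto (u := fun k => (u k : X.Space))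
    (v := fun k => (S ^ n) (u k : X.Space)) (fun k => ?_) (hlim ψ) ?_
  · rw [← ENNReal.ofReal_le_ofReal_iff (mul_nonneg A.coe_nonneg (apply_nonneg _ _)),
      ENNReal.ofReal_mul A.coe_nonneg, ofReal_xiSeminorm, ofReal_xiSeminorm,
      ENNReal.ofReal_coe_nnreal]
    simp only [rearrangementPairing_comm μ fun x => ‖(ψ : R →ₘ[μ] ℂ) x‖ₑ]
    rw [hS.pow_apply_eq (f := (u k : X.Space)) (u := ⟨(u k).1.1, (u k).2⟩) rfl n]
    exact hW n _ _ (measurable_enorm_coe _)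
  · refine squeeze_zero (fun _ => apply_nonneg _ _) (fun k => ?_)
      (by simpa using (hlim ψ).const_mul ((A : ℝ) ^ n))
    rw [← map_sub]
    exact hn n _

theorem IsExtension.enorm_le {W : Lp ℂ 2 μ →ₗ[ℂ] Lp ℂ 2 μ} {S : X.Space →ₗ[ℂ] X.Space}
    (hS : IsExtension A W S) (f : X.Space) :
    X.enorm (S f : R →ₘ[μ] ℂ) ≤ A * X.enorm (f : R →ₘ[μ] ℂ) := by
  refine enorm_le_of_rearrangementPairing_le f.2 fun ψ hψ => ?_
  let ψ' : X.associate.Space := ⟨ψ, hψ⟩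
  have h := ENNReal.ofReal_le_ofReal (hS.seminorm_le ψ' f)
  rwa [ENNReal.ofReal_mul A.coe_nonneg, ofReal_xiSeminorm, ofReal_xiSeminorm,
      ENNReal.ofReal_coe_nnreal] at h

theorem IsExtension.continuous_norm {W : Lp ℂ 2 μ →ₗ[ℂ] Lp ℂ 2 μ} {S : X.Space →ₗ[ℂ] X.Space}
    (hS : IsExtension A W S) : Continuous[X.normTopology, X.normTopology] S := by
  let _ : SeminormedAddCommGroup X.Space := X.normSeminorm.toSeminormedAddCommGroup
  refine AddMonoidHomClass.continuous_of_bound S A fun f => ?_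
  show (X.enorm (S f : R →ₘ[μ] ℂ)).toReal ≤ A * (X.enorm (f : R →ₘ[μ] ℂ)).toReal
  rw [← ENNReal.coe_toReal, ← ENNReal.toReal_mul]
  exact ENNReal.toReal_mono (ENNReal.mul_lt_top ENNReal.coe_lt_top f.2).ne (hS.enorm_le f)

theorem withSeminorms_xi (X : RIBanachFunctionNorm μ) :
    @WithSeminorms ℂ X.Space X.associate.Space _ _ _ X.xiSeminorm X.xi :=
  let _ : TopologicalSpace X.Space := X.xi
  ⟨rfl⟩

theorem IsExtension.continuous_xi {W : Lp ℂ 2 μ →ₗ[ℂ] Lp ℂ 2 μ} {S : X.Space →ₗ[ℂ] X.Space}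
    (hS : IsExtension A W S) : Continuous[X.xi, X.xi] S := by
  let _ : TopologicalSpace X.Space := X.xi
  refine WithSeminorms.continuous_of_isBounded X.withSeminorms_xi X.withSeminorms_xi S ?_
  intro ψ
  refine ⟨{ψ}, A, fun f => ?_⟩
  rw [Finset.sup_singleton]
  exact hS.seminorm_le ψ f

theorem tendsto_xi_iff {u : ℕ → X.Space} {f : X.Space} :
    Tendsto u atTop (@nhds X.Space X.xi f) ↔
      ∀ ψ, Tendsto (fun n => X.xiSeminorm ψ (u n - f)) atTop (𝓝 0) := by
  let _ : TopologicalSpace X.Space := X.xi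
  rw [X.withSeminorms_xi.tendsto_nhds]
  refine forall_congr' fun ψ => ?_
  rw [Metric.tendsto_nhds]
  simp only [Real.dist_0_eq_abs, abs_of_nonneg (apply_nonneg (X.xiSeminorm ψ) _)]

/-- The means of an extension converge to the extension of the limit. -/
theorem IsExtension.tendsto_cesaroMean (hX : X.HasACR) (hX' : X.associate.HasACR)
    {W Q : Lp ℂ 2 μ →ₗ[ℂ] Lp ℂ 2 μ} {S T : X.Space →ₗ[ℂ] X.Space} (hS : IsExtension A W S)
    (hT : IsExtension A Q T) (hW : ∀ n, PairingBounded A (W ^ n)) (hQ : PairingBounded A Q)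
    (hlim : ∀ u, Tendsto (fun n => cesaroMap W n u) atTop (𝓝 (Q u))) (ψ : X.associate.Space)
    (f : X.Space) : Tendsto (fun n => X.xiSeminorm ψ (cesaroMean S n f - T f)) atTop (𝓝 0) := by
  refine (X.xiSeminorm ψ).tendsto_cesaroMean_of_dense (A := A)
    (fun n f => hS.xiSeminorm_pow_le hX hW ψ n f) (fun f => hT.seminorm_le ψ f) f fun ε hε => ?_
  obtain ⟨u, -, -, hu⟩ := exists_seq_interL2 hX f
  obtain ⟨N, hN⟩ := Metric.tendsto_atTop.1 (hu ψ) ε hε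
  refine ⟨u N, ?_, ?_⟩
  · have := hN N le_rfl
    rwa [Real.dist_0_eq_abs, abs_of_nonneg (apply_nonneg _ _), map_sub_rev] at this
  set v : Lp ℂ 2 μ := ⟨(u N).1.1, (u N).2⟩
  have hvA : ∀ (P : Lp ℂ 2 μ →ₗ[ℂ] Lp ℂ 2 μ), PairingBounded A P → ∀ h, Measurable h →
      rearrangementPairing μ h (fun x => ‖P v x‖ₑ) ≤
        A * rearrangementPairing μ h (fun x => ‖v x‖ₑ) := fun P hP h hh => by
    simp only [rearrangementPairing_comm μ h]
    exact hP v h hh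
  have hg : Tendsto (fun n => cesaroMap W n v - Q v) atTop (𝓝 0) := by
    simpa using (hlim v).sub_const (Q v)
  -- The mean and the limit contribute one `A` each.
  have h1 := tendsto_rearrangementPairing_of_tendsto_L2 (B := A + A)
    (u := fun x => ‖v x‖ₑ)
    (measurable_enorm_coe (ψ : R →ₘ[μ] ℂ)) (ae_of_all _ fun x => enorm_lt_top) (hX' ψ)
    (X.rearrangementPairing_ne_top ψ (u N)) hg (fun n h hh => by
      rw [rearrangementPairing_comm]
      refine (rearrangementPairing_mono (ae_eq_refl h).le
        (g' := fun x => ‖cesaroMap W n v x‖ₑ + ‖Q v x‖ₑ) ?_).trans ?_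
      · filter_upwards [Lp.coeFn_sub (cesaroMap W n v) (Q v)] with x hx
        rw [hx, Pi.sub_apply]
        exact enorm_sub_le
      · refine (rearrangementPairing_add_right_le hh (measurable_enorm_Lp _)
          (measurable_enorm_Lp _)).trans ?_
        rw [ENNReal.coe_add, add_mul]
        exact add_le_add (hvA _ (PairingBounded.cesaroMap hW n) h hh) (hvA _ hQ h hh))
  have h2 := (ENNReal.tendsto_toReal ENNReal.zero_ne_top).comp h1
  rw [ENNReal.toReal_zero] at h2
  refine h2.congr fun n => ?_
  rw [xiSeminorm_apply, rearrangementPairing_comm, coe_sub,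
    hS.cesaroMean_apply_eq (f := (u N : X.Space)) (u := v) rfl n,
    hT.apply_eq (u N : X.Space) v rfl]
  rfl

theorem IsExtension.isMeanErgodicWithLimit (hX : X.HasACR) (hX' : X.associate.HasACR)
    {W Q : Lp ℂ 2 μ →ₗ[ℂ] Lp ℂ 2 μ} {S T : X.Space →ₗ[ℂ] X.Space} (hS : IsExtension A W S)
    (hT : IsExtension A Q T) (hW : ∀ n, PairingBounded A (W ^ n)) (hQ : PairingBounded A Q)
    (hlim : ∀ u, Tendsto (fun n => cesaroMap W n u) atTop (𝓝 (Q u))) :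
    IsMeanErgodicWithLimit X.xi S T :=
  ⟨hS.continuous_xi, hT.continuous_xi, fun f => tendsto_xi_iff.2 fun ψ =>
    hS.tendsto_cesaroMean hX hX' hT hW hQ hlim ψ f⟩

theorem IsExtension.isProj (hX : X.HasACR) (hX' : X.associate.HasACR)
    {W Q : Lp ℂ 2 μ →ₗ[ℂ] Lp ℂ 2 μ} {S T : X.Space →ₗ[ℂ] X.Space} (hS : IsExtension A W S)
    (hT : IsExtension A Q T) (hW : ∀ n, PairingBounded A (W ^ n)) (hQ : PairingBounded A Q)
    (hlim : ∀ u, Tendsto (fun n => cesaroMap W n u) atTop (𝓝 (Q u))) :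
    LinearMap.IsProj (LinearMap.ker (LinearMap.id - S)) T ∧
      LinearMap.IsProj (X.xiClosure (LinearMap.range (LinearMap.id - S))) (LinearMap.id - T) ∧
      IsCompl (LinearMap.ker (LinearMap.id - S))
        (X.xiClosure (LinearMap.range (LinearMap.id - S))) := by
  obtain ⟨hSc, hTc, hm⟩ := hS.isMeanErgodicWithLimit hX hX' hT hW hQ hlim
  let _ : TopologicalSpace X.Space := X.xi
  have : IsTopologicalAddGroup X.Space :=
    X.xiSeminorm.moduleFilterBasis.toAddGroupFilterBasis.isTopologicalAddGroup
  have : ContinuousSMul ℂ X.Space := X.xiSeminorm.moduleFilterBasis.continuousSMul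
  have : T1Space X.Space := X.withSeminorms_xi.T1_of_separating fun f hf => by
    by_contra hcon
    push Not at hcon
    exact hf (eq_zero_of_xiSeminorm_eq_zero hcon)
  refine isProj_of_tendsto_cesaroMean hSc hTc hm fun f => tendsto_xi_iff.2 fun ψ => ?_
  simp only [sub_zero]
  exact (X.xiSeminorm ψ).tendsto_cesaroMean_sub fun n => hS.xiSeminorm_pow_le hX hW ψ n f

end ExtensionProperties

end RIBanachFunctionNorm

/-! ### Associate operators and weak continuity -/

namespace RIBanachFunctionNorm

section Duality

variable {R : Type*} [MeasurableSpace R] {μ : Measure R} [SigmaFinite μ] [IsResonant μ]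
  {X : RIBanachFunctionNorm μ} {A : ℝ≥0}

theorem lintegral_enorm_mul_le (f : X.Space) (ψ : X.associate.Space) :
    ∫⁻ x, ‖(f : R →ₘ[μ] ℂ) x * (ψ : R →ₘ[μ] ℂ) x‖ₑ ∂μ ≤ ENNReal.ofReal (X.xiSeminorm ψ f) := by
  rw [ofReal_xiSeminorm, rearrangementPairing_comm]
  simp only [enorm_mul]
  exact lintegral_mul_le_rearrangementPairing (measurable_enorm_coe (f : R →ₘ[μ] ℂ))
    (measurable_enorm_coe (ψ : R →ₘ[μ] ℂ))

theorem integrable_mul (f : X.Space) (ψ : X.associate.Space) :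
    Integrable (fun x => (f : R →ₘ[μ] ℂ) x * (ψ : R →ₘ[μ] ℂ) x) μ :=
  ⟨(f : R →ₘ[μ] ℂ).aestronglyMeasurable.mul (ψ : R →ₘ[μ] ℂ).aestronglyMeasurable,
    (lintegral_enorm_mul_le f ψ).trans_lt ENNReal.ofReal_lt_top⟩

theorem norm_integral_mul_le (f : X.Space) (ψ : X.associate.Space) :
    ‖∫ x, (f : R →ₘ[μ] ℂ) x * (ψ : R →ₘ[μ] ℂ) x ∂μ‖ ≤ X.xiSeminorm ψ f := by
  rw [← ENNReal.ofReal_le_ofReal_iff (apply_nonneg _ _), ofReal_norm]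
  exact (enorm_integral_le_lintegral_enorm _).trans (lintegral_enorm_mul_le f ψ)

theorem integral_sub_mul (f g : X.Space) (ψ : X.associate.Space) :
    ∫ x, ((f - g : X.Space) : R →ₘ[μ] ℂ) x * (ψ : R →ₘ[μ] ℂ) x ∂μ =
      ∫ x, (f : R →ₘ[μ] ℂ) x * (ψ : R →ₘ[μ] ℂ) x ∂μ -
        ∫ x, (g : R →ₘ[μ] ℂ) x * (ψ : R →ₘ[μ] ℂ) x ∂μ := by
  rw [← integral_sub (integrable_mul f ψ) (integrable_mul g ψ)]
  refine integral_congr_ae ?_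
  filter_upwards [AEEqFun.coeFn_sub (f : R →ₘ[μ] ℂ) (g : R →ₘ[μ] ℂ)] with x hx
  rw [coe_sub, hx, Pi.sub_apply, sub_mul]

theorem tendsto_integral_mul_left {u : ℕ → X.Space} {f : X.Space} (ψ : X.associate.Space)
    (h : Tendsto (fun n => X.xiSeminorm ψ (u n - f)) atTop (𝓝 0)) :
    Tendsto (fun n => ∫ x, (u n : R →ₘ[μ] ℂ) x * (ψ : R →ₘ[μ] ℂ) x ∂μ) atTop
      (𝓝 (∫ x, (f : R →ₘ[μ] ℂ) x * (ψ : R →ₘ[μ] ℂ) x ∂μ)) := by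
  rw [tendsto_iff_norm_sub_tendsto_zero]
  refine squeeze_zero (fun _ => norm_nonneg _) (fun n => ?_) h
  rw [← integral_sub_mul]
  exact norm_integral_mul_le _ _

theorem enorm_associate_associate (f : R →ₘ[μ] ℂ) :
    X.associate.associate.enorm f = X.enorm f :=
  X.associate_associate_toFun (measurable_enorm_coe f)

variable (X) in
/-- The canonical map from `X` to `X''`. -/
def toBidual (f : X.Space) : X.associate.associate.Space :=
  ⟨f.1, lt_of_eq_of_lt (enorm_associate_associate _) f.2⟩

variable (X) in
/-- The canonical map from `X''` to `X`. -/
def ofBidual (f : X.associate.associate.Space) : X.Space :=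
  ⟨f.1, lt_of_eq_of_lt (enorm_associate_associate _).symm f.2⟩

theorem hasACR_associate_associate (hX : X.HasACR) : X.associate.associate.HasACR :=
  fun f => hX (X.ofBidual f)

theorem tendsto_integral_mul_right {v : ℕ → X.associate.Space} {ψ : X.associate.Space}
    (f : X.Space)
    (h : Tendsto (fun n => X.associate.xiSeminorm (X.toBidual f) (v n - ψ)) atTop (𝓝 0)) :
    Tendsto (fun n => ∫ x, (f : R →ₘ[μ] ℂ) x * (v n : R →ₘ[μ] ℂ) x ∂μ) atTop
      (𝓝 (∫ x, (f : R →ₘ[μ] ℂ) x * (ψ : R →ₘ[μ] ℂ) x ∂μ)) := by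
  have h1 := tendsto_integral_mul_left (X.toBidual f) h
  simp only [mul_comm ((f : R →ₘ[μ] ℂ) _)]
  exact h1

theorem IsExtension.tendsto_apply {W : Lp ℂ 2 μ →ₗ[ℂ] Lp ℂ 2 μ} {S : X.Space →ₗ[ℂ] X.Space}
    (hS : IsExtension A W S) {u : ℕ → X.Space} {f : X.Space} (ψ : X.associate.Space)
    (h : Tendsto (fun n => X.xiSeminorm ψ (u n - f)) atTop (𝓝 0)) :
    Tendsto (fun n => X.xiSeminorm ψ (S (u n) - S f)) atTop (𝓝 0) := by
  refine squeeze_zero (fun _ => apply_nonneg _ _) (fun n => ?_)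
    (by simpa using h.const_mul (A : ℝ))
  rw [← map_sub]
  exact hS.seminorm_le ψ _

/-- On `X ∩ L²` and `X' ∩ L²` this is the transposition in `L²`. Both sides are sequentially
`ξ`-continuous in each variable, so the identity extends first in `f` and then in `ψ`, with `f`
regarded as an element of `X''`. -/
theorem IsExtension.isAssociateOperator (hX : X.HasACR) (hX' : X.associate.HasACR)
    {W W' : Lp ℂ 2 μ →ₗ[ℂ] Lp ℂ 2 μ} {S : X.Space →ₗ[ℂ] X.Space}
    {S' : X.associate.Space →ₗ[ℂ] X.associate.Space} (hS : IsExtension A W S)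
    (hS' : IsExtension A W' S') (hW : AreTransposed W W') : X.IsAssociateOperator S S' := by
  intro f ψ
  obtain ⟨u, -, -, hu⟩ := exists_seq_interL2 hX f
  obtain ⟨v, -, -, hv⟩ := exists_seq_interL2 hX' ψ
  have h1 : ∀ k n, ∫ x, (S (u k) : R →ₘ[μ] ℂ) x * ((v n : X.associate.Space) : R →ₘ[μ] ℂ) x ∂μ =
      ∫ x, ((u k : X.Space) : R →ₘ[μ] ℂ) x * (S' (v n) : R →ₘ[μ] ℂ) x ∂μ := fun k n => by
    rw [hS.apply_eq (u k : X.Space) ⟨(u k).1.1, (u k).2⟩ rfl,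
      hS'.apply_eq (v n : X.associate.Space) ⟨(v n).1.1, (v n).2⟩ rfl]
    exact hW ⟨(u k).1.1, (u k).2⟩ ⟨(v n).1.1, (v n).2⟩
  have h2 : ∀ n, ∫ x, (S f : R →ₘ[μ] ℂ) x * ((v n : X.associate.Space) : R →ₘ[μ] ℂ) x ∂μ =
      ∫ x, (f : R →ₘ[μ] ℂ) x * (S' (v n) : R →ₘ[μ] ℂ) x ∂μ := fun n => by
    refine tendsto_nhds_unique
      (tendsto_integral_mul_left (v n : X.associate.Space) (hS.tendsto_apply _ (hu _))) ?_
    simp only [h1]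
    exact tendsto_integral_mul_left (S' (v n)) (hu _)
  refine tendsto_nhds_unique (tendsto_integral_mul_right (S f) (hv _)) ?_
  simp only [h2]
  exact tendsto_integral_mul_right f (hS'.tendsto_apply _ (hv _))

theorem continuous_weakPrime_of_forall_exists {S : X.Space →ₗ[ℂ] X.Space}
    (h : ∀ ψ : X.associate.Space, ∃ η : X.associate.Space, ∀ f : X.Space,
      ∫ x, (ψ : R →ₘ[μ] ℂ) x * (S f : R →ₘ[μ] ℂ) x ∂μ =
        ∫ x, (η : R →ₘ[μ] ℂ) x * (f : R →ₘ[μ] ℂ) x ∂μ) :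
    Continuous[X.weakPrime, X.weakPrime] S := by
  refine continuous_iInf_rng.2 fun ψ => continuous_induced_rng.2 ?_
  obtain ⟨η, hη⟩ := h ψ
  have e : (fun f : X.Space => ∫ x, (ψ : R →ₘ[μ] ℂ) x * (f : R →ₘ[μ] ℂ) x ∂μ) ∘ S =
      fun f : X.Space => ∫ x, (η : R →ₘ[μ] ℂ) x * (f : R →ₘ[μ] ℂ) x ∂μ := funext hη
  rw [e]
  exact continuous_iInf_dom (i := η) continuous_induced_dom

theorem IsAssociateOperator.continuous_weakPrime {S : X.Space →ₗ[ℂ] X.Space}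
    {S' : X.associate.Space →ₗ[ℂ] X.associate.Space} (h : X.IsAssociateOperator S S') :
    Continuous[X.weakPrime, X.weakPrime] S :=
  continuous_weakPrime_of_forall_exists fun ψ => ⟨S' ψ, fun f => by
    simpa only [mul_comm] using h f ψ⟩

/-- Because `X'' = X`, each functional defining `w'` on `X'` is given by an element of `X`, to which
`S` applies. -/
theorem IsAssociateOperator.continuous_weakPrime_associate {S : X.Space →ₗ[ℂ] X.Space}
    {S' : X.associate.Space →ₗ[ℂ] X.associate.Space} (h : X.IsAssociateOperator S S') :
    Continuous[X.associate.weakPrime, X.associate.weakPrime] S' :=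
  continuous_weakPrime_of_forall_exists fun χ =>
    ⟨X.toBidual (S (X.ofBidual χ)), fun ψ => (h (X.ofBidual χ) ψ).symm⟩

end Duality

/-! ### Identification with `f ∘ φ`, and positivity -/

section Composition

variable {R : Type*} [MeasurableSpace R] {μ : Measure R} [SigmaFinite μ] [IsResonant μ]
  {X : RIBanachFunctionNorm μ} {A : ℝ≥0}

/-- The extension to `X` of the composition operator on `L²` is the composition operator. -/
theorem IsExtension.isCompositionOperator (hX : X.HasACR) {W : Lp ℂ 2 μ →ₗ[ℂ] Lp ℂ 2 μ}
    {S : X.Space →ₗ[ℂ] X.Space} (hS : IsExtension A W S) {φ : R → R}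
    (hφ : Measure.QuasiMeasurePreserving φ μ μ)
    (hW : ∀ u : Lp ℂ 2 μ, (W u : R →ₘ[μ] ℂ) = (u : R →ₘ[μ] ℂ).compQuasiMeasurePreserving φ hφ) :
    IsCompositionOperator X hφ S := by
  intro f
  obtain ⟨u, -, hmid, hu⟩ := exists_seq_interL2 hX f
  obtain ⟨ns, hns, h1⟩ := exists_subseq_tendsto_ae fun ψ => hu ψ
  have hu' : ∀ ψ, Tendsto (fun i => X.xiSeminorm ψ ((u (ns i) : X.Space) - f)) atTop (𝓝 0) :=
    fun ψ => (hu ψ).comp hns.tendsto_atTop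
  -- Along a further subsequence the images converge a.e. to `S f` as well. Non-singularity of `φ`
  -- transports the a.e. convergence `u → f` to `u ∘ φ → f ∘ φ`, and the two limits agree.
  obtain ⟨ms, hms, h2⟩ := exists_subseq_tendsto_ae fun ψ => hS.tendsto_apply ψ (hu' ψ)
  have h3 : ∀ᵐ x ∂μ, ∀ k, (S (u k) : R →ₘ[μ] ℂ) x =
      ((u k : X.Space) : R →ₘ[μ] ℂ) (φ x) := by
    refine ae_all_iff.2 fun k => ?_
    rw [hS.apply_eq (u k : X.Space) ⟨(u k).1.1, (u k).2⟩ rfl, hW]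
    exact AEEqFun.coeFn_compQuasiMeasurePreserving _ hφ
  refine AEEqFun.ext ?_
  filter_upwards [h2, h3, hφ.ae h1,
    AEEqFun.coeFn_compQuasiMeasurePreserving (f : R →ₘ[μ] ℂ) hφ] with x h4 h5 h6 h7
  rw [h7]
  simp only [h5] at h4
  exact tendsto_nhds_unique h4 (h6.comp hms.tendsto_atTop)

theorem isClosed_setOf_nonneg : IsClosed {z : ℂ | 0 ≤ z.re ∧ z.im = 0} :=
  (isClosed_le continuous_const Complex.continuous_re).inter
    (isClosed_eq Complex.continuous_im continuous_const)

/-- Composition preserves non-negativity, hence so do the means, and a subsequence of the means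
converges a.e. to `T f`. -/
theorem IsCompositionOperator.isPositiveOperator_limit {φ : R → R}
    {hφ : Measure.QuasiMeasurePreserving φ μ μ} {S T : X.Space →ₗ[ℂ] X.Space}
    (hS : IsCompositionOperator X hφ S)
    (hlim : ∀ f ψ, Tendsto (fun n => X.xiSeminorm ψ (cesaroMean S n f - T f)) atTop (𝓝 0)) :
    X.IsPositiveOperator T := by
  intro f hf
  have hpow : ∀ i, ∀ᵐ x ∂μ, ((S ^ i) f : R →ₘ[μ] ℂ) x ∈ {z : ℂ | 0 ≤ z.re ∧ z.im = 0} :=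
    fun i => by
      induction i with
      | zero => exact hf
      | succ i ih =>
        rw [pow_succ', Module.End.mul_apply, hS]
        filter_upwards [hφ.ae ih, AEEqFun.coeFn_compQuasiMeasurePreserving
          ((S ^ i) f : R →ₘ[μ] ℂ) hφ] with x h1 h2
        rw [h2]
        exact h1
  have hsum : ∀ n, ∀ᵐ x ∂μ, ((∑ i ∈ Finset.range n, (S ^ i) f : X.Space) : R →ₘ[μ] ℂ) x ∈
      {z : ℂ | 0 ≤ z.re ∧ z.im = 0} := fun n => by
    induction n with
    | zero =>
      filter_upwards [AEEqFun.coeFn_zero (μ := μ) (β := ℂ)] with x hx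
      rw [Finset.range_zero, Finset.sum_empty, coe_zero, hx]
      simp
    | succ n ih =>
      filter_upwards [ih, hpow n, AEEqFun.coeFn_add
        ((∑ i ∈ Finset.range n, (S ^ i) f : X.Space) : R →ₘ[μ] ℂ) ((S ^ n) f : R →ₘ[μ] ℂ)]
        with x h1 h2 h3
      rw [Finset.sum_range_succ, coe_add, h3]
      exact ⟨add_nonneg h1.1 h2.1, by
        rw [Pi.add_apply, Complex.add_im, h1.2, h2.2, add_zero]⟩
  have hmean : ∀ᵐ x ∂μ, ∀ n, ((cesaroMean S n f : X.Space) : R →ₘ[μ] ℂ) x ∈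
      {z : ℂ | 0 ≤ z.re ∧ z.im = 0} := by
    refine ae_all_iff.2 fun n => ?_
    filter_upwards [hsum n, AEEqFun.coeFn_smul (n : ℂ)⁻¹
      ((∑ i ∈ Finset.range n, (S ^ i) f : X.Space) : R →ₘ[μ] ℂ)] with x h1 h2
    rw [cesaroMean, coe_smul, h2, Pi.smul_apply, smul_eq_mul]
    have h3 : ((n : ℂ)⁻¹) = (((n : ℝ)⁻¹ : ℝ) : ℂ) := by simp
    rw [h3]
    exact ⟨by rw [Complex.re_ofReal_mul]; exact mul_nonneg (by positivity) h1.1,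
      by rw [Complex.im_ofReal_mul, h1.2, mul_zero]⟩
  obtain ⟨ns, -, hns⟩ := exists_subseq_tendsto_ae fun ψ => hlim f ψ
  filter_upwards [hmean, hns] with x h1 h2
  exact isClosed_setOf_nonneg.mem_of_tendsto h2 (Eventually.of_forall fun i => h1 (ns i))

end Composition

end RIBanachFunctionNorm

/-! ### The main theorem -/

theorem mainTheorem2 {R : Type*} [MeasurableSpace R] (μ : Measure R) [SigmaFinite μ]
    [IsResonant μ] (X : RIBanachFunctionNorm μ) (hX : X.HasACR) (hX' : X.associate.HasACR)
    (φ : R → R) (hφ : PowerMeasureBounded μ φ) :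
    ∃ (Tφ T : X.Space →ₗ[ℂ] X.Space)
      (Tφ' T' : X.associate.Space →ₗ[ℂ] X.associate.Space),
      IsCompositionOperator X hφ.quasiMeasurePreserving Tφ ∧
      X.IsAssociateOperator Tφ Tφ' ∧
      IsMeanErgodicWithLimit X.xi Tφ T ∧
      X.IsPositiveOperator T ∧
      Continuous[X.weakPrime, X.weakPrime] T ∧
      Continuous[X.normTopology, X.normTopology] T ∧
      X.IsAssociateOperator T T' ∧
      Continuous[X.associate.normTopology, X.associate.normTopology] T' ∧
      Continuous[X.associate.weakPrime, X.associate.weakPrime] T' ∧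
      IsMeanErgodicWithLimit X.associate.xi Tφ' T' ∧
      LinearMap.IsProj (LinearMap.ker (LinearMap.id - Tφ)) T ∧
      LinearMap.IsProj (LinearMap.ker (LinearMap.id - Tφ')) T' ∧
      LinearMap.IsProj (X.xiClosure (LinearMap.range (LinearMap.id - Tφ))) (LinearMap.id - T) ∧
      LinearMap.IsProj (X.associate.xiClosure (LinearMap.range (LinearMap.id - Tφ')))
        (LinearMap.id - T') ∧
      IsCompl (LinearMap.ker (LinearMap.id - Tφ)) (X.xiClosure (LinearMap.range (LinearMap.id - Tφ))) ∧
      IsCompl (LinearMap.ker (LinearMap.id - Tφ'))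
        (X.associate.xiClosure (LinearMap.range (LinearMap.id - Tφ'))) := by
  obtain ⟨A, V, V', Q, Q', hVc, hV, hV', hQ, hQ', hVV', hQQ', hlim, hlim'⟩ :=
    exists_L2_operators hφ
  -- The statements on `X'` use the pair `X'`, `X''`, so (ACR) is needed for `X''` too.
  have hX'' := RIBanachFunctionNorm.hasACR_associate_associate hX
  have hV1 : PairingBounded A V := by simpa using hV 1
  have hV1' : PairingBounded A V' := by simpa using hV' 1
  obtain ⟨S, hS⟩ := RIBanachFunctionNorm.exists_isExtension hX hV1
  obtain ⟨S', hS'⟩ := RIBanachFunctionNorm.exists_isExtension hX' hV1'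
  obtain ⟨T, hT⟩ := RIBanachFunctionNorm.exists_isExtension hX hQ
  obtain ⟨T', hT'⟩ := RIBanachFunctionNorm.exists_isExtension hX' hQ'
  have hcomp := hS.isCompositionOperator hX hφ.quasiMeasurePreserving hVc
  have hTT' := hT.isAssociateOperator hX hX' hT' hQQ'
  have hproj := hS.isProj hX hX' hT hV hQ hlim
  have hproj' := hS'.isProj hX' hX'' hT' hV' hQ' hlim'
  exact ⟨S, T, S', T', hcomp, hS.isAssociateOperator hX hX' hS' hVV',
    hS.isMeanErgodicWithLimit hX hX' hT hV hQ hlim,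
    RIBanachFunctionNorm.IsCompositionOperator.isPositiveOperator_limit hcomp fun f ψ =>
      hS.tendsto_cesaroMean hX hX' hT hV hQ hlim ψ f,
    RIBanachFunctionNorm.IsAssociateOperator.continuous_weakPrime hTT', hT.continuous_norm, hTT',
    hT'.continuous_norm,
    RIBanachFunctionNorm.IsAssociateOperator.continuous_weakPrime_associate hTT',
    hS'.isMeanErgodicWithLimit hX' hX'' hT' hV' hQ' hlim', hproj.1, hproj'.1, hproj.2.1,
    hproj'.2.1, hproj.2.2, hproj'.2.2⟩
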